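/- **Setting.** Let $\mathbb D$ be the term model of the simply typed $\lambda$-calculus with types $A ::= \mathsf{tm}\mid \mathsf{unit}\mid A\times B\mid A\to B$ and constants $\mathsf{app}:\mathsf{tm}\to\mathsf{tm}\to\mathsf{tm}$ and $\mathsf{lam}:(\mathsf{tm}\to\mathsf{tm})\to\mathsf{tm}$: its objects are the typing contexts and its morphisms $\Phi\to\Psi$ are the tuples of terms in context $\Phi$, one for each variable of $\Psi$, modulo $\beta\eta$. Write $\top$ for the empty context, $\mathsf{times}\,\Phi\,A$ for the extension of $\Phi$ by a variable of type $A$, with projections $\mathsf{fst},\mathsf{snd}$, and $\widehat{\mathbb D}$ for the category of presheaves on $\mathbb D$. Let $\mathrm{El}\,c$ be the representable presheaf of $c\in\mathbb D$, $\mathrm{Obj}$ the constant presheaf on the set of objects of $\mathbb D$, $X\to Y$ the exponential in $\widehat{\mathbb D}$, $\mathrm{El}\,c\to_v\mathrm{El}\,A$ the subpresheaf of $\mathrm{El}\,c\to\mathrm{El}\,A$ consisting of the projections $\mathsf{snd}\circ\mathsf{fst}^k$, and $\flat:\widehat{\mathbb D}\to\widehat{\mathbb D}$ the functor that takes $F$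 to the constant presheaf on $F(\top)$. The crisp function space $(x::X)\to^\flat Y$ is the dependent product over $\flat X$. **Simply-typed Cocon.** Domain types are $A::=\mathsf{tm}\mid A\to B$, domain contexts $\Psi::=\cdot\mid\psi\mid\Psi,x{:}A$ with $\psi$ a context variable. Computation types are $\tau::=[\Psi\vdash A]\mid[\Psi\vdash_v A]\mid \tau_1\Rightarrow\tau_2\mid(\psi:\mathsf{ctx})\Rightarrow\tau$, computation contexts $\Gamma::=\cdot\mid\Gamma,y{:}\tau\mid\Gamma,\psi{:}\mathsf{ctx}$; $\check\tau$ stands for a computation type or $\mathsf{ctx}$, the terms of type $\mathsf{ctx}$ being the domain contexts. The judgments are: - $\Gamma;\Psi\vdash M:A$, with $M::=x\mid\mathsf{app}\mid\mathsf{lam}\mid M\,N\mid\lambda x.M\mid\lfloor t\rfloor_\sigma$, where $t:[\Phi\vdash A]$ or $t:[\Phi\vdash_v A]$ and $\Gamma;\Psi\vdash\sigma:\Phi$; - $\Gamma;\Psi\vdash\sigma:\Phi$, with $\sigma::=\mathsf{wk}_\Phi$ (if $\Psi=\Phi,\vec x{:}\vec A$) $\mid\cdot\mid\sigma,M$; -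 $\Gamma\vdash C:(\Psi\vdash_v A)$, with $C$ a variable of $\Psi$ or $\lfloor t\rfloor_{\mathsf{wk}_\Phi}$ for $t:[\Phi\vdash_v A]$ and $\Psi=\Phi,\vec x{:}\vec A$; - $\Gamma\vdash t:\tau$, with $t$ a variable, a boxed domain term or contextual object $[C]$, an abstraction or application for either function type, or a recursor $\mathsf{rec}^{\tau}(t_v,t_{\mathsf{app}},t_{\mathsf{lam}})\,\Psi\,t:[\Psi/\psi]\tau$ for $t:[\Psi\vdash\mathsf{tm}]$, with branches $\Gamma,\psi{:}\mathsf{ctx},p{:}[\psi\vdash_v\mathsf{tm}]\vdash t_v:\tau$, $\Gamma,\psi{:}\mathsf{ctx},m{:}[\psi\vdash\mathsf{tm}],n{:}[\psi\vdash\mathsf{tm}],f_m{:}\tau,f_n{:}\tau\vdash t_{\mathsf{app}}:\tau$, $\Gamma,\psi{:}\mathsf{ctx},m{:}[\psi,x{:}\mathsf{tm}\vdash\mathsf{tm}],f_m{:}[(\psi,x{:}\mathsf{tm})/\psi]\tau\vdash t_{\mathsf{lam}}:\tau$. Judgmental equality $\equiv$ is generated, on well-typed terms of the same type, by reflexivity,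 symmetry, transitivity and congruence for all term formers together with: $\beta$ and $\eta$ for domain functions; $\lfloor[M]\rfloor_\sigma\equiv[\sigma]M$ and $t\equiv[\lfloor t\rfloor_{\mathsf{wk}_\Psi}]$ for $[\Psi\vdash A]$ and likewise for $[\Psi\vdash_v A]$; $\sigma\equiv\cdot$ for $\sigma:\cdot$ and $\mathsf{wk}_{\Psi,x:A}\equiv\mathsf{wk}_\Psi,x$; $\beta$ and $\eta$ for both computation function types; and the three reductions of $\mathsf{rec}$, on a boxed variable or $\lfloor t\rfloor_{\mathsf{wk}}$ of type $\Psi\vdash_v\mathsf{tm}$, on $[\mathsf{app}\,M\,N]$ and on $[\mathsf{lam}\,(\lambda x.M)]$. Equality at $\mathsf{ctx}$ is identity of contexts. **Interpretation.** $[\![\cdot]\!]=\top$, $[\![\psi]\!]=\psi$ and $[\![\Psi,x{:}A]\!]=\mathsf{times}\,[\![\Psi]\!]\,[\![A]\!]$ are of type $\mathrm{Obj}$; $[\![\mathsf{ctx}]\!]=\mathrm{Obj}$, $[\![\Psi\vdash A]\!]=\flat(\mathrm{El}[\![\Psi]\!]\to\mathrm{El}[\![A]\!])$, $[\![\Psi\vdash_v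 A]\!]=\flat(\mathrm{El}[\![\Psi]\!]\to_v\mathrm{El}[\![A]\!])$, function types are interpreted as crisp function spaces, and $[\![\Gamma]\!]$ is the context of crisp variables $[\![\Gamma]\!],y::[\![\tau]\!]$, resp. $[\![\Gamma]\!],\psi::\mathrm{Obj}$. A domain term $\Gamma;\Psi\vdash M:A$ and a substitution $\Gamma;\Psi\vdash\sigma:\Phi$ are interpreted as terms $\mathrm{El}[\![\Psi]\!]\to\mathrm{El}[\![A]\!]$ and $\mathrm{El}[\![\Psi]\!]\to\mathrm{El}[\![\Phi]\!]$ in context $[\![\Gamma]\!]$, and $\Gamma\vdash t:\check\tau$ as a term of type $[\![\check\tau]\!]$ in context $[\![\Gamma]\!]$, by recursion on derivations: variables and weakenings by projections; boxes by the introduction of $\flat$; $\lfloor t\rfloor_\sigma$ by $\mathsf{let\ box}\ x=[\![t]\!]\ \mathsf{in}\ \lambda u.\,x([\![\sigma]\!]u)$; $\lambda$, application and the constants by the structure of $\mathbb D$; computation functions by crisp abstraction and application; and the recursor by recursion over the elements of $\flat(\mathrm{El}\,c\to\mathrm{El}\,\mathsf{tm})$, that is, over domain terms of type $\mathsf{tm}$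 in context $c$ up to $\beta\eta$, by cases on whether the term is a variable, $\mathsf{app}\,m\,n$ or $\mathsf{lam}\,(\lambda x.m)$. On a term that is none of these, such as $f\,m$ with $f:\mathsf{tm}\to\mathsf{tm}$ a variable, its value is fixed to be that of $t_{\mathsf{lam}}$ at the last variable $x$ of $c,x{:}\mathsf{tm}$, with the value of $t_v$ at $x$ as recursive call. **Proposition (Soundness).** 1. If $\Gamma;\Psi\vdash M\equiv N:A$, then $[\![\Gamma;\Psi\vdash M:A]\!]=[\![\Gamma;\Psi\vdash N:A]\!]$, as terms of type $\mathrm{El}[\![\Psi]\!]\to\mathrm{El}[\![A]\!]$ in context $[\![\Gamma]\!]$ in $\widehat{\mathbb D}$. 2. If $\Gamma;\Psi\vdash\sigma\equiv\sigma':\Phi$, then $[\![\Gamma;\Psi\vdash\sigma:\Phi]\!]=[\![\Gamma;\Psi\vdash\sigma':\Phi]\!]$, as terms of type $\mathrm{El}[\![\Psi]\!]\to\mathrm{El}[\![\Phi]\!]$ in context $[\![\Gamma]\!]$. 3. If $\Gamma\vdash t_1\equiv t_2:\check\tau$, then $[\![\Gamma\vdash t_1:\check\tau]\!]=[\![\Gamma\vdash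 t_2:\check\tau]\!]$, as terms of type $[\![\check\tau]\!]$ in context $[\![\Gamma]\!]$. 4. $\flat$ is strictly idempotent: $\flat\circ\flat=\flat$ as functors. -/

import Mathlib

open CategoryTheory Opposite

namespace Cocon

/-! ## The domain-level calculus and its term model -/

/-- Simple types: the base type `tm`, unit, products and functions. -/
inductive STy : Type
  | tm : STy
  | unit : STy
  | prod (A B : STy) : STy
  | arr (A B : STy) : STy

/-- `SVar Φ A`: de Bruijn variables of type `A` in the context `Φ` (head of the list = last
declared variable). -/
inductive SVar : List STy → STy → Type
  | zero {Φ : List STy} {A : STy} : SVar (A :: Φ) A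
  | succ {Φ : List STy} {A B : STy} (x : SVar Φ A) : SVar (B :: Φ) A

/-- Simply typed terms `Φ ⊢ t : A` with the constants `app : tm → tm → tm` and
`lam : (tm → tm) → tm`. -/
inductive STm : List STy → STy → Type
  | var {Φ : List STy} {A : STy} (x : SVar Φ A) : STm Φ A
  | lam {Φ : List STy} {A B : STy} (t : STm (A :: Φ) B) : STm Φ (.arr A B)
  | app {Φ : List STy} {A B : STy} (t : STm Φ (.arr A B)) (u : STm Φ A) : STm Φ B
  | pair {Φ : List STy} {A B : STy} (t : STm Φ A) (u : STm Φ B) : STm Φ (.prod A B)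
  | fst {Φ : List STy} {A B : STy} (t : STm Φ (.prod A B)) : STm Φ A
  | snd {Φ : List STy} {A B : STy} (t : STm Φ (.prod A B)) : STm Φ B
  | unit {Φ : List STy} : STm Φ .unit
  | cApp {Φ : List STy} : STm Φ (.arr .tm (.arr .tm .tm))
  | cLam {Φ : List STy} : STm Φ (.arr (.arr .tm .tm) .tm)

/-- Variable renamings. -/
abbrev SRen (Φ Ψ : List STy) : Type := ∀ A, SVar Ψ A → SVar Φ A

/-- `STup Φ Ψ`: tuples of terms in context `Φ`, one for each variable of `Ψ`. -/
abbrev STup (Φ Ψ : List STy) : Type := ∀ A, SVar Ψ A → STm Φ A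

def SRen.lift {Φ Ψ : List STy} (ρ : SRen Φ Ψ) (B : STy) : SRen (B :: Φ) (B :: Ψ)
  | _, .zero => .zero
  | _, .succ x => .succ (ρ _ x)

def STm.ren {Φ Ψ : List STy} {A : STy} : STm Ψ A → SRen Φ Ψ → STm Φ A
  | .var x, ρ => .var (ρ _ x)
  | .lam t, ρ => .lam (t.ren (ρ.lift _))
  | .app t u, ρ => .app (t.ren ρ) (u.ren ρ)
  | .pair t u, ρ => .pair (t.ren ρ) (u.ren ρ)
  | .fst t, ρ => .fst (t.ren ρ)
  | .snd t, ρ => .snd (t.ren ρ)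
  | .unit, _ => .unit
  | .cApp, _ => .cApp
  | .cLam, _ => .cLam

/-- Weakening by one variable. -/
def STm.wk {Φ : List STy} {A : STy} (t : STm Φ A) (B : STy) : STm (B :: Φ) A :=
  t.ren fun _ x => .succ x

def STup.lift {Φ Ψ : List STy} (σ : STup Φ Ψ) (B : STy) : STup (B :: Φ) (B :: Ψ)
  | _, .zero => .var .zero
  | _, .succ x => (σ _ x).wk B

/-- Simultaneous capture-avoiding substitution. -/
def STm.sub {Φ Ψ : List STy} {A : STy} : STm Ψ A → STup Φ Ψ → STm Φ A
  | .var x, σ => σ _ x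
  | .lam t, σ => .lam (t.sub (STup.lift σ _))
  | .app t u, σ => .app (t.sub σ) (u.sub σ)
  | .pair t u, σ => .pair (t.sub σ) (u.sub σ)
  | .fst t, σ => .fst (t.sub σ)
  | .snd t, σ => .snd (t.sub σ)
  | .unit, _ => .unit
  | .cApp, _ => .cApp
  | .cLam, _ => .cLam

/-- Extension of a tuple by one term. -/
def STup.cons {Φ Ψ : List STy} (σ : STup Φ Ψ) {B : STy} (u : STm Φ B) : STup Φ (B :: Ψ)
  | _, .zero => u
  | _, .succ x => σ _ x

/-- The identity tuple. -/
def STup.id (Φ : List STy) : STup Φ Φ := fun _ x => .var x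

/-- `βη`-equality. -/
inductive STm.Eqv : {Φ : List STy} → {A : STy} → STm Φ A → STm Φ A → Prop
  | refl {Φ : List STy} {A : STy} (t : STm Φ A) : Eqv t t
  | symm {Φ : List STy} {A : STy} {t u : STm Φ A} : Eqv t u → Eqv u t
  | trans {Φ : List STy} {A : STy} {t u v : STm Φ A} : Eqv t u → Eqv u v → Eqv t v
  | lam {Φ : List STy} {A B : STy} {t t' : STm (A :: Φ) B} : Eqv t t' → Eqv (.lam t) (.lam t')
  | app {Φ : List STy} {A B : STy} {t t' : STm Φ (.arr A B)} {u u' : STm Φ A} :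
      Eqv t t' → Eqv u u' → Eqv (.app t u) (.app t' u')
  | pair {Φ : List STy} {A B : STy} {t t' : STm Φ A} {u u' : STm Φ B} :
      Eqv t t' → Eqv u u' → Eqv (.pair t u) (.pair t' u')
  | fst {Φ : List STy} {A B : STy} {t t' : STm Φ (.prod A B)} :
      Eqv t t' → Eqv (.fst t) (.fst t')
  | snd {Φ : List STy} {A B : STy} {t t' : STm Φ (.prod A B)} :
      Eqv t t' → Eqv (.snd t) (.snd t')
  | beta {Φ : List STy} {A B : STy} (t : STm (A :: Φ) B) (u : STm Φ A) :
      Eqv (.app (.lam t) u) (t.sub (STup.cons (STup.id Φ) u))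
  | eta {Φ : List STy} {A B : STy} (t : STm Φ (.arr A B)) :
      Eqv t (.lam (.app (t.wk A) (.var .zero)))
  | fst_pair {Φ : List STy} {A B : STy} (t : STm Φ A) (u : STm Φ B) : Eqv (.fst (.pair t u)) t
  | snd_pair {Φ : List STy} {A B : STy} (t : STm Φ A) (u : STm Φ B) : Eqv (.snd (.pair t u)) u
  | pair_eta {Φ : List STy} {A B : STy} (t : STm Φ (.prod A B)) : Eqv t (.pair (.fst t) (.snd t))
  | unit_eta {Φ : List STy} (t : STm Φ .unit) : Eqv t .unit

theorem STup.lift_id (Φ : List STy) (B : STy) : STup.lift (STup.id Φ) B = STup.id (B :: Φ) := by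
  funext A x; cases x <;> rfl

theorem STm.sub_id {Φ : List STy} {A : STy} (t : STm Φ A) : t.sub (STup.id Φ) = t := by
  induction t with
  | lam t ih => simp only [STm.sub, STup.lift_id, ih]
  | _ => simp_all [STm.sub, STup.id]

theorem STm.ren_ren {Φ Ψ Ξ : List STy} {A : STy} (t : STm Ξ A) (ρ : SRen Ψ Ξ) (ρ' : SRen Φ Ψ) :
    (t.ren ρ).ren ρ' = t.ren (fun _ x => ρ' _ (ρ _ x)) := by
  induction t generalizing Φ Ψ with
  | lam t ih =>
    simp only [STm.ren, ih]
    congr 2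
    funext A x; cases x <;> rfl
  | _ => simp_all [STm.ren]

theorem STm.ren_sub {Φ Ψ Ξ : List STy} {A : STy} (t : STm Ξ A) (ρ : SRen Ψ Ξ) (σ : STup Φ Ψ) :
    (t.ren ρ).sub σ = t.sub (fun _ x => σ _ (ρ _ x)) := by
  induction t generalizing Φ Ψ with
  | lam t ih =>
    simp only [STm.ren, STm.sub, ih]
    congr 2
    funext A x; cases x <;> rfl
  | _ => simp_all [STm.ren, STm.sub]

theorem STm.sub_ren {Φ Ψ Ξ : List STy} {A : STy} (t : STm Ξ A) (σ : STup Ψ Ξ) (ρ : SRen Φ Ψ) :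
    (t.sub σ).ren ρ = t.sub (fun _ x => (σ _ x).ren ρ) := by
  induction t generalizing Φ Ψ with
  | lam t ih =>
    simp only [STm.ren, STm.sub, ih]
    congr 2
    funext A x
    cases x with
    | zero => rfl
    | succ x => simp only [STup.lift, STm.wk, STm.ren_ren]; rfl
  | _ => simp_all [STm.ren, STm.sub]

theorem STm.sub_sub {Φ Ψ Ξ : List STy} {A : STy} (t : STm Ξ A) (σ : STup Ψ Ξ) (τ : STup Φ Ψ) :
    (t.sub σ).sub τ = t.sub (fun _ x => (σ _ x).sub τ) := by
  induction t generalizing Φ Ψ with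
  | lam t ih =>
    simp only [STm.sub, ih]
    congr 2
    funext A x
    cases x with
    | zero => rfl
    | succ x => simp only [STup.lift, STm.wk, STm.ren_sub, STm.sub_ren]
  | _ => simp_all [STm.sub]

theorem STm.ren_eq_sub {Φ Ψ : List STy} {A : STy} (t : STm Ψ A) (ρ : SRen Φ Ψ) :
    t.ren ρ = t.sub (fun _ x => .var (ρ _ x)) := by
  have h := STm.sub_ren t (STup.id Ψ) ρ
  rwa [STm.sub_id] at h

theorem STm.Eqv.sub {Φ Ψ : List STy} {A : STy} {t t' : STm Ψ A} (h : STm.Eqv t t')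
    (σ : STup Φ Ψ) : STm.Eqv (t.sub σ) (t'.sub σ) := by
  induction h generalizing Φ with
  | refl t => exact .refl _
  | symm _ ih => exact .symm (ih σ)
  | trans _ _ ih ih' => exact .trans (ih σ) (ih' σ)
  | lam _ ih => exact .lam (ih _)
  | app _ _ ih ih' => exact .app (ih σ) (ih' σ)
  | pair _ _ ih ih' => exact .pair (ih σ) (ih' σ)
  | fst _ ih => exact .fst (ih σ)
  | snd _ ih => exact .snd (ih σ)
  | beta t u =>
    refine (STm.Eqv.beta (t.sub (STup.lift σ _)) (u.sub σ)).trans ?_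
    rw [STm.sub_sub, STm.sub_sub]
    have : (fun B x => (STup.lift σ _ B x).sub (STup.cons (STup.id Φ) (u.sub σ))) =
        fun B x => (STup.cons (STup.id _) u B x).sub σ := by
      funext B x
      cases x with
      | zero => rfl
      | succ x =>
        simp only [STup.lift, STm.wk, STm.ren_sub]
        exact STm.sub_id _
    rw [this]
    exact .refl _
  | eta t =>
    refine (STm.Eqv.eta (t.sub σ)).trans ?_
    simp only [STm.sub, STm.wk, STm.ren_sub, STm.sub_ren]
    exact .refl _
  | fst_pair t u => exact .fst_pair _ _
  | snd_pair t u => exact .snd_pair _ _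
  | pair_eta t => exact .pair_eta _
  | unit_eta t => exact .unit_eta _

theorem STm.Eqv.wk {Φ : List STy} {A : STy} {t t' : STm Φ A} (h : STm.Eqv t t') (B : STy) :
    STm.Eqv (t.wk B) (t'.wk B) := by
  simp only [STm.wk, STm.ren_eq_sub]; exact h.sub _

theorem STm.sub_congr {Φ Ψ : List STy} {A : STy} (t : STm Ψ A) {σ σ' : STup Φ Ψ}
    (h : ∀ A x, STm.Eqv (σ A x) (σ' A x)) : STm.Eqv (t.sub σ) (t.sub σ') := by
  induction t generalizing Φ with
  | var x => exact h _ x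
  | lam t ih =>
    refine .lam (ih fun A x => ?_)
    cases x with
    | zero => exact .refl _
    | succ x => exact (h _ x).wk _
  | app t u ih ih' => exact .app (ih h) (ih' h)
  | pair t u ih ih' => exact .pair (ih h) (ih' h)
  | fst t ih => exact .fst (ih h)
  | snd t ih => exact .snd (ih h)
  | unit => exact .refl _
  | cApp => exact .refl _
  | cLam => exact .refl _

/-- Objects of the term model `𝔻`: contexts of simple types. -/
def Dom : Type := List STy

/-- Tuples of terms up to `βη`-equality. -/
instance STup.setoid (Φ Ψ : List STy) : Setoid (STup Φ Ψ) where
  r σ σ' := ∀ A x, STm.Eqv (σ A x) (σ' A x)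
  iseqv := ⟨fun _ _ _ => .refl _, fun h A x => .symm (h A x),
    fun h h' A x => .trans (h A x) (h' A x)⟩

/-- The term model `𝔻`: a morphism `Φ ⟶ Ψ` is a tuple of terms in context `Φ`, one for each
variable of `Ψ`, up to `βη`-equality; composition is substitution. -/
instance : SmallCategory Dom where
  Hom Φ Ψ := Quotient (STup.setoid Φ Ψ)
  id Φ := Quotient.mk _ (STup.id Φ)
  comp {Φ Ψ Ξ} := Quotient.map₂ (fun (σ : STup Φ Ψ) (τ : STup Ψ Ξ) A x => (τ A x).sub σ)
    (fun _ _ h τ _ h' A x => (STm.sub_congr (τ A x) h).trans ((h' A x).sub _))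
  id_comp := by
    rintro Φ Ψ ⟨σ⟩
    exact congrArg (Quotient.mk _) (funext fun A => funext fun x => STm.sub_id _)
  comp_id := by
    rintro Φ Ψ ⟨σ⟩
    rfl
  assoc := by
    rintro Φ Ψ Ξ Ω ⟨σ⟩ ⟨τ⟩ ⟨υ⟩
    exact congrArg (Quotient.mk _) (funext fun A => funext fun x => (STm.sub_sub _ _ _).symm)

namespace Dom

/-- The empty context. -/
def unit : Dom := ([] : List STy)

/-- A type seen as an object: the context with a single variable. -/
def one (A : STy) : Dom := [A]

/-- `times Φ A`: the concatenation of `Φ` with the single-variable context `A`. -/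
def times (Φ : Dom) (A : STy) : Dom := List.cons A Φ

def toUnit (Φ : Dom) : Φ ⟶ unit := Quotient.mk _ (fun _ x => nomatch x : STup Φ [])

theorem toUnit_unique {Φ : Dom} (f g : Φ ⟶ unit) : f = g := by
  obtain ⟨f⟩ := f
  obtain ⟨g⟩ := g
  exact congrArg (Quotient.mk _) (funext fun _ => funext fun x : SVar [] _ => nomatch x)

def fst {Φ : Dom} {A : STy} : times Φ A ⟶ Φ :=
  Quotient.mk _ (fun _ x => .var (.succ x) : STup (A :: Φ) Φ)

/-- The one-component tuple. -/
def tup {Φ : List STy} {A : STy} (t : STm Φ A) : STup Φ [A] := STup.cons (Ψ := []) (fun _ x => nomatch x) t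

def snd {Φ : Dom} {A : STy} : times Φ A ⟶ one A :=
  Quotient.mk _ (tup (.var .zero) : STup (A :: Φ) [A])

def pair {Φ Ψ : Dom} {A : STy} : (Φ ⟶ Ψ) → (Φ ⟶ one A) → (Φ ⟶ times Ψ A) :=
  Quotient.map₂ (fun (σ : STup Φ Ψ) (t : STup Φ [A]) => STup.cons σ (t A .zero))
    (fun _ _ h _ _ h' _ x => match x with
      | .zero => h' _ .zero
      | .succ x => h _ x)

def lam {Φ : Dom} {A B : STy} : (times Φ A ⟶ one B) → (Φ ⟶ one (.arr A B)) :=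
  Quotient.map (fun (t : STup (A :: Φ) [B]) => tup (.lam (t B .zero)))
    (fun _ _ h _ x => match x with
      | .zero => .lam (h _ .zero))

def app {Φ : Dom} {A B : STy} : (Φ ⟶ one (.arr A B)) → (Φ ⟶ one A) → (Φ ⟶ one B) :=
  Quotient.map₂ (fun (t : STup Φ [.arr A B]) (u : STup Φ [A]) => tup (.app (t _ .zero) (u _ .zero)))
    (fun _ _ h _ _ h' _ x => match x with
      | .zero => .app (h _ .zero) (h' _ .zero))

def cApp (Φ : Dom) : Φ ⟶ one (.arr .tm (.arr .tm .tm)) := Quotient.mk _ (tup .cApp : STup Φ _)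

def cLam (Φ : Dom) : Φ ⟶ one (.arr (.arr .tm .tm) .tm) := Quotient.mk _ (tup .cLam : STup Φ _)

theorem mk_ext {Φ Ψ : List STy} {σ τ : STup Φ Ψ} (h : ∀ A x, σ A x = τ A x) :
    Quotient.mk (STup.setoid Φ Ψ) σ = Quotient.mk _ τ :=
  congrArg _ (funext fun A => funext fun x => h A x)

theorem comp_pair {Φ Ψ Ξ : Dom} {A : STy} (δ : Ξ ⟶ Φ) (σ : Φ ⟶ Ψ) (t : Φ ⟶ one A) :
    δ ≫ pair σ t = pair (δ ≫ σ) (δ ≫ t) := by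
  obtain ⟨δ⟩ := δ
  obtain ⟨σ⟩ := σ
  obtain ⟨t⟩ := t
  exact mk_ext fun _ x => match x with
    | .zero => rfl
    | .succ x => rfl

theorem pair_fst {Φ Ψ : Dom} {A : STy} (σ : Φ ⟶ Ψ) (t : Φ ⟶ one A) : pair σ t ≫ fst = σ := by
  obtain ⟨σ⟩ := σ
  obtain ⟨t⟩ := t
  rfl

theorem pair_snd {Φ Ψ : Dom} {A : STy} (σ : Φ ⟶ Ψ) (t : Φ ⟶ one A) : pair σ t ≫ snd = t := by
  obtain ⟨σ⟩ := σ
  obtain ⟨t⟩ := t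
  exact mk_ext fun _ x => match x with
    | .zero => rfl

theorem comp_lam {Φ Ψ : Dom} {A B : STy} (δ : Ψ ⟶ Φ) (t : times Φ A ⟶ one B) :
    δ ≫ lam t = lam (pair (fst ≫ δ) snd ≫ t) := by
  obtain ⟨δ⟩ := δ
  obtain ⟨t⟩ := t
  refine mk_ext fun _ x => match x with
    | .zero => ?_
  change STm.lam _ = STm.lam _
  congr 2
  funext C y
  cases y with
  | zero => rfl
  | succ y => exact STm.ren_eq_sub _ _

theorem comp_app {Φ Ψ : Dom} {A B : STy} (δ : Ψ ⟶ Φ) (t : Φ ⟶ one (.arr A B)) (u : Φ ⟶ one A) :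
    δ ≫ app t u = app (δ ≫ t) (δ ≫ u) := by
  obtain ⟨δ⟩ := δ
  obtain ⟨t⟩ := t
  obtain ⟨u⟩ := u
  exact mk_ext fun _ x => match x with
    | .zero => rfl

theorem comp_cApp {Φ Ψ : Dom} (δ : Ψ ⟶ Φ) : δ ≫ cApp Φ = cApp Ψ := by
  obtain ⟨δ⟩ := δ
  exact mk_ext fun _ x => match x with
    | .zero => rfl

theorem comp_cLam {Φ Ψ : Dom} (δ : Ψ ⟶ Φ) : δ ≫ cLam Φ = cLam Ψ := by
  obtain ⟨δ⟩ := δ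
  exact mk_ext fun _ x => match x with
    | .zero => rfl

end Dom

/-! ## The presheaf category `𝔻̂`: `♭`, function spaces, representables -/

/-- The presheaf category `𝔻̂`. -/
abbrev Psh : Type 1 := Domᵒᵖ ⥤ Type

/-- The empty context, as an index of presheaves. -/
abbrev top : Domᵒᵖ := op Dom.unit

/-- The representable presheaf `El c = y(c)`. -/
abbrev El (c : Dom) : Psh := yoneda.obj c

/-- `Obj`: the constant presheaf on the set of objects of `𝔻`. -/
abbrev Obj : Psh := (Functor.const Domᵒᵖ).obj Dom

/-- The comonad `♭`: `♭F` is the constant presheaf on `F(⊤)`. -/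
def flat : Psh ⥤ Psh := (evaluation Domᵒᵖ Type).obj top ⋙ Functor.const Domᵒᵖ

/-- Global elements of a presheaf. -/
def Glob (X : Psh) : Type := X.sections

def Glob.map {X Y : Psh} (m : Glob X) (f : X ⟶ Y) : Glob Y :=
  ⟨fun Φ => f.app Φ (m.1 Φ), fun σ => by
    rw [← NatTrans.naturality_apply]; exact congrArg _ (m.2 σ)⟩

def Glob.cast {X Y : Psh} (h : X = Y) (m : Glob X) : Glob Y := h ▸ m

/-- The counit `♭X ⟶ X` at a closed element: the closed element `x` as a global element of `X`.
This is the lookup of a crisp variable. -/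
def Psh.ofTop (X : Psh) (x : X.obj top) : Glob X :=
  ⟨fun Φ => X.map (Dom.toUnit Φ.unop).op x, by
    intro Φ Ψ f
    rw [← Functor.map_comp_apply]
    exact congrArg (fun g => X.map g x) (Quiver.Hom.unop_inj (Dom.toUnit_unique _ _))⟩

def flatCounit : flat ⟶ 𝟭 Psh where
  app X := { app := fun Φ => ↾fun x => (X.ofTop x).1 Φ
             naturality := by
              intro Φ Ψ f
              ext x
              exact ((X.ofTop x).2 f).symm }
  naturality := by
    intro X Y f
    ext Φ x
    exact (NatTrans.naturality_apply f (Dom.toUnit Φ.unop).op x).symm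

/-- `box m`. -/
def boxIntro {X : Psh} (m : Glob X) : Glob (flat.obj X) := ⟨fun _ => m.1 top, fun _ => rfl⟩

/-- `let box x = m in k x`, where the crisp variable `x` ranges over the closed elements. -/
def letBox {X Y : Psh} (m : Glob (flat.obj X)) (k : X.obj top → Glob Y) : Glob Y := k (m.1 top)

/-- An element of the function space `X ⇒ Y` at stage `Φ`: a coherent family of functions. -/
@[ext]
structure FunAt (X Y : Psh) (Φ : Dom) : Type where
  app : ∀ {Ψ : Dom}, (Ψ ⟶ Φ) → X.obj (op Ψ) → Y.obj (op Ψ)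
  nat : ∀ {Ψ Ψ' : Dom} (δ : Ψ ⟶ Φ) (δ' : Ψ' ⟶ Ψ) (x : X.obj (op Ψ)),
    app (δ' ≫ δ) (X.map δ'.op x) = Y.map δ'.op (app δ x)

/-- The function space `X ⇒ Y` in `𝔻̂`. -/
def Fn (X Y : Psh) : Psh where
  obj Φ := FunAt X Y Φ.unop
  map σ := ↾fun f =>
    { app := fun δ x => f.app (δ ≫ σ.unop) x
      nat := fun δ δ' x => by rw [Category.assoc]; exact f.nat _ _ _ }
  map_id Φ := by
    refine ConcreteCategory.hom_ext _ _ fun f => ?_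
    apply FunAt.ext
    funext Ψ δ x
    change f.app (δ ≫ 𝟙 _) x = f.app δ x
    rw [Category.comp_id]
  map_comp σ τ := by
    refine ConcreteCategory.hom_ext _ _ fun f => ?_
    apply FunAt.ext
    funext Ψ δ x
    change f.app (δ ≫ (σ ≫ τ).unop) x = f.app ((δ ≫ τ.unop) ≫ σ.unop) x
    rw [Category.assoc, unop_comp]

/-- `λ u. f u`. -/
def lamU {X Y : Psh} (f : X ⟶ Y) : Glob (Fn X Y) :=
  ⟨fun _ => { app := fun {Ψ} _ x => f.app (op Ψ) x
              nat := fun _ δ' x => NatTrans.naturality_apply f δ'.op x },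
   fun _ => rfl⟩

/-- `u ↦ m u`. -/
def ap {X Y : Psh} (m : Glob (Fn X Y)) : X ⟶ Y where
  app Φ := ↾fun x => (m.1 Φ).app (𝟙 _) x
  naturality Φ Ψ σ := by
    ext x
    change (m.1 Ψ).app (𝟙 _) (X.map σ x) = Y.map σ ((m.1 Φ).app (𝟙 _) x)
    have h : m.1 Ψ = (Fn X Y).map σ (m.1 Φ) := (m.2 σ).symm
    rw [h]
    change (m.1 Φ).app (𝟙 _ ≫ σ.unop) (X.map σ x) = _
    have := (m.1 Φ).nat (𝟙 _) σ.unop x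
    rw [Category.comp_id] at this
    rw [Category.id_comp]
    exact this

/-- The crisp function space `(x :: X) →♭ Y x`. Since `♭X` is the constant presheaf on `X(⊤)`, it is
the pointwise product over `X(⊤)`. -/
def CrispFn (X : Psh) (Y : X.obj top → Psh) : Psh where
  obj Φ := ∀ x, (Y x).obj Φ
  map σ := ↾fun f x => (Y x).map σ (f x)
  map_id Φ := by
    refine ConcreteCategory.hom_ext _ _ fun (f : ∀ x, _) => funext fun x => ?_
    exact (Y x).map_id_apply Φ (f x)
  map_comp σ τ := by
    refine ConcreteCategory.hom_ext _ _ fun (f : ∀ x, _) => funext fun x => ?_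
    exact (Y x).map_comp_apply σ τ (f x)

/-- `λ♭ x :: X. m x`. -/
def crispLam {X : Psh} {Y : X.obj top → Psh} (m : ∀ x, Glob (Y x)) : Glob (CrispFn X Y) :=
  ⟨fun Φ x => (m x).1 Φ, fun σ => funext fun x => (m x).2 σ⟩

/-- Crisp application `m n`. -/
def crispApp {X : Psh} {Y : X.obj top → Psh} (m : Glob (CrispFn X Y)) (n : Glob X) :
    Glob (Y (n.1 top)) :=
  ⟨fun Φ => m.1 Φ (n.1 top), fun σ => congrFun (m.2 σ) _⟩

/-- The projections `snd ∘ fstᵏ` in `𝔻`. -/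
inductive IsProj : {c : Dom} → {A : STy} → (c ⟶ Dom.one A) → Prop
  | snd {c : Dom} {A : STy} : IsProj (Dom.snd : Dom.times c A ⟶ Dom.one A)
  | fst {c : Dom} {A B : STy} {p : c ⟶ Dom.one A} :
      IsProj p → IsProj ((Dom.fst : Dom.times c B ⟶ c) ≫ p)

/-- `El c ⇒ᵥ El A`: the subpresheaf of `El c ⇒ El A` of those functions that are projections. -/
def FnV (c : Dom) (A : STy) : Psh where
  obj Φ := { f : (Fn (El c) (El (Dom.one A))).obj Φ //
    ∃ p : c ⟶ Dom.one A, IsProj p ∧ ∀ (Ψ : Dom) (δ : Ψ ⟶ Φ.unop) (u : Ψ ⟶ c),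
      FunAt.app f δ u = u ≫ p }
  map σ := ↾fun f => ⟨(Fn (El c) (El (Dom.one A))).map σ f.1, by
    obtain ⟨p, hp, h⟩ := f.2
    exact ⟨p, hp, fun Ψ δ u => h Ψ _ u⟩⟩
  map_id Φ := by
    refine ConcreteCategory.hom_ext _ _ fun f => Subtype.ext ?_
    exact (Functor.map_id_apply _ _ _)
  map_comp σ τ := by
    refine ConcreteCategory.hom_ext _ _ fun f => Subtype.ext ?_
    exact (Functor.map_comp_apply _ _ _ _)

/-- The inclusion of `El c ⇒ᵥ El A` into `El c ⇒ El A`. -/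
def inclV (c : Dom) (A : STy) : FnV c A ⟶ Fn (El c) (El (Dom.one A)) where
  app Φ := ↾fun f => f.1

/-- A projection as a global element of `El c ⇒ᵥ El A`. -/
def projV {c : Dom} {A : STy} (p : c ⟶ Dom.one A) (hp : IsProj p) : Glob (FnV c A) :=
  ⟨fun Φ => ⟨(lamU (yoneda.map p)).1 Φ, p, hp, fun _ _ _ => rfl⟩, fun _ => rfl⟩

/-- `x ↦ λ u. x (f u)` for `x` in `El d →ᵥ El A`. -/
def precompV {c d : Dom} {A : STy} (f : c ⟶ d)
    (hf : ∀ p : d ⟶ Dom.one A, IsProj p → IsProj (f ≫ p)) : FnV d A ⟶ FnV c A where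
  app Φ := ↾fun x =>
    ⟨{ app := fun {Ψ} δ (u : Ψ ⟶ c) => FunAt.app x.1 δ (u ≫ f)
       nat := fun δ δ' u => by
        refine Eq.trans ?_ (FunAt.nat x.1 δ δ' (u ≫ f))
        exact congrArg (FunAt.app x.1 (δ' ≫ δ)) (Category.assoc δ' u f) }, by
      obtain ⟨p, hp, h⟩ := x.2
      exact ⟨f ≫ p, hf p hp, fun Ψ δ u => (h Ψ δ (u ≫ f)).trans (Category.assoc _ _ _)⟩⟩

/-- `arrow-i : (El A ⇒ El B) ⟶ El (A ⇒ B)`. -/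
def arrowI (A B : STy) : Fn (El (Dom.one A)) (El (Dom.one B)) ⟶ El (Dom.one (.arr A B)) where
  app Φ := ↾fun f => Dom.lam (FunAt.app f (Dom.fst : Dom.times Φ.unop A ⟶ Φ.unop) Dom.snd)
  naturality Φ Ψ σ := by
    refine ConcreteCategory.hom_ext _ _ fun (f : FunAt _ _ _) => ?_
    refine Eq.trans ?_ (Dom.comp_lam σ.unop (FunAt.app f Dom.fst Dom.snd)).symm
    refine congrArg Dom.lam (Eq.trans ?_ (f.nat (Dom.fst : Dom.times Φ.unop A ⟶ _)
      (Dom.pair ((Dom.fst : Dom.times Ψ.unop A ⟶ _) ≫ σ.unop) Dom.snd) Dom.snd))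
    refine congrArg₂ (FunAt.app f) (Dom.pair_fst _ _).symm (Dom.pair_snd _ _).symm

/-- The constant `app : El tm → El tm → El tm`, at each stage. -/
def semApp {Φ : Dom} (x y : Φ ⟶ Dom.one .tm) : Φ ⟶ Dom.one .tm :=
  Dom.app (Dom.app (Dom.cApp Φ) x) y

theorem comp_semApp {Φ Ψ : Dom} (σ : Ψ ⟶ Φ) (x y : Φ ⟶ Dom.one .tm) :
    σ ≫ semApp x y = semApp (σ ≫ x) (σ ≫ y) := by
  simp only [semApp, Dom.comp_app, Dom.comp_cApp]

/-- The constant `lam : (El tm → El tm) → El tm`. -/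
def semLam : Fn (El (Dom.one .tm)) (El (Dom.one .tm)) ⟶ El (Dom.one .tm) where
  app Φ := ↾fun f => Dom.app (Dom.cLam Φ.unop) ((arrowI .tm .tm).app Φ f)
  naturality Φ Ψ σ := by
    ext f
    change Dom.app (Dom.cLam _) ((arrowI .tm .tm).app Ψ ((Fn _ _).map σ f)) =
      σ.unop ≫ Dom.app (Dom.cLam _) ((arrowI .tm .tm).app Φ f)
    rw [Dom.comp_app, Dom.comp_cLam, NatTrans.naturality_apply]
    rfl

/-- `u ↦ λ x. m (pair u x)`, for a presheaf of functions out of an extended context. -/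
def curryU {c : Dom} {A : STy} {Y : Psh} (m : El (Dom.times c A) ⟶ Y) :
    El c ⟶ Fn (El (Dom.one A)) Y where
  app Φ := ↾fun u =>
    { app := fun {Ψ} δ x => m.app (op Ψ) (Dom.pair (δ ≫ u) x)
      nat := fun {Ψ Ψ'} δ δ' x => by
        rw [← NatTrans.naturality_apply]
        congr 1
        change Dom.pair ((δ' ≫ δ) ≫ u) (δ' ≫ x) = δ' ≫ Dom.pair (δ ≫ u) x
        rw [Dom.comp_pair, Category.assoc] }
  naturality Φ Ψ σ := by
    refine ConcreteCategory.hom_ext _ _ fun u => ?_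
    apply FunAt.ext
    funext Ξ δ x
    change m.app (op Ξ) (Dom.pair (δ ≫ (σ.unop ≫ u)) x) = m.app (op Ξ) (Dom.pair ((δ ≫ σ.unop) ≫ u) x)
    rw [Category.assoc]

/-- `u ↦ pair (σ u) (m u)`. -/
def pairU {c d : Dom} {A : STy} (σ : El c ⟶ El d) (m : El c ⟶ El (Dom.one A)) :
    El c ⟶ El (Dom.times d A) where
  app Φ := ↾fun u => Dom.pair (σ.app Φ u) (m.app Φ u)
  naturality Φ Ψ δ := by
    ext u
    change Dom.pair (σ.app Ψ ((El c).map δ u)) (m.app Ψ ((El c).map δ u)) =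
      δ.unop ≫ Dom.pair (σ.app Φ u) (m.app Φ u)
    rw [Dom.comp_pair, NatTrans.naturality_apply, NatTrans.naturality_apply]
    rfl

/-- `u ↦ arrow-e (m u) (n u)`. -/
def arrowE {c : Dom} {A B : STy} (m : El c ⟶ El (Dom.one (.arr A B))) (n : El c ⟶ El (Dom.one A)) :
    El c ⟶ El (Dom.one B) where
  app Φ := ↾fun u => Dom.app (m.app Φ u) (n.app Φ u)
  naturality Φ Ψ δ := by
    ext u
    change Dom.app (m.app Ψ ((El c).map δ u)) (n.app Ψ ((El c).map δ u)) =
      δ.unop ≫ Dom.app (m.app Φ u) (n.app Φ u)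
    rw [Dom.comp_app, NatTrans.naturality_apply, NatTrans.naturality_apply]
    rfl

/-- `f ↦ λ x. arrow-e f x`. -/
def arrowEFun (A B : STy) :
    El (Dom.one (.arr A B)) ⟶ Fn (El (Dom.one A)) (El (Dom.one B)) where
  app Φ := ↾fun f =>
    { app := fun {Ψ} δ x => Dom.app (δ ≫ f) x
      nat := fun {Ψ Ψ'} δ δ' x => by
        refine Eq.trans ?_ (Dom.comp_app δ' (δ ≫ f) x).symm
        rw [Category.assoc]
        rfl }
  naturality Φ Ψ σ := by
    refine ConcreteCategory.hom_ext _ _ fun f => ?_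
    apply FunAt.ext
    funext Ξ δ x
    change Dom.app (δ ≫ (σ.unop ≫ f)) x = Dom.app ((δ ≫ σ.unop) ≫ f) x
    rw [Category.assoc]

/-- `x ↦ λ y. app x y`. -/
def appCurried : El (Dom.one .tm) ⟶ Fn (El (Dom.one .tm)) (El (Dom.one .tm)) where
  app Φ := ↾fun x =>
    { app := fun {Ψ} δ y => semApp (δ ≫ x) y
      nat := fun {Ψ Ψ'} δ δ' y => by
        refine Eq.trans ?_ (comp_semApp δ' (δ ≫ x) y).symm
        rw [Category.assoc]
        rfl }
  naturality Φ Ψ σ := by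
    refine ConcreteCategory.hom_ext _ _ fun x => ?_
    apply FunAt.ext
    funext Ξ δ y
    change semApp (δ ≫ (σ.unop ≫ x)) y = semApp ((δ ≫ σ.unop) ≫ x) y
    rw [Category.assoc]

/-- `u ↦ app (m u) (n u)`. -/
def appU {c : Dom} (m n : El c ⟶ El (Dom.one .tm)) : El c ⟶ El (Dom.one .tm) where
  app Φ := ↾fun u => semApp (m.app Φ u) (n.app Φ u)
  naturality Φ Ψ δ := by
    ext u
    change semApp (m.app Ψ ((El c).map δ u)) (n.app Ψ ((El c).map δ u)) =
      δ.unop ≫ semApp (m.app Φ u) (n.app Φ u)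
    rw [comp_semApp, NatTrans.naturality_apply, NatTrans.naturality_apply]
    rfl

/-- `u ↦ a` for a global element `a`. -/
def constU {c : Dom} {Y : Psh} (a : Glob Y) : El c ⟶ Y where
  app Φ := ↾fun _ => a.1 Φ
  naturality Φ Ψ δ := by
    ext u
    exact (a.2 δ).symm

/-- `arrow-i (λ x. arrow-i (λ y. app x y))`. -/
def appConst : Glob (El (Dom.one (.arr .tm (.arr .tm .tm)))) :=
  (lamU (appCurried ≫ arrowI .tm .tm)).map (arrowI .tm (.arr .tm .tm))

/-- `arrow-i (λ f. lam (λ x. arrow-e f x))`. -/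
def lamConst : Glob (El (Dom.one (.arr (.arr .tm .tm) .tm))) :=
  (lamU (arrowEFun .tm .tm ≫ semLam)).map (arrowI (.arr .tm .tm) .tm)

/-- A domain-level context as a global element of `Obj`. -/
def objGlob (c : Dom) : Glob Obj := ⟨fun _ => c, fun _ => rfl⟩

/-! ### The recursion scheme -/

/-- Closed elements of `♭(El c → El tm)`. -/
abbrev BoxTm (c : Dom) : Type := (flat.obj (Fn (El c) (El (Dom.one .tm)))).obj top

/-- Closed elements of `♭(El c →ᵥ El tm)`. -/
abbrev BoxVar (c : Dom) : Type := (flat.obj (FnV c .tm)).obj top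

/-- A closed element of `♭(El c → El tm)` as a map `El c ⟶ El tm`. -/
def BoxTm.hom {c : Dom} (m : BoxTm c) : El c ⟶ El (Dom.one .tm) := ap (Psh.ofTop _ m)

def BoxTm.mk {c : Dom} (m : El c ⟶ El (Dom.one .tm)) : BoxTm c := (boxIntro (lamU m)).1 top

/-- `app' m n = let box m' = m in let box n' = n in box (λ u. app (m' u) (n' u))`. -/
def app' {c : Dom} (m n : BoxTm c) : BoxTm c := .mk (appU m.hom n.hom)

/-- `lam' m = let box m' = m in box (λ u. lam (λ x. m' (pair u x)))`. -/
def lam' {c : Dom} (m : BoxTm (Dom.times c .tm)) : BoxTm c := .mk (curryU m.hom ≫ semLam)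

def BoxVar.toTm {c : Dom} (p : BoxVar c) : BoxTm c := (inclV c .tm).app top p

/-- The last variable of `c, x : tm`. -/
def lastVar (c : Dom) : BoxVar (Dom.times c .tm) := (projV Dom.snd .snd).1 top

section
variable {R : Dom → Type} (tv : ∀ c, BoxVar c → R c)
  (ta : ∀ c, BoxTm c → BoxTm c → R c → R c → R c)
  (tl : ∀ c, BoxTm (Dom.times c .tm) → R (Dom.times c .tm) → R c)

/-- The value on terms that are neither variables, applications nor abstractions, such as `f x` for
`f : tm → tm` in `c`. The three clauses always provide one. -/
def recOther (c : Dom) : R c :=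
  tl c (lastVar c).toTm (tv _ (lastVar c))

/-- The graph of the function defined by recursion on terms of type `tm` in a context. -/
inductive RecGraph : (c : Dom) → BoxTm c → R c → Prop
  | var (c : Dom) (p : BoxVar c) : RecGraph c p.toTm (tv c p)
  | app (c : Dom) (m n : BoxTm c) (a b : R c) :
      RecGraph c m a → RecGraph c n b → RecGraph c (app' m n) (ta c m n a b)
  | lam (c : Dom) (m : BoxTm (Dom.times c .tm)) (a : R (Dom.times c .tm)) :
      RecGraph _ m a → RecGraph c (lam' m) (tl c m a)
  | other (c : Dom) (m : BoxTm c) (hv : ∀ p : BoxVar c, m ≠ p.toTm) (ha : ∀ n n', m ≠ app' n n')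
      (hl : ∀ n, m ≠ lam' n) : RecGraph c m (recOther tv tl c)

open Classical in
/-- The recursor `rec tv ta tl`. -/
noncomputable def recSem (c : Dom) (m : BoxTm c) : R c :=
  if h : ∃ a, RecGraph tv ta tl c m a then h.choose else recOther tv tl c
end

/-! ## Simply-typed Cocon: types and contexts -/

/-- Domain-level types. -/
inductive DTy : Type
  | tm : DTy
  | arr (A B : DTy) : DTy

/-- Domain-level contexts `Ψ ::= · | ψ | Ψ, x:A` over `n` context variables. -/
inductive DCtx (n : ℕ) : Type
  | nil : DCtx n
  | var (i : Fin n) : DCtx n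
  | snoc (Ψ : DCtx n) (A : DTy) : DCtx n

/-- Extension of a family indexed by `Fin n` by a value at `0`. -/
def vcons {α : Type} {n : ℕ} (a : α) (f : Fin n → α) : Fin (n + 1) → α := Fin.cases a f

/-- Substitution of domain-level contexts for context variables. -/
def DCtx.sub {n m : ℕ} (θ : Fin n → DCtx m) : DCtx n → DCtx m
  | .nil => .nil
  | .var i => θ i
  | .snoc Ψ A => .snoc (Ψ.sub θ) A

/-- The lifting of a substitution under a context variable. -/
def liftS {n m : ℕ} (θ : Fin n → DCtx m) : Fin (n + 1) → DCtx (m + 1) :=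
  vcons (.var 0) fun i => (θ i).sub fun j => .var j.succ

/-- Computation-level types `τ` over `n` context variables:
`[Ψ ⊢ A]`, `[Ψ ⊢ᵥ A]`, `(y : τ₁) ⇒ τ₂` and `(ψ : ctx) ⇒ τ`. -/
inductive CTy : ℕ → Type
  | box {n : ℕ} (Ψ : DCtx n) (A : DTy) : CTy n
  | boxv {n : ℕ} (Ψ : DCtx n) (A : DTy) : CTy n
  | fn {n : ℕ} (τ₁ τ₂ : CTy n) : CTy n
  | pi {n : ℕ} (τ : CTy (n + 1)) : CTy n

def CTy.sub : {n : ℕ} → CTy n → {m : ℕ} → (Fin n → DCtx m) → CTy m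
  | _, .box Ψ A, _, θ => .box (Ψ.sub θ) A
  | _, .boxv Ψ A, _, θ => .boxv (Ψ.sub θ) A
  | _, .fn τ₁ τ₂, _, θ => .fn (τ₁.sub θ) (τ₂.sub θ)
  | _, .pi τ, _, θ => .pi (τ.sub (liftS θ))

/-- Weakening by a context variable. -/
def CTy.weaken {n : ℕ} (τ : CTy n) : CTy (n + 1) := τ.sub fun i => .var i.succ

/-- `[Ψ/ψ]τ`. -/
def CTy.inst {n : ℕ} (τ : CTy (n + 1)) (Ψ : DCtx n) : CTy n := τ.sub (vcons Ψ .var)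

/-- `[(ψ, x:tm)/ψ]τ`. -/
def CTy.extTm {n : ℕ} (τ : CTy (n + 1)) : CTy (n + 1) :=
  τ.sub (vcons (.snoc (.var 0) .tm) fun i => .var i.succ)

theorem DCtx.sub_var {n : ℕ} (Ψ : DCtx n) : Ψ.sub .var = Ψ := by
  induction Ψ <;> simp_all [DCtx.sub]

theorem DCtx.sub_sub {n m k : ℕ} (Ψ : DCtx n) (θ : Fin n → DCtx m) (η : Fin m → DCtx k) :
    (Ψ.sub θ).sub η = Ψ.sub fun i => (θ i).sub η := by
  induction Ψ <;> simp_all [DCtx.sub]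

theorem vcons_ext {α : Type} {n : ℕ} {f g : Fin (n + 1) → α} (h₀ : f 0 = g 0)
    (h : ∀ i : Fin n, f i.succ = g i.succ) : f = g :=
  funext fun i => Fin.cases h₀ h i

theorem liftS_var (n : ℕ) : liftS (.var : Fin n → DCtx n) = .var :=
  vcons_ext rfl fun _ => rfl

theorem liftS_comp {n m k : ℕ} (θ : Fin n → DCtx m) (η : Fin m → DCtx k) :
    (fun i => (liftS θ i).sub (liftS η)) = liftS fun i => (θ i).sub η :=
  vcons_ext rfl fun i => by
    change ((θ i).sub _).sub _ = ((θ i).sub _).sub _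
    rw [DCtx.sub_sub, DCtx.sub_sub]
    rfl

theorem CTy.sub_var {n : ℕ} (τ : CTy n) : τ.sub .var = τ := by
  induction τ <;> simp_all [CTy.sub, DCtx.sub_var, liftS_var]

theorem CTy.sub_sub {n m k : ℕ} (τ : CTy n) (θ : Fin n → DCtx m) (η : Fin m → DCtx k) :
    (τ.sub θ).sub η = τ.sub fun i => (θ i).sub η := by
  induction τ generalizing m k with
  | pi τ ih => simp only [CTy.sub, ih, liftS_comp]
  | _ => simp_all [CTy.sub, DCtx.sub_sub]

theorem CTy.weaken_sub_vcons {n m : ℕ} (τ : CTy n) (Ψ : DCtx m) (θ : Fin n → DCtx m) :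
    τ.weaken.sub (vcons Ψ θ) = τ.sub θ := by
  rw [CTy.weaken, CTy.sub_sub]; rfl

theorem CTy.weaken_sub_liftS {n m : ℕ} (τ : CTy n) (θ : Fin n → DCtx m) :
    τ.weaken.sub (liftS θ) = (τ.sub θ).weaken := by
  rw [CTy.weaken, CTy.weaken, CTy.sub_sub, CTy.sub_sub]; rfl

theorem CTy.inst_sub {n m : ℕ} (τ : CTy (n + 1)) (Ψ : DCtx n) (θ : Fin n → DCtx m) :
    (τ.inst Ψ).sub θ = (τ.sub (liftS θ)).inst (Ψ.sub θ) := by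
  rw [CTy.inst, CTy.inst, CTy.sub_sub, CTy.sub_sub]
  congr 1
  refine vcons_ext rfl fun i => ?_
  change θ i = ((θ i).sub _).sub _
  rw [DCtx.sub_sub]
  exact (DCtx.sub_var _).symm

theorem CTy.extTm_sub {n m : ℕ} (τ : CTy (n + 1)) (θ : Fin n → DCtx m) :
    τ.extTm.sub (liftS θ) = (τ.sub (liftS θ)).extTm := by
  rw [CTy.extTm, CTy.extTm, CTy.sub_sub, CTy.sub_sub]
  congr 1
  refine vcons_ext rfl fun i => ?_
  change (θ i).sub _ = ((θ i).sub _).sub _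
  rw [DCtx.sub_sub]
  rfl

theorem CTy.extTm_sub_vcons {n : ℕ} (τ : CTy (n + 1)) (Ψ : DCtx n) :
    τ.extTm.sub (vcons Ψ .var) = τ.inst (.snoc Ψ .tm) := by
  rw [CTy.extTm, CTy.inst, CTy.sub_sub]
  congr 1
  exact vcons_ext rfl fun i => rfl

theorem CTy.inst_var_zero {n : ℕ} (τ : CTy (n + 1)) :
    (τ.sub (liftS fun i => .var i.succ)).inst (.var 0) = τ := by
  rw [CTy.inst, CTy.sub_sub]
  refine Eq.trans (congrArg τ.sub ?_) τ.sub_var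
  exact vcons_ext rfl fun i => rfl

/-- Computation-level contexts `Γ ::= · | Γ, y:τ | Γ, ψ:ctx`; the index counts the context
variables. -/
inductive CCtx : ℕ → Type
  | nil : CCtx 0
  | tm {n : ℕ} (Γ : CCtx n) (τ : CTy n) : CCtx n
  | ctx {n : ℕ} (Γ : CCtx n) : CCtx (n + 1)

/-- Computation-level variables `y : τ ∈ Γ`. -/
inductive CVar : {n : ℕ} → CCtx n → CTy n → Type
  | zero {n : ℕ} {Γ : CCtx n} {τ : CTy n} : CVar (Γ.tm τ) τ
  | succ {n : ℕ} {Γ : CCtx n} {τ τ' : CTy n} (y : CVar Γ τ) : CVar (Γ.tm τ') τ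
  | succCtx {n : ℕ} {Γ : CCtx n} {τ : CTy n} (y : CVar Γ τ) : CVar Γ.ctx τ.weaken

/-- Domain-level variables `x : A ∈ Ψ`. -/
inductive DVar {n : ℕ} : DCtx n → DTy → Type
  | zero {Ψ : DCtx n} {A : DTy} : DVar (Ψ.snoc A) A
  | succ {Ψ : DCtx n} {A B : DTy} (x : DVar Ψ A) : DVar (Ψ.snoc B) A

/-- `Wk Φ Ψ`: the context `Φ` is `Ψ` followed by further declarations `x⃗:A⃗`. -/
inductive Wk {n : ℕ} : DCtx n → DCtx n → Type
  | refl {Ψ : DCtx n} : Wk Ψ Ψ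
  | drop {Φ Ψ : DCtx n} {A : DTy} (w : Wk Φ Ψ) : Wk (Φ.snoc A) Ψ

/-! ## Simply-typed Cocon: terms

Terms are intrinsically typed, i.e. they are the typing derivations of the judgments
`Γ; Ψ ⊢ M : A`, `Γ; Φ ⊢ σ : Ψ`, `Γ ⊢ C : (Ψ ⊢ᵥ A)` and `Γ ⊢ t : τ`. -/

mutual

/-- Domain-level terms `Γ; Ψ ⊢ M : A`. -/
inductive DTm : {n : ℕ} → CCtx n → DCtx n → DTy → Type
  | var {n : ℕ} {Γ : CCtx n} {Ψ : DCtx n} {A : DTy} (x : DVar Ψ A) : DTm Γ Ψ A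
  | cLam {n : ℕ} {Γ : CCtx n} {Ψ : DCtx n} : DTm Γ Ψ (.arr (.arr .tm .tm) .tm)
  | cApp {n : ℕ} {Γ : CCtx n} {Ψ : DCtx n} : DTm Γ Ψ (.arr .tm (.arr .tm .tm))
  | app {n : ℕ} {Γ : CCtx n} {Ψ : DCtx n} {A B : DTy} (M : DTm Γ Ψ (.arr A B))
      (N : DTm Γ Ψ A) : DTm Γ Ψ B
  | lam {n : ℕ} {Γ : CCtx n} {Ψ : DCtx n} {A B : DTy} (M : DTm Γ (Ψ.snoc A) B) :
      DTm Γ Ψ (.arr A B)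
  | unbox {n : ℕ} {Γ : CCtx n} {Φ Ψ : DCtx n} {A : DTy} (t : CTm Γ (.box Φ A))
      (σ : DSub Γ Ψ Φ) : DTm Γ Ψ A
  | unboxv {n : ℕ} {Γ : CCtx n} {Φ Ψ : DCtx n} {A : DTy} (t : CTm Γ (.boxv Φ A))
      (σ : DSub Γ Ψ Φ) : DTm Γ Ψ A

/-- Domain-level substitutions `Γ; Φ ⊢ σ : Ψ`. -/
inductive DSub : {n : ℕ} → CCtx n → DCtx n → DCtx n → Type
  | wk {n : ℕ} {Γ : CCtx n} {Φ Ψ : DCtx n} (w : Wk Φ Ψ) : DSub Γ Φ Ψ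
  | nil {n : ℕ} {Γ : CCtx n} {Φ : DCtx n} : DSub Γ Φ .nil
  | snoc {n : ℕ} {Γ : CCtx n} {Φ Ψ : DCtx n} {A : DTy} (σ : DSub Γ Φ Ψ) (M : DTm Γ Φ A) :
      DSub Γ Φ (Ψ.snoc A)

/-- Contextual objects `Γ ⊢ C : (Ψ ⊢ᵥ A)`: variables of `Ψ`, and variables unboxed under a
weakening. -/
inductive VObj : {n : ℕ} → CCtx n → DCtx n → DTy → Type
  | var {n : ℕ} {Γ : CCtx n} {Ψ : DCtx n} {A : DTy} (x : DVar Ψ A) : VObj Γ Ψ A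
  | unbox {n : ℕ} {Γ : CCtx n} {Φ Ψ : DCtx n} {A : DTy} (t : CTm Γ (.boxv Φ A))
      (w : Wk Ψ Φ) : VObj Γ Ψ A

/-- Computation-level terms `Γ ⊢ t : τ`. In `appCtx` and `recTm` the result type is `[Ψ/ψ]τ`, and
in `recTm` the type `τl` of the recursive call in the third branch is `[(ψ, x:tm)/ψ]τ`. -/
inductive CTm : {n : ℕ} → CCtx n → CTy n → Type
  | var {n : ℕ} {Γ : CCtx n} {τ : CTy n} (y : CVar Γ τ) : CTm Γ τ
  | box {n : ℕ} {Γ : CCtx n} {Ψ : DCtx n} {A : DTy} (M : DTm Γ Ψ A) : CTm Γ (.box Ψ A)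
  | boxv {n : ℕ} {Γ : CCtx n} {Ψ : DCtx n} {A : DTy} (C : VObj Γ Ψ A) : CTm Γ (.boxv Ψ A)
  | fn {n : ℕ} {Γ : CCtx n} {τ₁ τ₂ : CTy n} (t : CTm (Γ.tm τ₁) τ₂) : CTm Γ (.fn τ₁ τ₂)
  | fnCtx {n : ℕ} {Γ : CCtx n} {τ : CTy (n + 1)} (t : CTm Γ.ctx τ) : CTm Γ (.pi τ)
  | app {n : ℕ} {Γ : CCtx n} {τ₁ τ₂ : CTy n} (t : CTm Γ (.fn τ₁ τ₂)) (s : CTm Γ τ₁) : CTm Γ τ₂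
  | appCtx {n : ℕ} {Γ : CCtx n} {τ : CTy (n + 1)} {τ' : CTy n} (t : CTm Γ (.pi τ)) (Ψ : DCtx n)
      (h : τ.inst Ψ = τ') : CTm Γ τ'
  | recTm {n : ℕ} {Γ : CCtx n} (τ : CTy (n + 1)) {τl : CTy (n + 1)} {τ' : CTy n}
      (bv : CTm (Γ.ctx.tm (.boxv (.var 0) .tm)) τ)
      (ba : CTm ((((Γ.ctx.tm (.box (.var 0) .tm)).tm (.box (.var 0) .tm)).tm τ).tm τ) τ)
      (hl : τ.extTm = τl)
      (bl : CTm ((Γ.ctx.tm (.box (.snoc (.var 0) .tm) .tm)).tm τl) τ)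
      (Ψ : DCtx n) (t : CTm Γ (.box Ψ .tm)) (h : τ.inst Ψ = τ') : CTm Γ τ'

end

/-! ### Domain-level substitution -/

def Wk.trans {n : ℕ} {Φ Ψ Ξ : DCtx n} : Wk Φ Ψ → Wk Ψ Ξ → Wk Φ Ξ
  | .refl, w => w
  | .drop v, w => .drop (v.trans w)

def Wk.var {n : ℕ} {Φ Ψ : DCtx n} {A : DTy} : Wk Φ Ψ → DVar Ψ A → DVar Φ A
  | .refl, x => x
  | .drop w, x => .succ (w.var x)

/-- The weakening by one declaration. -/
def Wk.one {n : ℕ} {Ψ : DCtx n} {A : DTy} : Wk (Ψ.snoc A) Ψ := .drop .refl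

/-- Weakenings below binders. -/
inductive Ope {n : ℕ} : DCtx n → DCtx n → Type
  | wk {Φ Ψ : DCtx n} (w : Wk Φ Ψ) : Ope Φ Ψ
  | keep {Φ Ψ : DCtx n} {A : DTy} (o : Ope Φ Ψ) : Ope (Φ.snoc A) (Ψ.snoc A)

def Ope.var {n : ℕ} {Φ Ψ : DCtx n} {A : DTy} : Ope Φ Ψ → DVar Ψ A → DVar Φ A
  | .wk w, x => w.var x
  | .keep _, .zero => .zero
  | .keep o, .succ x => .succ (o.var x)

/-- The substitution given by an `Ope`, weakened along `v`. -/
def Ope.toDSub {n : ℕ} (Γ : CCtx n) {Ξ Φ Ψ : DCtx n} : Ope Φ Ψ → Wk Ξ Φ → DSub Γ Ξ Ψ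
  | .wk w, v => .wk (v.trans w)
  | .keep o, v => .snoc (o.toDSub Γ (v.trans .one)) (.var (v.var .zero))

/-- `σ, M ↦ σ`. -/
def DSub.tail {n : ℕ} {Γ : CCtx n} {Φ Ψ : DCtx n} {A : DTy} : DSub Γ Φ (Ψ.snoc A) → DSub Γ Φ Ψ
  | .wk w => .wk (w.trans .one)
  | .snoc σ _ => σ

/-- Truncation: the composition of `σ` with a weakening substitution. -/
def DSub.trunc {n : ℕ} {Γ : CCtx n} {Φ Ψ Ξ : DCtx n} (σ : DSub Γ Φ Ψ) : Wk Ψ Ξ → DSub Γ Φ Ξ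
  | .refl => σ
  | .drop w => σ.tail.trunc w

mutual

def DTm.ren {n : ℕ} {Γ : CCtx n} {Φ Ψ : DCtx n} {A : DTy} : DTm Γ Ψ A → Ope Φ Ψ → DTm Γ Φ A
  | .var x, o => .var (o.var x)
  | .cLam, _ => .cLam
  | .cApp, _ => .cApp
  | .app M N, o => .app (M.ren o) (N.ren o)
  | .lam M, o => .lam (M.ren o.keep)
  | .unbox t σ, o => .unbox t (σ.ren o)
  | .unboxv t σ, o => .unboxv t (σ.ren o)

def DSub.ren {n : ℕ} {Γ : CCtx n} {Φ Ψ Ξ : DCtx n} : DSub Γ Ψ Ξ → Ope Φ Ψ → DSub Γ Φ Ξ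
  | .wk w, o => (o.toDSub Γ .refl).trunc w
  | .nil, _ => .nil
  | .snoc σ M, o => .snoc (σ.ren o) (M.ren o)

end

def DSub.lookup {n : ℕ} {Γ : CCtx n} {Φ Ψ : DCtx n} {A : DTy} : DSub Γ Φ Ψ → DVar Ψ A → DTm Γ Φ A
  | .wk w, x => .var (w.var x)
  | .snoc _ M, .zero => M
  | .snoc σ _, .succ x => σ.lookup x

def DSub.lift {n : ℕ} {Γ : CCtx n} {Φ Ψ : DCtx n} (σ : DSub Γ Φ Ψ) (A : DTy) :
    DSub Γ (Φ.snoc A) (Ψ.snoc A) :=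
  .snoc (σ.ren (.wk .one)) (.var .zero)

mutual

/-- `[σ]M`. -/
def DTm.sub {n : ℕ} {Γ : CCtx n} {Φ Ψ : DCtx n} {A : DTy} : DTm Γ Ψ A → DSub Γ Φ Ψ → DTm Γ Φ A
  | .var x, σ => σ.lookup x
  | .cLam, _ => .cLam
  | .cApp, _ => .cApp
  | .app M N, σ => .app (M.sub σ) (N.sub σ)
  | .lam M, σ => .lam (M.sub (σ.lift _))
  | .unbox t τ, σ => .unbox t (τ.sub σ)
  | .unboxv t τ, σ => .unboxv t (τ.sub σ)

/-- `[σ]τ`. -/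
def DSub.sub {n : ℕ} {Γ : CCtx n} {Φ Ψ Ξ : DCtx n} : DSub Γ Ψ Ξ → DSub Γ Φ Ψ → DSub Γ Φ Ξ
  | .wk w, σ => σ.trunc w
  | .nil, _ => .nil
  | .snoc τ M, σ => .snoc (τ.sub σ) (M.sub σ)

end

/-- The domain-level term underlying a contextual object of type `Ψ ⊢ᵥ A`. -/
def VObj.toDTm {n : ℕ} {Γ : CCtx n} {Ψ : DCtx n} {A : DTy} : VObj Γ Ψ A → DTm Γ Ψ A
  | .var x => .var x
  | .unbox t w => .unboxv t (.wk w)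

/-! ### Computation-level renaming and substitution

Both are instances of one traversal, for the two kinds of things a variable can be replaced by. -/

def CTm.cast {n : ℕ} {Γ : CCtx n} {τ τ' : CTy n} (h : τ = τ') (t : CTm Γ τ) : CTm Γ τ' := h ▸ t

structure Kit where
  V : {n : ℕ} → CCtx n → CTy n → Type
  cast : {n : ℕ} → {Γ : CCtx n} → {τ τ' : CTy n} → τ = τ' → V Γ τ → V Γ τ'
  ofVar : {n : ℕ} → {Γ : CCtx n} → {τ : CTy n} → CVar Γ τ → V Γ τ
  toTm : {n : ℕ} → {Γ : CCtx n} → {τ : CTy n} → V Γ τ → CTm Γ τ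
  wk : {n : ℕ} → {Γ : CCtx n} → {τ : CTy n} → (τ' : CTy n) → V Γ τ → V (Γ.tm τ') τ
  wkCtx : {n : ℕ} → {Γ : CCtx n} → {τ : CTy n} → V Γ τ → V Γ.ctx τ.weaken

/-- A map from the variables of `Γ` to contexts and `K`-values over `Δ`. -/
structure Env (K : Kit) {n m : ℕ} (Γ : CCtx n) (Δ : CCtx m) where
  θ : Fin n → DCtx m
  val : {τ : CTy n} → CVar Γ τ → K.V Δ (τ.sub θ)

def Env.id (K : Kit) {n : ℕ} (Γ : CCtx n) : Env K Γ Γ where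
  θ := .var
  val {τ} y := K.cast τ.sub_var.symm (K.ofVar y)

def Env.cons {K : Kit} {n m : ℕ} {Γ : CCtx n} {Δ : CCtx m} (e : Env K Γ Δ) {τ : CTy n}
    (v : K.V Δ (τ.sub e.θ)) : Env K (Γ.tm τ) Δ where
  θ := e.θ
  val
    | .zero => v
    | .succ y => e.val y

def Env.consCtx {K : Kit} {n m : ℕ} {Γ : CCtx n} {Δ : CCtx m} (e : Env K Γ Δ) (Ψ : DCtx m) :
    Env K Γ.ctx Δ where
  θ := vcons Ψ e.θ
  val
    | .succCtx y => K.cast (CTy.weaken_sub_vcons _ _ _).symm (e.val y)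

def Env.wk {K : Kit} {n m : ℕ} {Γ : CCtx n} {Δ : CCtx m} (e : Env K Γ Δ) (τ : CTy m) :
    Env K Γ (Δ.tm τ) where
  θ := e.θ
  val y := K.wk τ (e.val y)

def Env.lift {K : Kit} {n m : ℕ} {Γ : CCtx n} {Δ : CCtx m} (e : Env K Γ Δ) (τ : CTy n) :
    Env K (Γ.tm τ) (Δ.tm (τ.sub e.θ)) :=
  (e.wk (τ.sub e.θ)).cons (K.ofVar .zero)

def Env.liftCtx {K : Kit} {n m : ℕ} {Γ : CCtx n} {Δ : CCtx m} (e : Env K Γ Δ) :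
    Env K Γ.ctx Δ.ctx where
  θ := liftS e.θ
  val
    | .succCtx y => K.cast (CTy.weaken_sub_liftS _ _).symm (K.wkCtx (e.val y))

def DVar.csub {n m : ℕ} (θ : Fin n → DCtx m) {Ψ : DCtx n} {A : DTy} :
    DVar Ψ A → DVar (Ψ.sub θ) A
  | .zero => .zero
  | .succ x => .succ (x.csub θ)

def Wk.csub {n m : ℕ} (θ : Fin n → DCtx m) {Φ Ψ : DCtx n} : Wk Φ Ψ → Wk (Φ.sub θ) (Ψ.sub θ)
  | .refl => .refl
  | .drop w => .drop (w.csub θ)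

mutual

def DTm.csub {K : Kit} : {n : ℕ} → {Γ : CCtx n} → {Ψ : DCtx n} → {A : DTy} → DTm Γ Ψ A →
    {m : ℕ} → {Δ : CCtx m} → (e : Env K Γ Δ) → DTm Δ (Ψ.sub e.θ) A
  | _, _, _, _, .var x, _, _, e => .var (x.csub e.θ)
  | _, _, _, _, .cLam, _, _, _ => .cLam
  | _, _, _, _, .cApp, _, _, _ => .cApp
  | _, _, _, _, .app M N, _, _, e => .app (M.csub e) (N.csub e)
  | _, _, _, _, .lam M, _, _, e => .lam (M.csub e)
  | _, _, _, _, .unbox t σ, _, _, e => .unbox (t.csub e) (σ.csub e)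
  | _, _, _, _, .unboxv t σ, _, _, e => .unboxv (t.csub e) (σ.csub e)

def DSub.csub {K : Kit} : {n : ℕ} → {Γ : CCtx n} → {Φ Ψ : DCtx n} → DSub Γ Φ Ψ →
    {m : ℕ} → {Δ : CCtx m} → (e : Env K Γ Δ) → DSub Δ (Φ.sub e.θ) (Ψ.sub e.θ)
  | _, _, _, _, .wk w, _, _, e => .wk (w.csub e.θ)
  | _, _, _, _, .nil, _, _, _ => .nil
  | _, _, _, _, .snoc σ M, _, _, e => .snoc (σ.csub e) (M.csub e)

def VObj.csub {K : Kit} : {n : ℕ} → {Γ : CCtx n} → {Ψ : DCtx n} → {A : DTy} → VObj Γ Ψ A →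
    {m : ℕ} → {Δ : CCtx m} → (e : Env K Γ Δ) → VObj Δ (Ψ.sub e.θ) A
  | _, _, _, _, .var x, _, _, e => .var (x.csub e.θ)
  | _, _, _, _, .unbox t w, _, _, e => .unbox (t.csub e) (w.csub e.θ)

def CTm.csub {K : Kit} : {n : ℕ} → {Γ : CCtx n} → {τ : CTy n} → CTm Γ τ →
    {m : ℕ} → {Δ : CCtx m} → (e : Env K Γ Δ) → CTm Δ (τ.sub e.θ)
  | _, _, _, .var y, _, _, e => K.toTm (e.val y)
  | _, _, _, .box M, _, _, e => .box (M.csub e)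
  | _, _, _, .boxv C, _, _, e => .boxv (C.csub e)
  | _, _, _, .fn t, _, _, e => .fn (t.csub (e.lift _))
  | _, _, _, .fnCtx t, _, _, e => .fnCtx (t.csub e.liftCtx)
  | _, _, _, .app t s, _, _, e => .app (t.csub e) (s.csub e)
  | _, _, _, .appCtx t Ψ h, _, _, e =>
      .appCtx (t.csub e) (Ψ.sub e.θ) (by rw [← h, CTy.inst_sub])
  | _, _, _, .recTm τ bv ba hl bl Ψ t h, _, _, e =>
      .recTm (τ.sub (liftS e.θ)) (bv.csub (e.liftCtx.lift _))
        (ba.csub ((((e.liftCtx.lift _).lift _).lift _).lift _))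
        (hl ▸ (CTy.extTm_sub τ e.θ).symm) (bl.csub ((e.liftCtx.lift _).lift _))
        (Ψ.sub e.θ) (t.csub e) (by rw [← h, CTy.inst_sub])

end

/-- Renaming: variables for variables. -/
def Kit.ren : Kit where
  V := CVar
  cast h y := h ▸ y
  ofVar y := y
  toTm := .var
  wk _ y := y.succ
  wkCtx y := y.succCtx

/-- Weakening by a variable of type `τ'`. -/
def CTm.wk {n : ℕ} {Γ : CCtx n} {τ : CTy n} (t : CTm Γ τ) (τ' : CTy n) : CTm (Γ.tm τ') τ :=
  (t.csub ((Env.id Kit.ren Γ).wk τ')).cast τ.sub_var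

/-- Weakening by a context variable. -/
def CTm.wkCtx {n : ℕ} {Γ : CCtx n} {τ : CTy n} (t : CTm Γ τ) : CTm Γ.ctx τ.weaken :=
  t.csub (K := Kit.ren) ⟨fun i => .var i.succ, fun y => y.succCtx⟩

/-- Substitution: terms for variables. -/
def Kit.sub : Kit where
  V := CTm
  cast h t := t.cast h
  ofVar := .var
  toTm t := t
  wk τ' t := t.wk τ'
  wkCtx t := t.wkCtx

/-- `[s/y]t`. -/
def CTm.inst {n : ℕ} {Γ : CCtx n} {τ τ' : CTy n} (t : CTm (Γ.tm τ') τ) (s : CTm Γ τ') : CTm Γ τ :=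
  (t.csub ((Env.id Kit.sub Γ).cons (s.cast τ'.sub_var.symm))).cast τ.sub_var

/-- The substitution `Ψ/ψ`. -/
def instCtx {n : ℕ} (Γ : CCtx n) (Ψ : DCtx n) : Env Kit.sub Γ.ctx Γ := (Env.id Kit.sub Γ).consCtx Ψ

/-! ### Judgmental equality -/

mutual

/-- `Γ; Ψ ⊢ M ≡ N : A`. -/
inductive DTm.Eqv : {n : ℕ} → {Γ : CCtx n} → {Ψ : DCtx n} → {A : DTy} →
    DTm Γ Ψ A → DTm Γ Ψ A → Prop
  | refl {n : ℕ} {Γ : CCtx n} {Ψ : DCtx n} {A : DTy} (M : DTm Γ Ψ A) : DTm.Eqv M M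
  | symm {n : ℕ} {Γ : CCtx n} {Ψ : DCtx n} {A : DTy} {M N : DTm Γ Ψ A} :
      DTm.Eqv M N → DTm.Eqv N M
  | trans {n : ℕ} {Γ : CCtx n} {Ψ : DCtx n} {A : DTy} {M N P : DTm Γ Ψ A} :
      DTm.Eqv M N → DTm.Eqv N P → DTm.Eqv M P
  | app {n : ℕ} {Γ : CCtx n} {Ψ : DCtx n} {A B : DTy} {M M' : DTm Γ Ψ (.arr A B)}
      {N N' : DTm Γ Ψ A} : DTm.Eqv M M' → DTm.Eqv N N' → DTm.Eqv (.app M N) (.app M' N')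
  | lam {n : ℕ} {Γ : CCtx n} {Ψ : DCtx n} {A B : DTy} {M M' : DTm Γ (Ψ.snoc A) B} :
      DTm.Eqv M M' → DTm.Eqv (.lam M) (.lam M')
  | unbox {n : ℕ} {Γ : CCtx n} {Φ Ψ : DCtx n} {A : DTy} {t t' : CTm Γ (.box Φ A)}
      {σ σ' : DSub Γ Ψ Φ} : CTm.Eqv t t' → DSub.Eqv σ σ' → DTm.Eqv (.unbox t σ) (.unbox t' σ')
  | unboxv {n : ℕ} {Γ : CCtx n} {Φ Ψ : DCtx n} {A : DTy} {t t' : CTm Γ (.boxv Φ A)}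
      {σ σ' : DSub Γ Ψ Φ} : CTm.Eqv t t' → DSub.Eqv σ σ' → DTm.Eqv (.unboxv t σ) (.unboxv t' σ')
  | beta {n : ℕ} {Γ : CCtx n} {Ψ : DCtx n} {A B : DTy} (M : DTm Γ (Ψ.snoc A) B)
      (N : DTm Γ Ψ A) : DTm.Eqv (.app (.lam M) N) (M.sub (.snoc (.wk .refl) N))
  | eta {n : ℕ} {Γ : CCtx n} {Ψ : DCtx n} {A B : DTy} (M : DTm Γ Ψ (.arr A B)) :
      DTm.Eqv M (.lam (.app (M.ren (.wk .one)) (.var .zero)))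
  | unbox_box {n : ℕ} {Γ : CCtx n} {Φ Ψ : DCtx n} {A : DTy} (M : DTm Γ Φ A) (σ : DSub Γ Ψ Φ) :
      DTm.Eqv (.unbox (.box M) σ) (M.sub σ)
  | unboxv_boxv {n : ℕ} {Γ : CCtx n} {Φ Ψ : DCtx n} {A : DTy} (C : VObj Γ Φ A)
      (σ : DSub Γ Ψ Φ) : DTm.Eqv (.unboxv (.boxv C) σ) (C.toDTm.sub σ)

/-- `Γ; Φ ⊢ σ ≡ σ' : Ψ`. -/
inductive DSub.Eqv : {n : ℕ} → {Γ : CCtx n} → {Φ Ψ : DCtx n} → DSub Γ Φ Ψ → DSub Γ Φ Ψ → Prop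
  | refl {n : ℕ} {Γ : CCtx n} {Φ Ψ : DCtx n} (σ : DSub Γ Φ Ψ) : DSub.Eqv σ σ
  | symm {n : ℕ} {Γ : CCtx n} {Φ Ψ : DCtx n} {σ τ : DSub Γ Φ Ψ} : DSub.Eqv σ τ → DSub.Eqv τ σ
  | trans {n : ℕ} {Γ : CCtx n} {Φ Ψ : DCtx n} {σ τ υ : DSub Γ Φ Ψ} :
      DSub.Eqv σ τ → DSub.Eqv τ υ → DSub.Eqv σ υ
  | snoc {n : ℕ} {Γ : CCtx n} {Φ Ψ : DCtx n} {A : DTy} {σ σ' : DSub Γ Φ Ψ} {M M' : DTm Γ Φ A} :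
      DSub.Eqv σ σ' → DTm.Eqv M M' → DSub.Eqv (.snoc σ M) (.snoc σ' M')
  | nil_eta {n : ℕ} {Γ : CCtx n} {Φ : DCtx n} (σ : DSub Γ Φ .nil) : DSub.Eqv σ .nil
  | wk_eta {n : ℕ} {Γ : CCtx n} {Φ Ψ : DCtx n} {A : DTy} (w : Wk Φ (Ψ.snoc A)) :
      DSub.Eqv (Γ := Γ) (.wk w) (.snoc (.wk (w.trans .one)) (.var (w.var .zero)))

/-- `Γ ⊢ t₁ ≡ t₂ : τ`. -/
inductive CTm.Eqv : {n : ℕ} → {Γ : CCtx n} → {τ : CTy n} → CTm Γ τ → CTm Γ τ → Prop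
  | refl {n : ℕ} {Γ : CCtx n} {τ : CTy n} (t : CTm Γ τ) : CTm.Eqv t t
  | symm {n : ℕ} {Γ : CCtx n} {τ : CTy n} {t s : CTm Γ τ} : CTm.Eqv t s → CTm.Eqv s t
  | trans {n : ℕ} {Γ : CCtx n} {τ : CTy n} {t s r : CTm Γ τ} :
      CTm.Eqv t s → CTm.Eqv s r → CTm.Eqv t r
  | box {n : ℕ} {Γ : CCtx n} {Ψ : DCtx n} {A : DTy} {M N : DTm Γ Ψ A} :
      DTm.Eqv M N → CTm.Eqv (.box M) (.box N)
  | boxv {n : ℕ} {Γ : CCtx n} {Ψ : DCtx n} {A : DTy} {C D : VObj Γ Ψ A} :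
      DTm.Eqv C.toDTm D.toDTm → CTm.Eqv (.boxv C) (.boxv D)
  | fn {n : ℕ} {Γ : CCtx n} {τ₁ τ₂ : CTy n} {t t' : CTm (Γ.tm τ₁) τ₂} :
      CTm.Eqv t t' → CTm.Eqv (.fn t) (.fn t')
  | fnCtx {n : ℕ} {Γ : CCtx n} {τ : CTy (n + 1)} {t t' : CTm Γ.ctx τ} :
      CTm.Eqv t t' → CTm.Eqv (.fnCtx t) (.fnCtx t')
  | app {n : ℕ} {Γ : CCtx n} {τ₁ τ₂ : CTy n} {t t' : CTm Γ (.fn τ₁ τ₂)} {s s' : CTm Γ τ₁} :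
      CTm.Eqv t t' → CTm.Eqv s s' → CTm.Eqv (.app t s) (.app t' s')
  | appCtx {n : ℕ} {Γ : CCtx n} {τ : CTy (n + 1)} {τ' : CTy n} {t t' : CTm Γ (.pi τ)} (Ψ : DCtx n)
      (h : τ.inst Ψ = τ') : CTm.Eqv t t' → CTm.Eqv (.appCtx t Ψ h) (.appCtx t' Ψ h)
  | recTm {n : ℕ} {Γ : CCtx n} (τ : CTy (n + 1)) {τl : CTy (n + 1)} {τ' : CTy n}
      {bv bv' : CTm (Γ.ctx.tm (.boxv (.var 0) .tm)) τ}
      {ba ba' : CTm ((((Γ.ctx.tm (.box (.var 0) .tm)).tm (.box (.var 0) .tm)).tm τ).tm τ) τ}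
      (hl : τ.extTm = τl)
      {bl bl' : CTm ((Γ.ctx.tm (.box (.snoc (.var 0) .tm) .tm)).tm τl) τ}
      (Ψ : DCtx n) {t t' : CTm Γ (.box Ψ .tm)} (h : τ.inst Ψ = τ') :
      CTm.Eqv bv bv' → CTm.Eqv ba ba' → CTm.Eqv bl bl' → CTm.Eqv t t' →
      CTm.Eqv (.recTm τ bv ba hl bl Ψ t h) (.recTm τ bv' ba' hl bl' Ψ t' h)
  | fn_beta {n : ℕ} {Γ : CCtx n} {τ₁ τ₂ : CTy n} (t : CTm (Γ.tm τ₁) τ₂) (s : CTm Γ τ₁) :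
      CTm.Eqv (.app (.fn t) s) (t.inst s)
  | fn_eta {n : ℕ} {Γ : CCtx n} {τ₁ τ₂ : CTy n} (t : CTm Γ (.fn τ₁ τ₂)) :
      CTm.Eqv t (.fn (.app (t.wk τ₁) (.var .zero)))
  | fnCtx_beta {n : ℕ} {Γ : CCtx n} {τ : CTy (n + 1)} (t : CTm Γ.ctx τ) (Ψ : DCtx n) :
      CTm.Eqv (.appCtx (.fnCtx t) Ψ rfl) (t.csub (instCtx Γ Ψ))
  | fnCtx_eta {n : ℕ} {Γ : CCtx n} {τ : CTy (n + 1)} (t : CTm Γ (.pi τ)) :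
      CTm.Eqv t (.fnCtx (.appCtx t.wkCtx (.var 0) τ.inst_var_zero))
  | box_eta {n : ℕ} {Γ : CCtx n} {Ψ : DCtx n} {A : DTy} (t : CTm Γ (.box Ψ A)) :
      CTm.Eqv t (.box (.unbox t (.wk .refl)))
  | boxv_eta {n : ℕ} {Γ : CCtx n} {Ψ : DCtx n} {A : DTy} (t : CTm Γ (.boxv Ψ A)) :
      CTm.Eqv t (.boxv (.unbox t .refl))
  | rec_var {n : ℕ} {Γ : CCtx n} (τ : CTy (n + 1)) {τl : CTy (n + 1)}
      (bv : CTm (Γ.ctx.tm (.boxv (.var 0) .tm)) τ)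
      (ba : CTm ((((Γ.ctx.tm (.box (.var 0) .tm)).tm (.box (.var 0) .tm)).tm τ).tm τ) τ)
      (hl : τ.extTm = τl)
      (bl : CTm ((Γ.ctx.tm (.box (.snoc (.var 0) .tm) .tm)).tm τl) τ)
      (Ψ : DCtx n) (C : VObj Γ Ψ .tm) :
      CTm.Eqv (.recTm τ bv ba hl bl Ψ (.box C.toDTm) rfl)
        (bv.csub ((instCtx Γ Ψ).cons (τ := .boxv (.var 0) .tm) (CTm.boxv C)))
  | rec_app {n : ℕ} {Γ : CCtx n} (τ : CTy (n + 1)) {τl : CTy (n + 1)}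
      (bv : CTm (Γ.ctx.tm (.boxv (.var 0) .tm)) τ)
      (ba : CTm ((((Γ.ctx.tm (.box (.var 0) .tm)).tm (.box (.var 0) .tm)).tm τ).tm τ) τ)
      (hl : τ.extTm = τl)
      (bl : CTm ((Γ.ctx.tm (.box (.snoc (.var 0) .tm) .tm)).tm τl) τ)
      (Ψ : DCtx n) (M N : DTm Γ Ψ .tm) :
      CTm.Eqv (.recTm τ bv ba hl bl Ψ (.box (.app (.app .cApp M) N)) rfl)
        (ba.csub (((((instCtx Γ Ψ).cons (τ := .box (.var 0) .tm) (CTm.box M)).cons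
          (τ := .box (.var 0) .tm) (CTm.box N)).cons
          (CTm.recTm τ bv ba hl bl Ψ (.box M) rfl)).cons
          (CTm.recTm τ bv ba hl bl Ψ (.box N) rfl)))
  | rec_lam {n : ℕ} {Γ : CCtx n} (τ : CTy (n + 1)) {τl : CTy (n + 1)}
      (bv : CTm (Γ.ctx.tm (.boxv (.var 0) .tm)) τ)
      (ba : CTm ((((Γ.ctx.tm (.box (.var 0) .tm)).tm (.box (.var 0) .tm)).tm τ).tm τ) τ)
      (hl : τ.extTm = τl)
      (bl : CTm ((Γ.ctx.tm (.box (.snoc (.var 0) .tm) .tm)).tm τl) τ)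
      (Ψ : DCtx n) (M : DTm Γ (Ψ.snoc .tm) .tm) :
      CTm.Eqv (.recTm τ bv ba hl bl Ψ (.box (.app .cLam (.lam M))) rfl)
        (bl.csub (((instCtx Γ Ψ).cons (τ := .box (.snoc (.var 0) .tm) .tm) (CTm.box M)).cons
          (CTm.recTm τ bv ba hl bl (Ψ.snoc .tm) (.box M)
            (by rw [← hl]; exact (CTy.extTm_sub_vcons τ Ψ).symm))))

end

/-! ## Interpretation of simply-typed Cocon in `𝔻̂` -/

def DTy.sem : DTy → STy
  | .tm => .tm
  | .arr A B => .arr A.sem B.sem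

/-- A domain-level context as an object of `𝔻`, given values for the context variables. -/
def DCtx.sem {n : ℕ} (ρ : Fin n → Dom) : DCtx n → Dom
  | .nil => Dom.unit
  | .var i => ρ i
  | .snoc Ψ A => Dom.times (Ψ.sem ρ) A.sem

/-- Types over a crisp context only depend on the values `ρ` of the context variables; `τ.sem ρ` is
the presheaf interpreting `τ` at `ρ`. -/
def CTy.sem : {n : ℕ} → CTy n → (Fin n → Dom) → Psh
  | _, .box Ψ A, ρ => flat.obj (Fn (El (Ψ.sem ρ)) (El (Dom.one A.sem)))
  | _, .boxv Ψ A, ρ => flat.obj (FnV (Ψ.sem ρ) A.sem)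
  | _, .fn τ₁ τ₂, ρ => CrispFn (τ₁.sem ρ) fun _ => τ₂.sem ρ
  | _, .pi τ, ρ => CrispFn Obj fun c => τ.sem (vcons c ρ)

theorem DCtx.sem_sub {n m : ℕ} (Ψ : DCtx n) (θ : Fin n → DCtx m) (ρ : Fin m → Dom) :
    (Ψ.sub θ).sem ρ = Ψ.sem fun i => (θ i).sem ρ := by
  induction Ψ <;> simp_all [DCtx.sub, DCtx.sem]

theorem CTy.sem_sub {n m : ℕ} (τ : CTy n) (θ : Fin n → DCtx m) (ρ : Fin m → Dom) :
    (τ.sub θ).sem ρ = τ.sem fun i => (θ i).sem ρ := by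
  induction τ generalizing m with
  | pi τ ih =>
    simp only [CTy.sub, CTy.sem, ih]
    congr 1
    funext c
    congr 1
    refine vcons_ext rfl fun i => ?_
    change ((θ i).sub _).sem _ = (θ i).sem ρ
    rw [DCtx.sem_sub]
    rfl
  | fn τ₁ τ₂ ih₁ ih₂ =>
    change CrispFn _ _ = CrispFn _ _
    rw [ih₁]
    simp only [ih₂]
  | _ => simp_all [CTy.sub, CTy.sem, DCtx.sem_sub]

theorem CTy.sem_weaken {n : ℕ} (τ : CTy n) (c : Dom) (ρ : Fin n → Dom) :
    τ.weaken.sem (vcons c ρ) = τ.sem ρ := by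
  rw [CTy.weaken, CTy.sem_sub]; rfl

theorem CTy.sem_inst {n : ℕ} (τ : CTy (n + 1)) (Ψ : DCtx n) (ρ : Fin n → Dom) :
    (τ.inst Ψ).sem ρ = τ.sem (vcons (Ψ.sem ρ) ρ) := by
  rw [CTy.inst, CTy.sem_sub]
  congr 1
  exact vcons_ext rfl fun _ => rfl

theorem CTy.sem_extTm {n : ℕ} (τ : CTy (n + 1)) (c : Dom) (ρ : Fin n → Dom) :
    τ.extTm.sem (vcons c ρ) = τ.sem (vcons (Dom.times c .tm) ρ) := by
  rw [CTy.extTm, CTy.sem_sub]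
  congr 1
  exact vcons_ext rfl fun _ => rfl

/-- The data interpreting a computation-level context: the set of elements of the crisp context and
the values of its context variables. -/
structure Crisp (n : ℕ) where
  carrier : Type
  env : carrier → Fin n → Dom

/-- `⟦Γ, y:τ⟧ = ⟦Γ⟧, y :: ⟦τ⟧` and `⟦Γ, ψ:ctx⟧ = ⟦Γ⟧, ψ :: Obj`; as all variables are crisp, an
element consists of closed elements. -/
def CCtx.sem : {n : ℕ} → CCtx n → Crisp n
  | _, .nil => ⟨Unit, fun _ => Fin.elim0⟩
  | _, .tm Γ τ => ⟨Σ s : Γ.sem.carrier, (τ.sem (Γ.sem.env s)).obj top, fun s => Γ.sem.env s.1⟩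
  | _, .ctx Γ => ⟨Σ _ : Γ.sem.carrier, Obj.obj top, fun s => vcons s.2 (Γ.sem.env s.1)⟩

/-- The elements of `⟦Γ⟧`. -/
abbrev CCtx.El {n : ℕ} (Γ : CCtx n) : Type := Γ.sem.carrier

abbrev CCtx.env {n : ℕ} (Γ : CCtx n) (s : Γ.El) : Fin n → Dom := Γ.sem.env s

def CVar.sem : {n : ℕ} → {Γ : CCtx n} → {τ : CTy n} → CVar Γ τ → (s : Γ.El) →
    (τ.sem (Γ.env s)).obj top
  | _, _, _, .zero, s => s.2
  | _, _, _, .succ y, s => y.sem s.1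
  | _, _, _, .succCtx (τ := τ) y, s =>
      cast (congrArg (fun X : Psh => X.obj top) (τ.sem_weaken _ _).symm) (y.sem s.1)

/-- `snd ∘ fstᵏ`. -/
def DVar.sem {n : ℕ} (ρ : Fin n → Dom) {Ψ : DCtx n} {A : DTy} :
    DVar Ψ A → (Ψ.sem ρ ⟶ Dom.one A.sem)
  | .zero => Dom.snd
  | .succ x => Dom.fst ≫ x.sem ρ

/-- `fstⁿ`. -/
def Wk.sem {n : ℕ} (ρ : Fin n → Dom) {Φ Ψ : DCtx n} : Wk Φ Ψ → (Φ.sem ρ ⟶ Ψ.sem ρ)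
  | .refl => 𝟙 _
  | .drop w => Dom.fst ≫ w.sem ρ

theorem DVar.sem_isProj {n : ℕ} (ρ : Fin n → Dom) {Ψ : DCtx n} {A : DTy} (x : DVar Ψ A) :
    IsProj (x.sem ρ) := by
  induction x with
  | zero => exact .snd
  | succ x ih => exact .fst ih

theorem Wk.sem_isProj {n : ℕ} (ρ : Fin n → Dom) {Φ Ψ : DCtx n} {A : STy} (w : Wk Φ Ψ)
    (p : Ψ.sem ρ ⟶ Dom.one A) (hp : IsProj p) : IsProj (w.sem ρ ≫ p) := by
  induction w with
  | refl => change IsProj (𝟙 _ ≫ p); rw [Category.id_comp]; exact hp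
  | drop w ih => change IsProj ((Dom.fst ≫ w.sem ρ) ≫ p); rw [Category.assoc]; exact .fst (ih p hp)


mutual

/-- `⟦Γ; Ψ ⊢ M : A⟧ : (u : El ⟦Ψ⟧) → El ⟦A⟧`, at each element of `⟦Γ⟧`. -/
noncomputable def DTm.sem : {n : ℕ} → {Γ : CCtx n} → {Ψ : DCtx n} → {A : DTy} → DTm Γ Ψ A →
    (s : Γ.El) → Glob (Fn (El (Ψ.sem (Γ.env s))) (El (Dom.one A.sem)))
  | _, Γ, _, _, .var x, s => lamU (yoneda.map (x.sem (Γ.env s)))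
  | _, _, _, _, .cLam, _ => lamU (constU lamConst)
  | _, _, _, _, .cApp, _ => lamU (constU appConst)
  | _, _, _, _, .app M N, s => lamU (arrowE (ap (M.sem s)) (ap (N.sem s)))
  | _, _, _, _, .lam M, s => lamU (curryU (ap (M.sem s)) ≫ arrowI _ _)
  | _, _, _, _, .unbox t σ, s =>
      letBox (t.sem s) fun x => lamU (ap (σ.sem s) ≫ ap (Psh.ofTop _ x))
  | _, _, _, _, .unboxv t σ, s =>
      letBox (t.sem s) fun x => lamU (ap (σ.sem s) ≫ ap ((Psh.ofTop _ x).map (inclV _ _)))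

/-- `⟦Γ; Φ ⊢ σ : Ψ⟧ : (u : El ⟦Φ⟧) → El ⟦Ψ⟧`, at each element of `⟦Γ⟧`. -/
noncomputable def DSub.sem : {n : ℕ} → {Γ : CCtx n} → {Φ Ψ : DCtx n} → DSub Γ Φ Ψ →
    (s : Γ.El) → Glob (Fn (El (Φ.sem (Γ.env s))) (El (Ψ.sem (Γ.env s))))
  | _, Γ, _, _, .wk w, s => lamU (yoneda.map (w.sem (Γ.env s)))
  | _, _, _, _, .nil, _ => lamU (yoneda.map (Dom.toUnit _))
  | _, _, _, _, .snoc σ M, s => lamU (pairU (ap (σ.sem s)) (ap (M.sem s)))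

/-- `⟦Γ ⊢ C : (Ψ ⊢ᵥ A)⟧ : (u : El ⟦Ψ⟧) →ᵥ El ⟦A⟧`, at each element of `⟦Γ⟧`. -/
noncomputable def VObj.sem : {n : ℕ} → {Γ : CCtx n} → {Ψ : DCtx n} → {A : DTy} → VObj Γ Ψ A →
    (s : Γ.El) → Glob (FnV (Ψ.sem (Γ.env s)) A.sem)
  | _, Γ, _, _, .var x, s => projV (x.sem (Γ.env s)) (x.sem_isProj _)
  | _, Γ, _, _, .unbox t w, s =>
      letBox (t.sem s) fun x =>
        (Psh.ofTop _ x).map (precompV (w.sem (Γ.env s)) (w.sem_isProj (Γ.env s)))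

/-- `⟦Γ ⊢ t : τ⟧ : ⟦τ⟧`, at each element of `⟦Γ⟧`. -/
noncomputable def CTm.sem : {n : ℕ} → {Γ : CCtx n} → {τ : CTy n} → CTm Γ τ →
    (s : Γ.El) → Glob (τ.sem (Γ.env s))
  | _, _, _, .var y, s => Psh.ofTop _ (y.sem s)
  | _, _, _, .box M, s => boxIntro (M.sem s)
  | _, _, _, .boxv C, s => boxIntro (C.sem s)
  | _, _, _, .fn t, s => crispLam fun x => t.sem ⟨s, x⟩
  | _, _, _, .fnCtx t, s => crispLam (X := Obj) fun c => t.sem ⟨s, c⟩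
  | _, _, _, .app t r, s => crispApp (t.sem s) (r.sem s)
  | _, Γ, _, .appCtx (τ := τ) t Ψ h, s =>
      (crispApp (t.sem s) (objGlob (Ψ.sem (Γ.env s)))).cast
        (by rw [← h, CTy.sem_inst]; rfl)
  | _, Γ, _, .recTm τ bv ba hl bl Ψ t h, s =>
      (Psh.ofTop _ (recSem (R := fun c => (τ.sem (vcons c (Γ.env s))).obj top)
        (fun c p => (bv.sem ⟨⟨s, c⟩, p⟩).1 top)
        (fun c m n a b => (ba.sem ⟨⟨⟨⟨⟨s, c⟩, m⟩, n⟩, a⟩, b⟩).1 top)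
        (fun c m a => (bl.sem ⟨⟨⟨s, c⟩, m⟩,
          cast (congrArg (fun X : Psh => X.obj top) (by rw [← hl]; exact (τ.sem_extTm _ _).symm))
            a⟩).1 top)
        (Ψ.sem (Γ.env s)) ((t.sem s).1 top))).cast (by rw [← h, CTy.sem_inst])

end

/-! ### The interpretation as morphisms of `𝔻̂` -/

/-- The comprehension `⟦Γ⟧.X` of a type `X` over a constant presheaf on the set `S`; such a type, a
presheaf on the category of elements `S × 𝔻`, is a family of presheaves on `𝔻`. -/
def total {S : Type} (X : S → Psh) : Psh where
  obj Φ := Σ s, (X s).obj Φ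
  map σ := ↾fun x => ⟨x.1, (X x.1).map σ x.2⟩
  map_id Φ := by
    refine ConcreteCategory.hom_ext _ _ fun (x : Σ s, (X s).obj Φ) => ?_
    exact Sigma.ext rfl (heq_of_eq ((X x.1).map_id_apply Φ x.2))
  map_comp {Φ _ _} σ τ := by
    refine ConcreteCategory.hom_ext _ _ fun (x : Σ s, (X s).obj Φ) => ?_
    exact Sigma.ext rfl (heq_of_eq ((X x.1).map_comp_apply σ τ x.2))

/-- The projection `⟦Γ⟧.X ⟶ ⟦Γ⟧`. -/
def total.proj {S : Type} (X : S → Psh) : total X ⟶ (Functor.const Domᵒᵖ).obj S where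
  app _ := ↾fun x => x.1

/-- Terms of the internal language of type `X`: sections of the projection. -/
def Section {S : Type} (X : S → Psh) : Type :=
  { m : (Functor.const Domᵒᵖ).obj S ⟶ total X // m ≫ total.proj X = 𝟙 _ }

def Section.mk {S : Type} {X : S → Psh} (m : ∀ s, Glob (X s)) : Section X :=
  ⟨{ app := fun Φ => ↾fun s => ⟨s, (m s).1 Φ⟩
     naturality := fun Φ Ψ σ => by
      refine ConcreteCategory.hom_ext _ _ fun (s : S) => ?_
      exact Sigma.ext rfl (heq_of_eq ((m s).2 σ).symm) }, rfl⟩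

/-- `⟦Γ⟧ | · ⊢ ⟦Γ; Ψ ⊢ M : A⟧ : (u : El ⟦Ψ⟧) → El ⟦A⟧`. -/
noncomputable def DTm.interp {n : ℕ} {Γ : CCtx n} {Ψ : DCtx n} {A : DTy} (M : DTm Γ Ψ A) :
    Section fun s : Γ.El => Fn (El (Ψ.sem (Γ.env s))) (El (Dom.one A.sem)) :=
  Section.mk M.sem

/-- `⟦Γ⟧ | · ⊢ ⟦Γ; Φ ⊢ σ : Ψ⟧ : (u : El ⟦Φ⟧) → El ⟦Ψ⟧`. -/
noncomputable def DSub.interp {n : ℕ} {Γ : CCtx n} {Φ Ψ : DCtx n} (σ : DSub Γ Φ Ψ) :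
    Section fun s : Γ.El => Fn (El (Φ.sem (Γ.env s))) (El (Ψ.sem (Γ.env s))) :=
  Section.mk σ.sem

/-- The domain of discourse: computation-level types and `ctx`. -/
inductive Disc (n : ℕ) : Type
  | ty (τ : CTy n) : Disc n
  | ctx : Disc n

/-- `⟦Γ ⊢ τ̌⟧`. -/
def Disc.sem {n : ℕ} (ρ : Fin n → Dom) : Disc n → Psh
  | .ty τ => τ.sem ρ
  | .ctx => Obj

/-- The terms `Γ ⊢ t : τ̌`; those of type `ctx` are the domain-level contexts. -/
def Arg {n : ℕ} (Γ : CCtx n) : Disc n → Type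
  | .ty τ => CTm Γ τ
  | .ctx => DCtx n

/-- `Γ ⊢ t₁ ≡ t₂ : τ̌`; domain-level contexts are equal if they are the same. -/
def Arg.Eqv {n : ℕ} {Γ : CCtx n} : {d : Disc n} → Arg Γ d → Arg Γ d → Prop
  | .ty _, t, s => CTm.Eqv t s
  | .ctx, Ψ, Φ => Ψ = Φ

noncomputable def Arg.sem {n : ℕ} {Γ : CCtx n} : {d : Disc n} → Arg Γ d → (s : Γ.El) →
    Glob (d.sem (Γ.env s))
  | .ty _, t, s => CTm.sem t s
  | .ctx, Ψ, s => objGlob (DCtx.sem (Γ.env s) Ψ)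

/-- `⟦Γ⟧ | · ⊢ ⟦Γ ⊢ t : τ̌⟧ : ⟦Γ ⊢ τ̌⟧`. -/
noncomputable def Arg.interp {n : ℕ} {Γ : CCtx n} {d : Disc n} (t : Arg Γ d) :
    Section fun s : Γ.El => d.sem (Γ.env s) :=
  Section.mk t.sem

end Cocon

namespace Cocon

/-! ## Equations of the term model -/

/-- The morphism of `𝔻` given by a term. -/
def STm.cls {Φ : Dom} {A : STy} (t : STm Φ A) : Φ ⟶ Dom.one A :=
  Quotient.mk (STup.setoid Φ [A]) (Dom.tup t)

theorem STm.Eqv.cls_eq {Φ : Dom} {A : STy} {t u : STm Φ A} (h : t.Eqv u) : t.cls = u.cls :=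
  Quotient.sound (s := STup.setoid Φ [A]) fun _ x => match x with
    | .zero => h

namespace Dom

theorem mk_one {Φ : Dom} {A : STy} (σ : STup Φ [A]) :
    (Quotient.mk (STup.setoid Φ [A]) σ : Φ ⟶ one A) = STm.cls (σ A .zero) :=
  mk_ext fun _ x => match x with
    | .zero => rfl

theorem exists_cls {Φ : Dom} {A : STy} (f : Φ ⟶ one A) : ∃ t : STm Φ A, f = t.cls := by
  obtain ⟨σ⟩ := f
  exact ⟨_, mk_one σ⟩

theorem mk_comp_cls {Φ Ψ : Dom} {A : STy} (σ : STup Φ Ψ) (t : STm Ψ A) :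
    (Quotient.mk (STup.setoid Φ Ψ) σ : Φ ⟶ Ψ) ≫ t.cls = (t.sub σ).cls :=
  mk_ext fun _ x => match x with
    | .zero => rfl

theorem fst_comp_cls {Φ : Dom} {A B : STy} (t : STm Φ A) :
    (fst : times Φ B ⟶ Φ) ≫ t.cls = (t.wk B).cls := by
  refine (mk_comp_cls _ t).trans (congrArg STm.cls ?_)
  exact (STm.ren_eq_sub _ _).symm

theorem app_cls {Φ : Dom} {A B : STy} (t : STm Φ (.arr A B)) (u : STm Φ A) :
    app t.cls u.cls = (STm.app t u).cls := rfl

theorem pair_fst_snd {Φ : Dom} {A : STy} : pair (fst : times Φ A ⟶ Φ) snd = 𝟙 (times Φ A) :=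
  mk_ext fun _ x => match x with
    | .zero => rfl
    | .succ _ => rfl

theorem pair_eta {Φ Ψ : Dom} {A : STy} (σ : Φ ⟶ times Ψ A) : pair (σ ≫ fst) (σ ≫ snd) = σ := by
  rw [← comp_pair, pair_fst_snd, Category.comp_id]

theorem lam_eta {Φ : Dom} {A B : STy} (f : Φ ⟶ one (.arr A B)) :
    lam (app ((fst : times Φ A ⟶ Φ) ≫ f) snd) = f := by
  obtain ⟨t, rfl⟩ := exists_cls f
  rw [fst_comp_cls]
  exact (STm.Eqv.eta t).symm.cls_eq

theorem app_lam {Φ : Dom} {A B : STy} (t : times Φ A ⟶ one B) (u : Φ ⟶ one A) :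
    app (lam t) u = pair (𝟙 Φ) u ≫ t := by
  obtain ⟨t, rfl⟩ := exists_cls t
  obtain ⟨u, rfl⟩ := exists_cls u
  refine (STm.Eqv.beta t u).cls_eq.trans ?_
  exact (mk_comp_cls _ t).symm

theorem app_comp_lam {Φ Ψ : Dom} {A B : STy} (δ : Ψ ⟶ Φ) (t : times Φ A ⟶ one B)
    (u : Ψ ⟶ one A) : app (δ ≫ lam t) u = pair δ u ≫ t := by
  rw [comp_lam, app_lam, ← Category.assoc, comp_pair, ← Category.assoc, pair_fst, pair_snd,
    Category.id_comp]

/-- Pairing of elements of product types. -/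
def prodPair {Φ : Dom} {A B : STy} : (Φ ⟶ one A) → (Φ ⟶ one B) → (Φ ⟶ one (.prod A B)) :=
  Quotient.map₂ (fun (t : STup Φ [A]) (u : STup Φ [B]) => tup (.pair (t _ .zero) (u _ .zero)))
    (fun _ _ h _ _ h' _ x => match x with
      | .zero => .pair (h _ .zero) (h' _ .zero))

def prodFst {Φ : Dom} {A B : STy} : (Φ ⟶ one (.prod A B)) → (Φ ⟶ one A) :=
  Quotient.map (fun (t : STup Φ [.prod A B]) => tup (.fst (t _ .zero)))
    (fun _ _ h _ x => match x with
      | .zero => .fst (h _ .zero))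

def prodSnd {Φ : Dom} {A B : STy} : (Φ ⟶ one (.prod A B)) → (Φ ⟶ one B) :=
  Quotient.map (fun (t : STup Φ [.prod A B]) => tup (.snd (t _ .zero)))
    (fun _ _ h _ x => match x with
      | .zero => .snd (h _ .zero))

theorem comp_prodPair {Φ Ψ : Dom} {A B : STy} (δ : Ψ ⟶ Φ) (t : Φ ⟶ one A) (u : Φ ⟶ one B) :
    δ ≫ prodPair t u = prodPair (δ ≫ t) (δ ≫ u) := by
  obtain ⟨δ⟩ := δ
  obtain ⟨t⟩ := t
  obtain ⟨u⟩ := u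
  exact mk_ext fun _ x => match x with
    | .zero => rfl

theorem comp_prodFst {Φ Ψ : Dom} {A B : STy} (δ : Ψ ⟶ Φ) (t : Φ ⟶ one (.prod A B)) :
    δ ≫ prodFst t = prodFst (δ ≫ t) := by
  obtain ⟨δ⟩ := δ
  obtain ⟨t⟩ := t
  exact mk_ext fun _ x => match x with
    | .zero => rfl

theorem comp_prodSnd {Φ Ψ : Dom} {A B : STy} (δ : Ψ ⟶ Φ) (t : Φ ⟶ one (.prod A B)) :
    δ ≫ prodSnd t = prodSnd (δ ≫ t) := by
  obtain ⟨δ⟩ := δ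
  obtain ⟨t⟩ := t
  exact mk_ext fun _ x => match x with
    | .zero => rfl

theorem prodFst_prodPair {Φ : Dom} {A B : STy} (t : Φ ⟶ one A) (u : Φ ⟶ one B) :
    prodFst (prodPair t u) = t := by
  obtain ⟨t, rfl⟩ := exists_cls t
  obtain ⟨u, rfl⟩ := exists_cls u
  exact (STm.Eqv.fst_pair t u).cls_eq

theorem prodSnd_prodPair {Φ : Dom} {A B : STy} (t : Φ ⟶ one A) (u : Φ ⟶ one B) :
    prodSnd (prodPair t u) = u := by
  obtain ⟨t, rfl⟩ := exists_cls t
  obtain ⟨u, rfl⟩ := exists_cls u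
  exact (STm.Eqv.snd_pair t u).cls_eq

theorem prodPair_eta {Φ : Dom} {A B : STy} (t : Φ ⟶ one (.prod A B)) :
    prodPair (prodFst t) (prodSnd t) = t := by
  obtain ⟨t, rfl⟩ := exists_cls t
  exact (STm.Eqv.pair_eta t).symm.cls_eq

theorem unit_ext {Φ : Dom} (t u : Φ ⟶ one .unit) : t = u := by
  obtain ⟨t, rfl⟩ := exists_cls t
  obtain ⟨u, rfl⟩ := exists_cls u
  exact ((STm.Eqv.unit_eta t).trans (STm.Eqv.unit_eta u).symm).cls_eq

theorem exists_var_of_isProj {c : Dom} {A : STy} {p : c ⟶ one A} (hp : IsProj p) :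
    ∃ x : SVar c A, p = STm.cls (.var x) := by
  induction hp with
  | snd => exact ⟨.zero, rfl⟩
  | fst _ ih =>
    obtain ⟨x, rfl⟩ := ih
    exact ⟨.succ x, fst_comp_cls _⟩

end Dom

/-! ## A glued model

Elements of type `tm` are trees that record how a term is built from `app` and `lam`. Evaluation in
this model shows that these constructors are injective and disjoint, and that terms decompose into
finitely many of them. -/

inductive Tree : Dom → Type
  | leaf {c : Dom} (t : c ⟶ Dom.one .tm) : Tree c
  | app {c : Dom} (a b : Tree c) : Tree c
  | lam {c : Dom} (a : Tree (Dom.times c .tm)) : Tree c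

namespace Tree

/-- The term described by a tree. -/
def val : {c : Dom} → Tree c → (c ⟶ Dom.one .tm)
  | _, .leaf t => t
  | _, .app a b => semApp a.val b.val
  | c, .lam a => Dom.app (Dom.cLam c) (Dom.lam a.val)

def res : {c : Dom} → Tree c → {d : Dom} → (d ⟶ c) → Tree d
  | _, .leaf t, _, δ => .leaf (δ ≫ t)
  | _, .app a b, _, δ => .app (a.res δ) (b.res δ)
  | _, .lam a, _, δ => .lam (a.res (Dom.pair (Dom.fst ≫ δ) Dom.snd))

theorem res_id {c : Dom} (a : Tree c) : a.res (𝟙 c) = a := by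
  induction a with
  | leaf t => simp [res]
  | app a b iha ihb => simp [res, iha, ihb]
  | lam a ih =>
    simp only [res, Category.comp_id]
    rw [Dom.pair_fst_snd, ih]

theorem res_comp {c d e : Dom} (a : Tree c) (δ : d ⟶ c) (δ' : e ⟶ d) :
    a.res (δ' ≫ δ) = (a.res δ).res δ' := by
  induction a generalizing d e with
  | leaf t => simp [res]
  | app a b iha ihb => simp [res, iha, ihb]
  | lam a ih =>
    simp only [res, ← ih]
    rw [Dom.comp_pair, ← Category.assoc, ← Category.assoc, Dom.pair_fst, Dom.pair_snd,
      Category.assoc]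

theorem val_res {c d : Dom} (a : Tree c) (δ : d ⟶ c) : (a.res δ).val = δ ≫ a.val := by
  induction a generalizing d with
  | leaf t => rfl
  | app a b iha ihb => simp only [res, val, iha, ihb, comp_semApp]
  | lam a ih => simp only [res, val, ih, Dom.comp_app, Dom.comp_cLam, Dom.comp_lam]

end Tree

/-- A presheaf of elements of type `A`, each of which denotes a term, with a chosen natural element
denoting any given term. -/
structure Glued (A : STy) where
  El : Dom → Type
  res : {c d : Dom} → (d ⟶ c) → El c → El d
  res_id : ∀ {c : Dom} (x : El c), res (𝟙 c) x = x
  res_comp : ∀ {c d e : Dom} (δ : d ⟶ c) (δ' : e ⟶ d) (x : El c),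
    res (δ' ≫ δ) x = res δ' (res δ x)
  quote : {c : Dom} → El c → (c ⟶ Dom.one A)
  quote_res : ∀ {c d : Dom} (δ : d ⟶ c) (x : El c), quote (res δ x) = δ ≫ quote x
  reflect : {c : Dom} → (c ⟶ Dom.one A) → El c
  res_reflect : ∀ {c d : Dom} (δ : d ⟶ c) (t : c ⟶ Dom.one A),
    res δ (reflect t) = reflect (δ ≫ t)
  quote_reflect : ∀ {c : Dom} (t : c ⟶ Dom.one A), quote (reflect t) = t

@[ext]
structure GluedFun {A B : STy} (X : Glued A) (Y : Glued B) (c : Dom) where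
  term : c ⟶ Dom.one (.arr A B)
  fn : ∀ {d : Dom}, (d ⟶ c) → X.El d → Y.El d
  nat : ∀ {d e : Dom} (δ : d ⟶ c) (δ' : e ⟶ d) (x : X.El d),
    fn (δ' ≫ δ) (X.res δ' x) = Y.res δ' (fn δ x)
  quote : ∀ {d : Dom} (δ : d ⟶ c) (x : X.El d),
    Y.quote (fn δ x) = Dom.app (δ ≫ term) (X.quote x)

theorem GluedFun.fn_congr {A B : STy} {X : Glued A} {Y : Glued B} {c d : Dom}
    {f g : GluedFun X Y c} (h : f = g) (δ : d ⟶ c) {x y : X.El d} (h' : x = y) :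
    f.fn δ x = g.fn δ y := by
  rw [h, h']

namespace Glued

def tm : Glued .tm where
  El := Tree
  res δ a := a.res δ
  res_id := Tree.res_id
  res_comp δ δ' a := a.res_comp δ δ'
  quote := Tree.val
  quote_res δ a := a.val_res δ
  reflect := Tree.leaf
  res_reflect _ _ := rfl
  quote_reflect _ := rfl

def unit : Glued .unit where
  El _ := Unit
  res _ x := x
  res_id _ := rfl
  res_comp _ _ _ := rfl
  quote _ := STm.unit.cls
  quote_res _ _ := Dom.unit_ext _ _
  reflect _ := ()
  res_reflect _ _ := rfl
  quote_reflect _ := Dom.unit_ext _ _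

def prod {A B : STy} (X : Glued A) (Y : Glued B) : Glued (.prod A B) where
  El c := X.El c × Y.El c
  res δ x := (X.res δ x.1, Y.res δ x.2)
  res_id x := Prod.ext (X.res_id _) (Y.res_id _)
  res_comp δ δ' x := Prod.ext (X.res_comp _ _ _) (Y.res_comp _ _ _)
  quote x := Dom.prodPair (X.quote x.1) (Y.quote x.2)
  quote_res δ x := by rw [X.quote_res, Y.quote_res, Dom.comp_prodPair]
  reflect t := (X.reflect (Dom.prodFst t), Y.reflect (Dom.prodSnd t))
  res_reflect δ t := by rw [X.res_reflect, Y.res_reflect, Dom.comp_prodFst, Dom.comp_prodSnd]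
  quote_reflect t := by rw [X.quote_reflect, Y.quote_reflect, Dom.prodPair_eta]

def arr {A B : STy} (X : Glued A) (Y : Glued B) : Glued (.arr A B) where
  El c := GluedFun X Y c
  res δ f :=
    { term := δ ≫ f.term
      fn := fun δ' x => f.fn (δ' ≫ δ) x
      nat := fun δ' δ'' x => by rw [Category.assoc, f.nat]
      quote := fun δ' x => by rw [f.quote, Category.assoc] }
  res_id f := by
    apply GluedFun.ext
    · exact Category.id_comp _
    · funext d δ x
      exact congrArg (fun δ => f.fn δ x) (Category.comp_id δ)
  res_comp δ δ' f := by
    apply GluedFun.ext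
    · exact Category.assoc _ _ _
    · funext d δ'' x
      exact congrArg (fun δ => f.fn δ x) (Category.assoc _ _ _).symm
  quote f := f.term
  quote_res _ _ := rfl
  reflect t :=
    { term := t
      fn := fun δ x => Y.reflect (Dom.app (δ ≫ t) (X.quote x))
      nat := fun δ δ' x => by rw [Y.res_reflect, X.quote_res, Dom.comp_app, Category.assoc]
      quote := fun δ x => Y.quote_reflect _ }
  res_reflect δ t := by
    apply GluedFun.ext
    · rfl
    · funext d δ' x
      simp only [Category.assoc]
  quote_reflect _ := rfl

end Glued

/-- The interpretation of types in the glued model. -/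
def STy.glued : (A : STy) → Glued A
  | .tm => .tm
  | .unit => .unit
  | .prod A B => .prod A.glued B.glued
  | .arr A B => .arr A.glued B.glued

/-- Environments of the glued model. -/
abbrev GEnv (Ψ : List STy) (c : Dom) : Type := ∀ A, SVar Ψ A → A.glued.El c

namespace GEnv

def res {Ψ c d : Dom} (δ : d ⟶ c) (ρ : GEnv Ψ c) : GEnv Ψ d :=
  fun A x => A.glued.res δ (ρ A x)

def cons {Ψ c : Dom} {B : STy} (ρ : GEnv Ψ c) (b : B.glued.El c) : GEnv (B :: Ψ) c
  | _, .zero => b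
  | _, .succ x => ρ _ x

theorem res_id {Ψ c : Dom} (ρ : GEnv Ψ c) : ρ.res (𝟙 c) = ρ :=
  funext fun A => funext fun _ => A.glued.res_id _

theorem res_comp {Ψ c d e : Dom} (δ : d ⟶ c) (δ' : e ⟶ d) (ρ : GEnv Ψ c) :
    ρ.res (δ' ≫ δ) = (ρ.res δ).res δ' :=
  funext fun A => funext fun _ => A.glued.res_comp _ _ _

theorem res_cons {Ψ c d : Dom} {B : STy} (δ : d ⟶ c) (ρ : GEnv Ψ c)
    (b : B.glued.El c) : (ρ.cons b).res δ = (ρ.res δ).cons (B.glued.res δ b) := by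
  funext A x
  cases x <;> rfl

/-- The tuple of terms denoted by an environment. -/
def quote : {Ψ c : Dom} → GEnv Ψ c → (c ⟶ Ψ)
  | [], c, _ => Dom.toUnit c
  | A :: _, _, ρ =>
    Dom.pair (quote fun _ x => ρ _ (.succ x)) (A.glued.quote (ρ _ .zero))

theorem quote_cons {Ψ c : Dom} {B : STy} (ρ : GEnv Ψ c) (b : B.glued.El c) :
    (ρ.cons b).quote = Dom.pair ρ.quote (B.glued.quote b) := rfl

theorem quote_res {Ψ c d : Dom} (δ : d ⟶ c) (ρ : GEnv Ψ c) :
    (ρ.res δ).quote = δ ≫ ρ.quote := by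
  induction Ψ with
  | nil => exact Dom.toUnit_unique _ _
  | cons A Ψ ih =>
    refine Eq.trans ?_ (Dom.comp_pair δ _ _).symm
    exact congrArg₂ Dom.pair (ih fun _ x => ρ _ (.succ x)) (A.glued.quote_res δ _)

theorem quote_comp_var {Ψ c : Dom} {A : STy} (ρ : GEnv Ψ c) (x : SVar Ψ A) :
    ρ.quote ≫ STm.cls (.var x) = A.glued.quote (ρ A x) := by
  induction x with
  | zero => exact Dom.pair_snd _ _
  | succ x ih =>
    refine Eq.trans ?_ (ih fun _ x => ρ _ (.succ x))
    refine (congrArg (ρ.quote ≫ ·) (Dom.fst_comp_cls (.var x)).symm).trans ?_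
    refine (Category.assoc _ _ _).symm.trans ?_
    exact congrArg (· ≫ _) (Dom.pair_fst _ _)

end GEnv

/-- A denotation of a term in the glued model. -/
structure Den {Ψ : Dom} {A : STy} (t : STm Ψ A) where
  fn : ∀ {c : Dom}, GEnv Ψ c → A.glued.El c
  nat : ∀ {c d : Dom} (δ : d ⟶ c) (ρ : GEnv Ψ c), fn (ρ.res δ) = A.glued.res δ (fn ρ)
  quote : ∀ {c : Dom} (ρ : GEnv Ψ c), A.glued.quote (fn ρ) = ρ.quote ≫ t.cls

namespace Den

def var {Ψ : Dom} {A : STy} (x : SVar Ψ A) : Den (.var x) where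
  fn ρ := ρ A x
  nat _ _ := rfl
  quote ρ := (ρ.quote_comp_var x).symm

def lam {Ψ : Dom} {A B : STy} {t : STm (A :: Ψ) B} (f : Den t) : Den (.lam t) where
  fn {c} ρ :=
    { term := ρ.quote ≫ STm.cls (.lam t)
      fn := fun δ x => f.fn ((ρ.res δ).cons x)
      nat := fun δ δ' x => by rw [GEnv.res_comp, ← GEnv.res_cons, f.nat]
      quote := fun δ x => by
        rw [f.quote, GEnv.quote_cons, GEnv.quote_res, ← Category.assoc]
        exact (Dom.app_comp_lam _ _ _).symm }
  nat δ ρ := by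
    apply GluedFun.ext
    · change (ρ.res δ).quote ≫ _ = δ ≫ ρ.quote ≫ _
      rw [GEnv.quote_res, Category.assoc]
    · funext d δ' x
      change f.fn (((ρ.res δ).res δ').cons x) = f.fn ((ρ.res (δ' ≫ δ)).cons x)
      rw [GEnv.res_comp]
  quote _ := rfl

def app {Ψ : Dom} {A B : STy} {t : STm Ψ (.arr A B)} {u : STm Ψ A} (f : Den t) (g : Den u) :
    Den (.app t u) where
  fn {c} ρ := GluedFun.fn (f.fn ρ) (𝟙 c) (g.fn ρ)
  nat {c d} δ ρ := by
    rw [f.nat, g.nat]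
    refine Eq.trans ?_ (GluedFun.nat (f.fn ρ) (𝟙 c) δ (g.fn ρ))
    change GluedFun.fn (f.fn ρ) (𝟙 d ≫ δ) _ = _
    rw [Category.id_comp, Category.comp_id]
  quote {c} ρ := by
    refine (GluedFun.quote (f.fn ρ) (𝟙 c) (g.fn ρ)).trans ?_
    have h : GluedFun.term (f.fn ρ) = _ := f.quote ρ
    rw [h, g.quote, Category.id_comp, ← Dom.comp_app, Dom.app_cls]

def pair {Ψ : Dom} {A B : STy} {t : STm Ψ A} {u : STm Ψ B} (f : Den t) (g : Den u) :
    Den (.pair t u) where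
  fn ρ := (f.fn ρ, g.fn ρ)
  nat δ ρ := Prod.ext (f.nat δ ρ) (g.nat δ ρ)
  quote ρ := by
    change Dom.prodPair (A.glued.quote (f.fn ρ)) (B.glued.quote (g.fn ρ)) = _
    rw [f.quote, g.quote, ← Dom.comp_prodPair]
    rfl

def fst {Ψ : Dom} {A B : STy} {t : STm Ψ (.prod A B)} (f : Den t) : Den (.fst t) where
  fn ρ := Prod.fst (f.fn ρ)
  nat δ ρ := by rw [f.nat]; rfl
  quote ρ := by
    have h := congrArg Dom.prodFst (f.quote ρ)
    rw [← Dom.comp_prodFst] at h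
    exact (Dom.prodFst_prodPair _ _).symm.trans h

def snd {Ψ : Dom} {A B : STy} {t : STm Ψ (.prod A B)} (f : Den t) : Den (.snd t) where
  fn ρ := Prod.snd (f.fn ρ)
  nat δ ρ := by rw [f.nat]; rfl
  quote ρ := by
    have h := congrArg Dom.prodSnd (f.quote ρ)
    rw [← Dom.comp_prodSnd] at h
    exact (Dom.prodSnd_prodPair _ _).symm.trans h

def unit {Ψ : Dom} : Den (.unit : STm Ψ .unit) where
  fn _ := ()
  nat _ _ := rfl
  quote _ := Dom.unit_ext _ _

def cApp {Ψ : Dom} : Den (.cApp : STm Ψ _) where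
  fn {c} _ :=
    { term := Dom.cApp c
      fn := fun {d} δ a =>
        { term := Dom.app (Dom.cApp d) (Tree.val a)
          fn := fun δ' b => Tree.app (Tree.res a δ') b
          nat := fun δ' δ'' b => congrArg (Tree.app · _) (Tree.res_comp a δ' δ'')
          quote := fun δ' b => by
            rw [Dom.comp_app, Dom.comp_cApp]
            exact congrArg (fun t => Dom.app (Dom.app _ t) (Tree.val b)) (Tree.val_res a δ') }
      nat := fun δ δ' a => by
        apply GluedFun.ext
        · refine Eq.trans ?_ (Dom.comp_app δ' (Dom.cApp _) (Tree.val a)).symm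
          rw [Dom.comp_cApp]
          exact congrArg (Dom.app (Dom.cApp _)) (Tree.val_res a δ')
        · funext e δ'' b
          exact congrArg (Tree.app · b) (Tree.res_comp a δ' δ'').symm
      quote := fun δ a => by rw [Dom.comp_cApp]; rfl }
  nat δ _ := by
    apply GluedFun.ext
    · exact (Dom.comp_cApp δ).symm
    · rfl
  quote {c} ρ := (Dom.comp_cApp ρ.quote).symm

def cLam {Ψ : Dom} : Den (.cLam : STm Ψ _) where
  fn {c} _ :=
    { term := Dom.cLam c
      fn := fun {d} δ (f : GluedFun Glued.tm Glued.tm d) =>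
        Tree.lam (f.fn (Dom.fst : Dom.times d .tm ⟶ d) (Tree.leaf Dom.snd))
      nat := fun {d e} δ δ' (f : GluedFun Glued.tm Glued.tm d) => by
        refine congrArg Tree.lam (Eq.trans ?_ (f.nat Dom.fst (Dom.pair (Dom.fst ≫ δ') Dom.snd) _))
        rw [Dom.pair_fst]
        refine congrArg (f.fn (Dom.fst ≫ δ')) (congrArg Tree.leaf (Dom.pair_snd _ _).symm)
      quote := fun {d} δ (f : GluedFun Glued.tm Glued.tm d) => by
        refine congrArg₂ Dom.app (Dom.comp_cLam δ).symm ?_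
        refine (congrArg Dom.lam (f.quote Dom.fst (Tree.leaf Dom.snd))).trans ?_
        exact Dom.lam_eta f.term }
  nat δ _ := by
    apply GluedFun.ext
    · exact (Dom.comp_cLam δ).symm
    · rfl
  quote {c} ρ := (Dom.comp_cLam ρ.quote).symm

end Den

/-- Evaluation in the glued model. -/
def STm.den {Ψ : Dom} {A : STy} : (t : STm Ψ A) → Den t
  | .var x => .var x
  | .lam t => .lam t.den
  | .app t u => .app t.den u.den
  | .pair t u => .pair t.den u.den
  | .fst t => .fst t.den
  | .snd t => .snd t.den
  | .unit => .unit
  | .cApp => .cApp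
  | .cLam => .cLam

def STm.eval {Ψ : Dom} {A : STy} (t : STm Ψ A) {c : Dom} (ρ : GEnv Ψ c) : A.glued.El c :=
  t.den.fn ρ

theorem GEnv.quote_sub {Φ Ψ c : Dom} (σ : STup Φ Ψ) (ρ : GEnv Φ c) :
    GEnv.quote (fun A x => (σ A x).eval ρ) =
      ρ.quote ≫ (Quotient.mk (STup.setoid Φ Ψ) σ : Φ ⟶ Ψ) := by
  induction Ψ with
  | nil => exact Dom.toUnit_unique _ _
  | cons A Ψ ih =>
    have h : (Quotient.mk (STup.setoid Φ (A :: Ψ)) σ : Φ ⟶ Dom.times Ψ A) =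
        Dom.pair (Quotient.mk (STup.setoid Φ Ψ) fun _ x => σ _ (.succ x)) (σ A .zero).cls :=
      Dom.mk_ext fun _ x => match x with
        | .zero => rfl
        | .succ _ => rfl
    refine Eq.trans ?_ ((Dom.comp_pair _ _ _).symm.trans (congrArg (ρ.quote ≫ ·) h.symm))
    exact congrArg₂ Dom.pair (ih fun _ x => σ _ (.succ x)) ((σ A .zero).den.quote ρ)

namespace STm

theorem eval_lam_ext {Φ Ψ : Dom} {A B : STy} {t : STm (A :: Φ) B} {u : STm (A :: Ψ) B}
    {c : Dom} {ρ : GEnv Φ c} {ρ' : GEnv Ψ c}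
    (h : ρ.quote ≫ (STm.lam t).cls = ρ'.quote ≫ (STm.lam u).cls)
    (h' : ∀ {d : Dom} (δ : d ⟶ c) (x : A.glued.El d),
      t.eval ((ρ.res δ).cons x) = u.eval ((ρ'.res δ).cons x)) :
    (STm.lam t).eval ρ = (STm.lam u).eval ρ' := by
  apply GluedFun.ext
  · exact h
  · funext d δ x
    exact h' δ x

theorem eval_ren {Φ Ψ : List STy} {A : STy} (t : STm Ψ A) (r : SRen Φ Ψ) {c : Dom}
    (ρ : GEnv Φ c) : (t.ren r).eval ρ = t.eval fun A x => ρ A (r A x) := by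
  induction t generalizing Φ c with
  | lam t ih =>
    refine eval_lam_ext ?_ fun δ x => (ih _ _).trans (congrArg t.eval ?_)
    · refine Eq.trans ?_ (congrArg (· ≫ _) (GEnv.quote_sub (fun A x => .var (r A x)) ρ)).symm
      refine Eq.trans (congrArg (ρ.quote ≫ ·) ?_) (Category.assoc _ _ _).symm
      refine Eq.trans ?_ (Dom.mk_comp_cls _ _).symm
      exact congrArg STm.cls (STm.ren_eq_sub (.lam t) r)
    · funext B y
      cases y <;> rfl
  | var x => rfl
  | app t u iht ihu => exact GluedFun.fn_congr (iht r ρ) _ (ihu r ρ)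
  | pair t u iht ihu => exact Prod.ext (iht r ρ) (ihu r ρ)
  | fst t ih => exact congrArg Prod.fst (ih r ρ)
  | snd t ih => exact congrArg Prod.snd (ih r ρ)
  | unit => rfl
  | cApp => rfl
  | cLam => rfl

theorem eval_sub {Φ Ψ : List STy} {A : STy} (t : STm Ψ A) (σ : STup Φ Ψ) {c : Dom}
    (ρ : GEnv Φ c) : (t.sub σ).eval ρ = t.eval fun A x => (σ A x).eval ρ := by
  induction t generalizing Φ c with
  | lam t ih =>
    refine eval_lam_ext ?_ fun δ x => (ih _ _).trans (congrArg t.eval ?_)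
    · refine Eq.trans ?_ (congrArg (· ≫ _) (GEnv.quote_sub σ ρ)).symm
      refine Eq.trans (congrArg (ρ.quote ≫ ·) ?_) (Category.assoc _ _ _).symm
      exact (Dom.mk_comp_cls σ (.lam t)).symm
    · funext B y
      cases y with
      | zero => rfl
      | succ y => exact (eval_ren _ _ _).trans ((σ B y).den.nat δ ρ)
  | var x => rfl
  | app t u iht ihu => exact GluedFun.fn_congr (iht σ ρ) _ (ihu σ ρ)
  | pair t u iht ihu => exact Prod.ext (iht σ ρ) (ihu σ ρ)
  | fst t ih => exact congrArg Prod.fst (ih σ ρ)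
  | snd t ih => exact congrArg Prod.snd (ih σ ρ)
  | unit => rfl
  | cApp => rfl
  | cLam => rfl

theorem Eqv.eval_eq {Ψ : List STy} {A : STy} {t u : STm Ψ A} (h : t.Eqv u) {c : Dom}
    (ρ : GEnv Ψ c) : t.eval ρ = u.eval ρ := by
  induction h generalizing c with
  | refl t => rfl
  | symm _ ih => exact (ih ρ).symm
  | trans _ _ ih ih' => exact (ih ρ).trans (ih' ρ)
  | lam h ih =>
    exact eval_lam_ext (congrArg (ρ.quote ≫ ·) (Eqv.lam h).cls_eq) fun δ x => ih _
  | app _ _ ih ih' => exact GluedFun.fn_congr (ih ρ) _ (ih' ρ)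
  | pair _ _ ih ih' => exact Prod.ext (ih ρ) (ih' ρ)
  | fst _ ih => exact congrArg Prod.fst (ih ρ)
  | snd _ ih => exact congrArg Prod.snd (ih ρ)
  | beta t u =>
    refine Eq.trans (congrArg (fun ρ' => t.eval (GEnv.cons ρ' (u.eval ρ))) ρ.res_id) ?_
    refine Eq.trans (congrArg t.eval ?_) (eval_sub _ _ _).symm
    funext B y
    cases y <;> rfl
  | eta t =>
    apply GluedFun.ext
    · exact (t.den.quote ρ).trans (congrArg (ρ.quote ≫ ·) (Eqv.eta t).cls_eq)
    · funext d δ x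
      refine Eq.trans ?_ (GluedFun.fn_congr
        ((eval_ren t (fun _ x => .succ x) ((ρ.res δ).cons x)).trans (t.den.nat δ ρ)) (𝟙 d) rfl).symm
      exact congrArg (fun δ' => GluedFun.fn (t.eval ρ) δ' x) (Category.id_comp δ).symm
  | fst_pair t u => rfl
  | snd_pair t u => rfl
  | pair_eta t => rfl
  | unit_eta t => rfl

end STm

/-- The environment of variables. -/
def GEnv.vars (c : Dom) : GEnv c c := fun A x => A.glued.reflect (STm.cls (.var x))

theorem GEnv.quote_eq {Ψ c : Dom} (ρ : GEnv Ψ c) (σ : STup c Ψ)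
    (h : ∀ A x, A.glued.quote (ρ A x) = (σ A x).cls) :
    ρ.quote = (Quotient.mk (STup.setoid c Ψ) σ : c ⟶ Ψ) := by
  induction Ψ with
  | nil => exact Dom.toUnit_unique _ _
  | cons A Ψ ih =>
    refine (congrArg₂ Dom.pair (ih (fun _ x => ρ _ (.succ x)) (fun _ x => σ _ (.succ x))
      fun B x => h B (.succ x)) (h A .zero)).trans ?_
    exact Dom.mk_ext fun _ x => match x with
      | .zero => rfl
      | .succ _ => rfl

theorem GEnv.quote_vars (c : Dom) : (GEnv.vars c).quote = 𝟙 c :=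
  GEnv.quote_eq _ _ fun A _ => A.glued.quote_reflect _

theorem GEnv.cons_res_vars (c : Dom) (B : STy) :
    ((GEnv.vars c).res (Dom.fst : Dom.times c B ⟶ c)).cons (B.glued.reflect Dom.snd) =
      GEnv.vars (Dom.times c B) := by
  funext A x
  cases x with
  | zero => rfl
  | succ x =>
    refine (A.glued.res_reflect _ _).trans ?_
    rw [Dom.fst_comp_cls]
    rfl

namespace Dom

/-- The tree of a term. -/
def tree {c : Dom} : (c ⟶ one .tm) → Tree c :=
  Quotient.lift (fun σ : STup c [.tm] => (σ _ .zero).eval (GEnv.vars c)) fun _ _ h =>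
    (h _ .zero).eval_eq _

theorem val_tree {c : Dom} (t : c ⟶ one .tm) : (tree t).val = t := by
  obtain ⟨t, rfl⟩ := exists_cls t
  refine (t.den.quote _).trans ?_
  rw [GEnv.quote_vars, Category.id_comp]

theorem tree_proj {c : Dom} {p : c ⟶ one .tm} (hp : IsProj p) : tree p = .leaf p := by
  obtain ⟨x, rfl⟩ := exists_var_of_isProj hp
  rfl

theorem tree_semApp {c : Dom} (m n : c ⟶ one .tm) :
    tree (semApp m n) = .app (tree m) (tree n) := by
  obtain ⟨m, rfl⟩ := exists_cls m
  obtain ⟨n, rfl⟩ := exists_cls n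
  exact congrArg (Tree.app · _) (Tree.res_id _)

theorem tree_lam {c : Dom} (m : times c .tm ⟶ one .tm) :
    tree (app (cLam c) (lam m)) = .lam (tree m) := by
  obtain ⟨m, rfl⟩ := exists_cls m
  exact congrArg (fun ρ => Tree.lam (m.eval ρ)) (GEnv.cons_res_vars c .tm)

end Dom

/-! ## Global elements -/

theorem Glob.ofTop_top {X : Psh} (m : Glob X) : X.ofTop (m.1 top) = m :=
  Subtype.ext (funext fun Φ => m.2 (Dom.toUnit Φ.unop).op)

theorem Psh.top_ofTop (X : Psh) (x : X.obj top) : (X.ofTop x).1 top = x := by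
  have h : Dom.toUnit (unop top) = 𝟙 _ := Dom.toUnit_unique _ _
  change X.map (Dom.toUnit (unop top)).op x = x
  rw [h]
  exact X.map_id_apply _ x

theorem Glob.ext_top {X : Psh} {m n : Glob X} (h : m.1 top = n.1 top) : m = n := by
  rw [← m.ofTop_top, h, n.ofTop_top]

/-- A global element of `El c → El d` as a morphism of `𝔻`. -/
def Glob.hom {c d : Dom} (m : Glob (Fn (El c) (El d))) : c ⟶ d := (ap m).app (op c) (𝟙 c)

theorem yoneda_app {c d Φ : Dom} (f : El c ⟶ El d) (u : Φ ⟶ c) :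
    f.app (op Φ) u = u ≫ f.app (op c) (𝟙 c) := by
  have h := NatTrans.naturality_apply f u.op (𝟙 c)
  refine Eq.trans ?_ h
  exact congrArg (f.app (op Φ)) (Category.comp_id u).symm

theorem Glob.ap_app {c d Φ : Dom} (m : Glob (Fn (El c) (El d))) (u : Φ ⟶ c) :
    (ap m).app (op Φ) u = u ≫ m.hom := yoneda_app _ u

theorem FunAt.app_eq {c d Ψ : Dom} (f : FunAt (El c) (El d) Dom.unit) (δ : Ψ ⟶ Dom.unit)
    (u : Ψ ⟶ c) : f.app δ u = u ≫ f.app (Dom.toUnit c) (𝟙 c) := by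
  refine Eq.trans ?_ (f.nat (Dom.toUnit c) u (𝟙 c))
  exact congrArg₂ f.app (Dom.toUnit_unique _ _) (Category.comp_id u).symm

theorem FunAt.ext_hom {c d : Dom} {f g : FunAt (El c) (El d) Dom.unit}
    (h : f.app (Dom.toUnit c) (𝟙 c) = g.app (Dom.toUnit c) (𝟙 c)) : f = g := by
  apply FunAt.ext
  funext Ψ δ u
  exact (f.app_eq δ u).trans ((congrArg (u ≫ ·) h).trans (g.app_eq δ u).symm)

theorem Glob.hom_eq {c d : Dom} (m : Glob (Fn (El c) (El d))) :
    m.hom = FunAt.app (m.1 top) (Dom.toUnit c) (𝟙 c) := by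
  have h : m.1 (op c) = _ := (m.2 (Dom.toUnit c).op).symm
  change FunAt.app (m.1 (op c)) (𝟙 c) (𝟙 c) = _
  rw [h]
  exact congrArg (fun δ => FunAt.app (m.1 top) δ (𝟙 c)) (Category.id_comp (Dom.toUnit c))

theorem Glob.hom_ext {c d : Dom} {m n : Glob (Fn (El c) (El d))} (h : m.hom = n.hom) : m = n :=
  Glob.ext_top (FunAt.ext_hom (by rw [← Glob.hom_eq, h, Glob.hom_eq]))

theorem hom_lamU_yoneda {c d : Dom} (f : c ⟶ d) : (lamU (yoneda.map f)).hom = f :=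
  Category.id_comp f

/-! ## The recursion scheme -/

/-- A closed element of `♭(El c → El tm)` as a morphism of `𝔻`. -/
def BoxTm.cls {c : Dom} (m : BoxTm c) : c ⟶ Dom.one .tm := FunAt.app m (Dom.toUnit c) (𝟙 c)

theorem BoxTm.hom_app {c Φ : Dom} (m : BoxTm c) (u : Φ ⟶ c) :
    m.hom.app (op Φ) u = u ≫ m.cls := by
  refine (yoneda_app _ u).trans (congrArg (u ≫ ·) ?_)
  exact congrArg (fun δ => FunAt.app m δ (𝟙 c)) (Category.id_comp (Dom.toUnit c))

theorem BoxTm.cls_injective {c : Dom} {m n : BoxTm c} (h : m.cls = n.cls) : m = n :=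
  FunAt.ext_hom h

theorem BoxTm.cls_app' {c : Dom} (m n : BoxTm c) : (app' m n).cls = semApp m.cls n.cls := by
  change semApp (m.hom.app (op c) (𝟙 c)) (n.hom.app (op c) (𝟙 c)) = _
  rw [hom_app, hom_app, Category.id_comp, Category.id_comp]

theorem BoxTm.cls_lam' {c : Dom} (m : BoxTm (Dom.times c .tm)) :
    (lam' m).cls = Dom.app (Dom.cLam c) (Dom.lam m.cls) := by
  change Dom.app (Dom.cLam c) (Dom.lam (m.hom.app (op (Dom.times c .tm))
    (Dom.pair (Dom.fst ≫ 𝟙 c) Dom.snd))) = _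
  rw [hom_app, Category.comp_id, Dom.pair_fst_snd, Category.id_comp]

theorem BoxVar.cls_toTm {c : Dom} (p : BoxVar c) : IsProj p.toTm.cls := by
  obtain ⟨q, hq, h⟩ := p.2
  have : p.toTm.cls = q := (h _ _ _).trans (Category.id_comp q)
  rwa [this]

theorem BoxVar.toTm_injective {c : Dom} {p q : BoxVar c} (h : p.toTm = q.toTm) : p = q :=
  Subtype.ext h

/-- The tree of a closed element of `♭(El c → El tm)`. -/
def BoxTm.tree {c : Dom} (m : BoxTm c) : Tree c := Dom.tree m.cls

theorem BoxTm.tree_injective {c : Dom} {m n : BoxTm c} (h : m.tree = n.tree) : m = n := by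
  apply cls_injective
  rw [← Dom.val_tree m.cls, ← Dom.val_tree n.cls]
  exact congrArg Tree.val h

theorem BoxTm.tree_app' {c : Dom} (m n : BoxTm c) : (app' m n).tree = .app m.tree n.tree := by
  rw [tree, cls_app', Dom.tree_semApp]; rfl

theorem BoxTm.tree_lam' {c : Dom} (m : BoxTm (Dom.times c .tm)) :
    (lam' m).tree = .lam m.tree := by
  rw [tree, cls_lam', Dom.tree_lam]; rfl

theorem BoxVar.tree_toTm {c : Dom} (p : BoxVar c) : p.toTm.tree = .leaf p.toTm.cls :=
  Dom.tree_proj p.cls_toTm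

theorem app'_injective {c : Dom} {m n m' n' : BoxTm c} (h : app' m n = app' m' n') :
    m = m' ∧ n = n' := by
  have h := congrArg BoxTm.tree h
  rw [BoxTm.tree_app', BoxTm.tree_app', Tree.app.injEq] at h
  exact ⟨BoxTm.tree_injective h.1, BoxTm.tree_injective h.2⟩

theorem lam'_injective {c : Dom} {m n : BoxTm (Dom.times c .tm)} (h : lam' m = lam' n) :
    m = n := by
  have h := congrArg BoxTm.tree h
  rw [BoxTm.tree_lam', BoxTm.tree_lam', Tree.lam.injEq] at h
  exact BoxTm.tree_injective h

theorem toTm_ne_app' {c : Dom} (p : BoxVar c) (m n : BoxTm c) : p.toTm ≠ app' m n := by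
  intro h
  have h := congrArg BoxTm.tree h
  rw [BoxVar.tree_toTm, BoxTm.tree_app'] at h
  cases h

theorem toTm_ne_lam' {c : Dom} (p : BoxVar c) (m : BoxTm (Dom.times c .tm)) :
    p.toTm ≠ lam' m := by
  intro h
  have h := congrArg BoxTm.tree h
  rw [BoxVar.tree_toTm, BoxTm.tree_lam'] at h
  cases h

theorem app'_ne_lam' {c : Dom} (m n : BoxTm c) (k : BoxTm (Dom.times c .tm)) :
    app' m n ≠ lam' k := by
  intro h
  have h := congrArg BoxTm.tree h
  rw [BoxTm.tree_app', BoxTm.tree_lam'] at h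
  cases h

section
variable {R : Dom → Type} {tv : ∀ c, BoxVar c → R c}
  {ta : ∀ c, BoxTm c → BoxTm c → R c → R c → R c}
  {tl : ∀ c, BoxTm (Dom.times c .tm) → R (Dom.times c .tm) → R c}

theorem RecGraph.exists (c : Dom) (m : BoxTm c) : ∃ a, RecGraph tv ta tl c m a := by
  generalize hT : m.tree = T
  induction T with
  | leaf t =>
    by_cases hv : ∃ p : BoxVar _, m = p.toTm
    · obtain ⟨p, rfl⟩ := hv
      exact ⟨_, .var _ p⟩
    · refine ⟨_, .other _ m (fun p h => hv ⟨p, h⟩) ?_ ?_⟩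
      · rintro n n' rfl
        rw [BoxTm.tree_app'] at hT
        cases hT
      · rintro n rfl
        rw [BoxTm.tree_lam'] at hT
        cases hT
  | app a b iha ihb =>
    by_cases h : ∃ n n', m = app' n n'
    · obtain ⟨n, n', rfl⟩ := h
      rw [BoxTm.tree_app', Tree.app.injEq] at hT
      obtain ⟨x, hx⟩ := iha n hT.1
      obtain ⟨y, hy⟩ := ihb n' hT.2
      exact ⟨_, .app _ n n' x y hx hy⟩
    · refine ⟨_, .other _ m ?_ (fun n n' hn => h ⟨n, n', hn⟩) ?_⟩
      · rintro p rfl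
        rw [BoxVar.tree_toTm] at hT
        cases hT
      · rintro n rfl
        rw [BoxTm.tree_lam'] at hT
        cases hT
  | lam a ih =>
    by_cases h : ∃ n, m = lam' n
    · obtain ⟨n, rfl⟩ := h
      rw [BoxTm.tree_lam', Tree.lam.injEq] at hT
      obtain ⟨x, hx⟩ := ih n hT
      exact ⟨_, .lam _ n x hx⟩
    · refine ⟨_, .other _ m ?_ ?_ (fun n hn => h ⟨n, hn⟩)⟩
      · rintro p rfl
        rw [BoxVar.tree_toTm] at hT
        cases hT
      · rintro n n' rfl
        rw [BoxTm.tree_app'] at hT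
        cases hT

theorem RecGraph.unique {c : Dom} {m : BoxTm c} {a b : R c} (h : RecGraph tv ta tl c m a)
    (h' : RecGraph tv ta tl c m b) : a = b := by
  induction h with
  | var c p =>
    generalize hm : p.toTm = m at h'
    cases h' with
    | var _ q => rw [BoxVar.toTm_injective hm]
    | app _ n n' => exact absurd hm (toTm_ne_app' _ _ _)
    | lam _ n => exact absurd hm (toTm_ne_lam' _ _)
    | other _ _ hv => exact absurd hm.symm (hv p)
  | app c m n x y _ _ ihx ihy =>
    generalize hm : app' m n = k at h'
    cases h' with
    | var _ q => exact absurd hm.symm (toTm_ne_app' _ _ _)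
    | app _ m' n' x' y' hx hy =>
      obtain ⟨rfl, rfl⟩ := app'_injective hm
      rw [ihx hx, ihy hy]
    | lam _ n => exact absurd hm (app'_ne_lam' _ _ _)
    | other _ _ _ ha => exact absurd hm.symm (ha _ _)
  | lam c m x _ ih =>
    generalize hm : lam' m = k at h'
    cases h' with
    | var _ q => exact absurd hm.symm (toTm_ne_lam' _ _)
    | app _ n n' => exact absurd hm.symm (app'_ne_lam' _ _ _)
    | lam _ m' x' hx =>
      obtain rfl := lam'_injective hm
      rw [ih hx]
    | other _ _ _ _ hl => exact absurd hm.symm (hl _)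
  | other c m hv ha hl =>
    cases h' with
    | var _ q => exact absurd rfl (hv q)
    | app _ n n' => exact absurd rfl (ha _ _)
    | lam _ n => exact absurd rfl (hl _)
    | other => rfl

theorem recSem_graph (c : Dom) (m : BoxTm c) : RecGraph tv ta tl c m (recSem tv ta tl c m) := by
  have h := RecGraph.exists (tv := tv) (ta := ta) (tl := tl) c m
  rw [recSem, dif_pos h]
  exact h.choose_spec

theorem recSem_toTm (c : Dom) (p : BoxVar c) : recSem tv ta tl c p.toTm = tv c p :=
  (recSem_graph c _).unique (.var c p)

theorem recSem_app' (c : Dom) (m n : BoxTm c) : recSem tv ta tl c (app' m n) =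
    ta c m n (recSem tv ta tl c m) (recSem tv ta tl c n) :=
  (recSem_graph c _).unique (.app c m n _ _ (recSem_graph c m) (recSem_graph c n))

theorem recSem_lam' (c : Dom) (m : BoxTm (Dom.times c .tm)) : recSem tv ta tl c (lam' m) =
    tl c m (recSem tv ta tl _ m) :=
  (recSem_graph c _).unique (.lam c m _ (recSem_graph _ m))
end

/-! ## Domain-level terms and substitutions as morphisms of `𝔻` -/

theorem Dom.lam_cLam (c : Dom) :
    Dom.lam (Dom.app (Dom.cLam (Dom.times c (.arr .tm .tm))) (Dom.lam (Dom.app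
      ((Dom.fst : Dom.times (Dom.times c (.arr .tm .tm)) .tm ⟶ _) ≫ Dom.snd) Dom.snd))) =
    Dom.cLam c := by
  rw [Dom.lam_eta, ← Dom.comp_cLam (Dom.fst : Dom.times c (.arr .tm .tm) ⟶ c), Dom.lam_eta]

theorem Dom.lam_lam_semApp (c : Dom) :
    Dom.lam (Dom.lam (semApp ((Dom.fst : Dom.times (Dom.times c .tm) .tm ⟶ _) ≫ Dom.snd)
      Dom.snd)) = Dom.cApp c := by
  rw [semApp, ← Dom.comp_cApp (Dom.fst : Dom.times (Dom.times c .tm) .tm ⟶ _), ← Dom.comp_app,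
    Dom.lam_eta, ← Dom.comp_cApp (Dom.fst : Dom.times c .tm ⟶ c), Dom.lam_eta]

noncomputable def DTm.hom {n : ℕ} {Γ : CCtx n} {Ψ : DCtx n} {A : DTy} (M : DTm Γ Ψ A)
    (s : Γ.El) : Ψ.sem (Γ.env s) ⟶ Dom.one A.sem := (M.sem s).hom

noncomputable def DSub.hom {n : ℕ} {Γ : CCtx n} {Φ Ψ : DCtx n} (σ : DSub Γ Φ Ψ)
    (s : Γ.El) : Φ.sem (Γ.env s) ⟶ Ψ.sem (Γ.env s) := (σ.sem s).hom

noncomputable def CTm.boxHom {n : ℕ} {Γ : CCtx n} {Ψ : DCtx n} {A : DTy} (t : CTm Γ (.box Ψ A))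
    (s : Γ.El) : Ψ.sem (Γ.env s) ⟶ Dom.one A.sem :=
  FunAt.app ((t.sem s).1 top) (Dom.toUnit _) (𝟙 _)

noncomputable def CTm.boxvHom {n : ℕ} {Γ : CCtx n} {Ψ : DCtx n} {A : DTy}
    (t : CTm Γ (.boxv Ψ A)) (s : Γ.El) : Ψ.sem (Γ.env s) ⟶ Dom.one A.sem :=
  FunAt.app (Subtype.val ((t.sem s).1 top)) (Dom.toUnit _) (𝟙 _)

section
variable {n : ℕ} {Γ : CCtx n} {Φ Ψ Ξ : DCtx n} {A B : DTy} (s : Γ.El)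

theorem DTm.hom_var (x : DVar Ψ A) : (DTm.var (Γ := Γ) x).hom s = x.sem (Γ.env s) := by
  rw [DTm.hom, DTm.sem, hom_lamU_yoneda]

theorem DTm.hom_cLam : (DTm.cLam (Γ := Γ) (Ψ := Ψ)).hom s = Dom.cLam _ := by
  rw [DTm.hom, DTm.sem]
  exact Dom.lam_cLam _

theorem DTm.hom_cApp : (DTm.cApp (Γ := Γ) (Ψ := Ψ)).hom s = Dom.cApp _ := by
  rw [DTm.hom, DTm.sem]
  exact Dom.lam_lam_semApp _

theorem DTm.hom_app (M : DTm Γ Ψ (.arr A B)) (N : DTm Γ Ψ A) :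
    (DTm.app M N).hom s = Dom.app (M.hom s) (N.hom s) := by
  rw [DTm.hom, DTm.sem]; rfl

theorem DTm.hom_lam (M : DTm Γ (Ψ.snoc A) B) : (DTm.lam M).hom s = Dom.lam (M.hom s) := by
  rw [DTm.hom, DTm.sem]
  change Dom.lam ((ap (M.sem s)).app (op (Dom.times (Ψ.sem (Γ.env s)) A.sem))
    (Dom.pair (Dom.fst ≫ 𝟙 _) Dom.snd)) = _
  rw [Category.comp_id, Dom.pair_fst_snd]
  rfl

theorem DTm.hom_unbox (t : CTm Γ (.box Φ A)) (σ : DSub Γ Ψ Φ) :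
    (DTm.unbox t σ).hom s = σ.hom s ≫ t.boxHom s := by
  rw [DTm.hom, DTm.sem]
  refine (Glob.ap_app (Psh.ofTop (Fn (El _) (El _)) ((t.sem s).1 top)) (σ.hom s)).trans ?_
  refine congrArg (σ.hom s ≫ ·) ((Glob.hom_eq _).trans ?_)
  exact congrArg (FunAt.app · (Dom.toUnit _) (𝟙 _)) (Psh.top_ofTop (Fn (El _) (El _)) _)

theorem DTm.hom_unboxv (t : CTm Γ (.boxv Φ A)) (σ : DSub Γ Ψ Φ) :
    (DTm.unboxv t σ).hom s = σ.hom s ≫ t.boxvHom s := by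
  rw [DTm.hom, DTm.sem]
  refine (Glob.ap_app ((Psh.ofTop (FnV _ _) ((t.sem s).1 top)).map (inclV _ _))
    (σ.hom s)).trans ?_
  refine congrArg (σ.hom s ≫ ·) ((Glob.hom_eq _).trans ?_)
  exact congrArg (fun f => FunAt.app (Subtype.val f) (Dom.toUnit _) (𝟙 _))
    (Psh.top_ofTop (FnV _ _) _)

theorem DSub.hom_wk (w : Wk Φ Ψ) : (DSub.wk (Γ := Γ) w).hom s = w.sem (Γ.env s) := by
  rw [DSub.hom, DSub.sem, hom_lamU_yoneda]

theorem DSub.hom_snoc (σ : DSub Γ Φ Ψ) (M : DTm Γ Φ A) :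
    (DSub.snoc σ M).hom s = Dom.pair (σ.hom s) (M.hom s) := by
  rw [DSub.hom, DSub.sem]; rfl

end

theorem Wk.sem_trans {n : ℕ} (ρ : Fin n → Dom) {Φ Ψ Ξ : DCtx n} (v : Wk Φ Ψ) (w : Wk Ψ Ξ) :
    (v.trans w).sem ρ = v.sem ρ ≫ w.sem ρ := by
  induction v with
  | refl => exact (Category.id_comp _).symm
  | drop v ih =>
    refine Eq.trans ?_ (Category.assoc Dom.fst (v.sem ρ) (w.sem ρ)).symm
    exact congrArg (Dom.fst ≫ ·) (ih w)

theorem Wk.sem_one {n : ℕ} (ρ : Fin n → Dom) {Ψ : DCtx n} {A : DTy} :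
    (Wk.one : Wk (Ψ.snoc A) Ψ).sem ρ = (Dom.fst : Dom.times (Ψ.sem ρ) A.sem ⟶ _) :=
  Category.comp_id (Dom.fst : Dom.times (Ψ.sem ρ) A.sem ⟶ _)

theorem Wk.sem_var {n : ℕ} (ρ : Fin n → Dom) {Φ Ψ : DCtx n} {A : DTy} (w : Wk Φ Ψ)
    (x : DVar Ψ A) : (w.var x).sem ρ = w.sem ρ ≫ x.sem ρ := by
  induction w with
  | refl => exact (Category.id_comp _).symm
  | drop w ih =>
    refine Eq.trans ?_ (Category.assoc Dom.fst (w.sem ρ) (x.sem ρ)).symm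
    exact congrArg (Dom.fst ≫ ·) (ih x)

def Ope.sem {n : ℕ} (ρ : Fin n → Dom) {Φ Ψ : DCtx n} : Ope Φ Ψ → (Φ.sem ρ ⟶ Ψ.sem ρ)
  | .wk w => w.sem ρ
  | .keep o => Dom.pair (Dom.fst ≫ o.sem ρ) Dom.snd

theorem Ope.sem_var {n : ℕ} (ρ : Fin n → Dom) {Φ Ψ : DCtx n} {A : DTy} (o : Ope Φ Ψ)
    (x : DVar Ψ A) : (o.var x).sem ρ = o.sem ρ ≫ x.sem ρ := by
  induction o with
  | wk w => exact w.sem_var ρ x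
  | keep o ih =>
    cases x with
    | zero => exact (Dom.pair_snd _ _).symm
    | succ x =>
      change Dom.fst ≫ (o.var x).sem ρ = Dom.pair (Dom.fst ≫ o.sem ρ) Dom.snd ≫ Dom.fst ≫ x.sem ρ
      rw [← Category.assoc, Dom.pair_fst, Category.assoc, ih]

theorem Ope.hom_toDSub {n : ℕ} {Γ : CCtx n} (s : Γ.El) {Ξ Φ Ψ : DCtx n} (o : Ope Φ Ψ)
    (v : Wk Ξ Φ) : (o.toDSub Γ v).hom s = v.sem (Γ.env s) ≫ o.sem (Γ.env s) := by
  induction o with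
  | wk w =>
    rw [Ope.toDSub, DSub.hom_wk, Wk.sem_trans]
    rfl
  | keep o ih =>
    rw [Ope.toDSub, DSub.hom_snoc, ih, DTm.hom_var, Wk.sem_trans, Wk.sem_one, Wk.sem_var]
    refine Eq.trans ?_ (Dom.comp_pair _ _ _).symm
    exact congrArg (Dom.pair · _) (Category.assoc _ _ _)

namespace DSub

variable {n : ℕ} {Γ : CCtx n} (s : Γ.El) {Φ Ψ Ξ : DCtx n} {A : DTy}

theorem hom_tail (σ : DSub Γ Φ (Ψ.snoc A)) : σ.tail.hom s = σ.hom s ≫ Dom.fst := by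
  cases σ with
  | wk w => rw [DSub.tail, hom_wk, hom_wk, Wk.sem_trans, Wk.sem_one]
  | snoc σ M =>
    rw [hom_snoc]
    exact (Dom.pair_fst _ _).symm

theorem hom_trunc (σ : DSub Γ Φ Ψ) (w : Wk Ψ Ξ) :
    (σ.trunc w).hom s = σ.hom s ≫ w.sem (Γ.env s) := by
  induction w with
  | refl => exact (Category.comp_id _).symm
  | drop w ih =>
    rw [DSub.trunc, ih, hom_tail]
    exact Category.assoc _ _ _

theorem hom_lookup (σ : DSub Γ Φ Ψ) (x : DVar Ψ A) :
    (σ.lookup x).hom s = σ.hom s ≫ x.sem (Γ.env s) := by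
  induction x with
  | zero =>
    cases σ with
    | wk w => rw [DSub.lookup, hom_wk, DTm.hom_var, Wk.sem_var]
    | snoc σ M =>
      rw [hom_snoc]
      exact (Dom.pair_snd _ _).symm
  | succ x ih =>
    cases σ with
    | wk w => rw [DSub.lookup, hom_wk, DTm.hom_var, Wk.sem_var]
    | snoc σ M =>
      rw [hom_snoc]
      refine (ih σ).trans ?_
      refine Eq.trans ?_ (Category.assoc _ _ _)
      exact congrArg (· ≫ _) (Dom.pair_fst _ _).symm

end DSub

mutual

theorem DTm.hom_ren {n : ℕ} {Γ : CCtx n} (s : Γ.El) {Φ Ψ : DCtx n} {A : DTy} :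
    (M : DTm Γ Ψ A) → (o : Ope Φ Ψ) → (M.ren o).hom s = o.sem (Γ.env s) ≫ M.hom s
  | .var x, o => by rw [DTm.ren, DTm.hom_var, DTm.hom_var, Ope.sem_var]
  | .cLam, o => by rw [DTm.ren, DTm.hom_cLam, DTm.hom_cLam]; exact (Dom.comp_cLam _).symm
  | .cApp, o => by rw [DTm.ren, DTm.hom_cApp, DTm.hom_cApp]; exact (Dom.comp_cApp _).symm
  | .app M N, o => by
    rw [DTm.ren, DTm.hom_app, DTm.hom_app, DTm.hom_ren s M o, DTm.hom_ren s N o]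
    exact (Dom.comp_app _ _ _).symm
  | .lam M, o => by
    rw [DTm.ren, DTm.hom_lam, DTm.hom_lam, DTm.hom_ren s M o.keep]
    exact (Dom.comp_lam _ _).symm
  | .unbox t σ, o => by
    rw [DTm.ren, DTm.hom_unbox, DTm.hom_unbox, DSub.hom_ren s σ o, Category.assoc]
  | .unboxv t σ, o => by
    rw [DTm.ren, DTm.hom_unboxv, DTm.hom_unboxv, DSub.hom_ren s σ o, Category.assoc]

theorem DSub.hom_ren {n : ℕ} {Γ : CCtx n} (s : Γ.El) {Φ Ψ Ξ : DCtx n} :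
    (σ : DSub Γ Ψ Ξ) → (o : Ope Φ Ψ) → (σ.ren o).hom s = o.sem (Γ.env s) ≫ σ.hom s
  | .wk w, o => by
    rw [DSub.ren, DSub.hom_trunc, DSub.hom_wk, Ope.hom_toDSub]
    exact congrArg (· ≫ _) (Category.id_comp _)
  | .nil, o => Dom.toUnit_unique _ _
  | .snoc σ M, o => by
    rw [DSub.ren, DSub.hom_snoc, DSub.hom_snoc, DTm.hom_ren s M o, DSub.hom_ren s σ o]
    exact (Dom.comp_pair _ _ _).symm

end

theorem DSub.hom_lift {n : ℕ} {Γ : CCtx n} (s : Γ.El) {Φ Ψ : DCtx n} (A : DTy)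
    (σ : DSub Γ Φ Ψ) : (σ.lift A).hom s = Dom.pair (Dom.fst ≫ σ.hom s) Dom.snd := by
  rw [DSub.lift, DSub.hom_snoc, DSub.hom_ren, DTm.hom_var, Ope.sem, Wk.sem_one]
  rfl

mutual

theorem DTm.hom_sub {n : ℕ} {Γ : CCtx n} (s : Γ.El) {Φ Ψ : DCtx n} {A : DTy} :
    (M : DTm Γ Ψ A) → (σ : DSub Γ Φ Ψ) → (M.sub σ).hom s = σ.hom s ≫ M.hom s
  | .var x, σ => by rw [DTm.sub, DTm.hom_var, DSub.hom_lookup]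
  | .cLam, σ => by rw [DTm.sub, DTm.hom_cLam, DTm.hom_cLam]; exact (Dom.comp_cLam _).symm
  | .cApp, σ => by rw [DTm.sub, DTm.hom_cApp, DTm.hom_cApp]; exact (Dom.comp_cApp _).symm
  | .app M N, σ => by
    rw [DTm.sub, DTm.hom_app, DTm.hom_app, DTm.hom_sub s M σ, DTm.hom_sub s N σ]
    exact (Dom.comp_app _ _ _).symm
  | .lam M, σ => by
    rw [DTm.sub, DTm.hom_lam, DTm.hom_lam, DTm.hom_sub s M (σ.lift _), DSub.hom_lift]
    exact (Dom.comp_lam _ _).symm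
  | .unbox t τ, σ => by
    rw [DTm.sub, DTm.hom_unbox, DTm.hom_unbox, DSub.hom_sub s τ σ, Category.assoc]
  | .unboxv t τ, σ => by
    rw [DTm.sub, DTm.hom_unboxv, DTm.hom_unboxv, DSub.hom_sub s τ σ, Category.assoc]

theorem DSub.hom_sub {n : ℕ} {Γ : CCtx n} (s : Γ.El) {Φ Ψ Ξ : DCtx n} :
    (τ : DSub Γ Ψ Ξ) → (σ : DSub Γ Φ Ψ) → (τ.sub σ).hom s = σ.hom s ≫ τ.hom s
  | .wk w, σ => by rw [DSub.sub, DSub.hom_trunc, DSub.hom_wk]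
  | .nil, σ => Dom.toUnit_unique _ _
  | .snoc τ M, σ => by
    rw [DSub.sub, DSub.hom_snoc, DSub.hom_snoc, DTm.hom_sub s M σ, DSub.hom_sub s τ σ]
    exact (Dom.comp_pair _ _ _).symm

end

/-! ## Heterogeneous congruence for the semantic operations -/

section

theorem Glob.cast_heq {X Y : Psh} (h : X = Y) (m : Glob X) : HEq (m.cast h) m := by
  subst h; rfl

theorem Glob.top_heq {X Y : Psh} (h : X = Y) {m : Glob X} {n : Glob Y} (hm : HEq m n) :
    HEq (m.1 top) (n.1 top) := by
  subst h; cases hm; rfl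

theorem Psh.ofTop_heq {X Y : Psh} (h : X = Y) {x : X.obj top} {y : Y.obj top} (hx : HEq x y) :
    HEq (X.ofTop x) (Y.ofTop y) := by
  subst h; cases hx; rfl

theorem boxIntro_heq {X Y : Psh} (h : X = Y) {m : Glob X} {n : Glob Y} (hm : HEq m n) :
    HEq (boxIntro m) (boxIntro n) := by
  subst h; cases hm; rfl

theorem crispLam_heq {X X' Y Y' : Psh} (hX : X = X') (hY : Y = Y') {m : X.obj top → Glob Y}
    {m' : X'.obj top → Glob Y'} (h : ∀ x x', HEq x x' → HEq (m x) (m' x')) :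
    HEq (crispLam (X := X) (Y := fun _ => Y) m) (crispLam (X := X') (Y := fun _ => Y') m') := by
  subst hX hY
  exact heq_of_eq (congrArg crispLam (funext fun x => eq_of_heq (h x x HEq.rfl)))

theorem crispApp_heq {X X' Y Y' : Psh} (hX : X = X') (hY : Y = Y')
    {m : Glob (CrispFn X fun _ => Y)} {m' : Glob (CrispFn X' fun _ => Y')} (hm : HEq m m')
    {n : Glob X} {n' : Glob X'} (hn : HEq n n') : HEq (crispApp m n) (crispApp m' n') := by
  subst hX hY; cases hm; cases hn; rfl

theorem crispLam_obj_heq {Y Y' : Dom → Psh} (hY : Y = Y') {m : ∀ c, Glob (Y c)}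
    {m' : ∀ c, Glob (Y' c)} (h : ∀ c, HEq (m c) (m' c)) :
    HEq (crispLam (X := Obj) (Y := Y) m) (crispLam (X := Obj) (Y := Y') m') := by
  subst hY
  exact heq_of_eq (congrArg (crispLam (X := Obj)) (funext fun c => eq_of_heq (h c)))

theorem crispApp_obj_heq {Y Y' : Dom → Psh} (hY : Y = Y')
    {m : Glob (CrispFn Obj Y)} {m' : Glob (CrispFn Obj Y')} (hm : HEq m m')
    {c c' : Dom} (hc : c = c') :
    HEq (crispApp (X := Obj) (Y := Y) m (objGlob c))
      (crispApp (X := Obj) (Y := Y') m' (objGlob c')) := by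
  subst hY hc; cases hm; rfl

theorem recSem_heq {R R' : Dom → Type} (hR : R = R') {tv : ∀ c, BoxVar c → R c}
    {ta : ∀ c, BoxTm c → BoxTm c → R c → R c → R c}
    {tl : ∀ c, BoxTm (Dom.times c .tm) → R (Dom.times c .tm) → R c}
    {tv' : ∀ c, BoxVar c → R' c} {ta' : ∀ c, BoxTm c → BoxTm c → R' c → R' c → R' c}
    {tl' : ∀ c, BoxTm (Dom.times c .tm) → R' (Dom.times c .tm) → R' c}
    (hv : ∀ c p, HEq (tv c p) (tv' c p))
    (ha : ∀ c m n a b a' b', HEq a a' → HEq b b' → HEq (ta c m n a b) (ta' c m n a' b'))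
    (hl : ∀ c m a a', HEq a a' → HEq (tl c m a) (tl' c m a'))
    {c c' : Dom} (hc : c = c') {m : BoxTm c} {m' : BoxTm c'} (hm : HEq m m') :
    HEq (recSem tv ta tl c m) (recSem tv' ta' tl' c' m') := by
  subst hR hc
  cases hm
  obtain rfl : tv = tv' := funext fun c => funext fun p => eq_of_heq (hv c p)
  obtain rfl : ta = ta' := funext fun c => funext fun m => funext fun n => funext fun a =>
    funext fun b => eq_of_heq (ha c m n a b a b HEq.rfl HEq.rfl)
  obtain rfl : tl = tl' := funext fun c => funext fun m => funext fun a =>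
    eq_of_heq (hl c m a a HEq.rfl)
  rfl

theorem fn_el_eq {c c' d d' : Dom} (hc : c = c') (hd : d = d') :
    Fn (El c) (El d) = Fn (El c') (El d') := by
  rw [hc, hd]

theorem fnV_eq {c c' : Dom} (hc : c = c') (A : STy) : FnV c A = FnV c' A := by
  rw [hc]

theorem lamU_yoneda_heq {c c' d d' : Dom} (hc : c = c') (hd : d = d') {f : c ⟶ d} {f' : c' ⟶ d'}
    (hf : HEq f f') : HEq (lamU (yoneda.map f)) (lamU (yoneda.map f')) := by
  subst hc hd; cases hf; rfl

theorem lamU_constU_heq {c c' : Dom} (hc : c = c') {Y : Psh} (a : Glob Y) :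
    HEq (lamU (constU (c := c) a)) (lamU (constU (c := c') a)) := by
  subst hc; rfl

theorem lamU_toUnit_heq {c c' : Dom} (hc : c = c') :
    HEq (lamU (yoneda.map (Dom.toUnit c))) (lamU (yoneda.map (Dom.toUnit c'))) := by
  subst hc; rfl

theorem lamU_arrowE_heq {c c' : Dom} (hc : c = c') {A B : STy}
    {m : Glob (Fn (El c) (El (Dom.one (.arr A B))))}
    {m' : Glob (Fn (El c') (El (Dom.one (.arr A B))))} (hm : HEq m m')
    {n : Glob (Fn (El c) (El (Dom.one A)))} {n' : Glob (Fn (El c') (El (Dom.one A)))}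
    (hn : HEq n n') : HEq (lamU (arrowE (ap m) (ap n))) (lamU (arrowE (ap m') (ap n'))) := by
  subst hc; cases hm; cases hn; rfl

theorem lamU_curryU_heq {c c' : Dom} (hc : c = c') {A B : STy}
    {m : Glob (Fn (El (Dom.times c A)) (El (Dom.one B)))}
    {m' : Glob (Fn (El (Dom.times c' A)) (El (Dom.one B)))} (hm : HEq m m') :
    HEq (lamU (curryU (ap m) ≫ arrowI A B)) (lamU (curryU (ap m') ≫ arrowI A B)) := by
  subst hc; cases hm; rfl

theorem lamU_pairU_heq {c c' d d' : Dom} (hc : c = c') (hd : d = d') {A : STy}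
    {σ : Glob (Fn (El c) (El d))} {σ' : Glob (Fn (El c') (El d'))} (hσ : HEq σ σ')
    {m : Glob (Fn (El c) (El (Dom.one A)))} {m' : Glob (Fn (El c') (El (Dom.one A)))}
    (hm : HEq m m') : HEq (lamU (pairU (ap σ) (ap m))) (lamU (pairU (ap σ') (ap m'))) := by
  subst hc hd; cases hσ; cases hm; rfl

theorem letBox_comp_heq {c c' d d' : Dom} (hc : c = c') (hd : d = d') {A : STy}
    {t : Glob (flat.obj (Fn (El d) (El (Dom.one A))))}
    {t' : Glob (flat.obj (Fn (El d') (El (Dom.one A))))} (ht : HEq t t')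
    {σ : Glob (Fn (El c) (El d))} {σ' : Glob (Fn (El c') (El d'))} (hσ : HEq σ σ') :
    HEq (letBox t fun x => lamU (ap σ ≫ ap (Psh.ofTop _ x)))
      (letBox t' fun x => lamU (ap σ' ≫ ap (Psh.ofTop _ x))) := by
  subst hc hd; cases ht; cases hσ; rfl

theorem letBox_compV_heq {c c' d d' : Dom} (hc : c = c') (hd : d = d') {A : STy}
    {t : Glob (flat.obj (FnV d A))} {t' : Glob (flat.obj (FnV d' A))} (ht : HEq t t')
    {σ : Glob (Fn (El c) (El d))} {σ' : Glob (Fn (El c') (El d'))} (hσ : HEq σ σ') :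
    HEq (letBox t fun x => lamU (ap σ ≫ ap ((Psh.ofTop _ x).map (inclV _ _))))
      (letBox t' fun x => lamU (ap σ' ≫ ap ((Psh.ofTop _ x).map (inclV _ _)))) := by
  subst hc hd; cases ht; cases hσ; rfl

theorem projV_heq {c c' : Dom} (hc : c = c') {A : STy} {p : c ⟶ Dom.one A} {p' : c' ⟶ Dom.one A}
    (hp : HEq p p') (h : IsProj p) (h' : IsProj p') : HEq (projV p h) (projV p' h') := by
  subst hc; cases hp; rfl

theorem letBox_precompV_heq {c c' d d' : Dom} (hc : c = c') (hd : d = d') {A : STy}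
    {t : Glob (flat.obj (FnV d A))} {t' : Glob (flat.obj (FnV d' A))} (ht : HEq t t')
    {f : c ⟶ d} {f' : c' ⟶ d'} (hf : HEq f f')
    (h : ∀ p : d ⟶ Dom.one A, IsProj p → IsProj (f ≫ p))
    (h' : ∀ p : d' ⟶ Dom.one A, IsProj p → IsProj (f' ≫ p)) :
    HEq (letBox t fun x => (Psh.ofTop _ x).map (precompV f h))
      (letBox t' fun x => (Psh.ofTop _ x).map (precompV f' h')) := by
  subst hc hd; cases ht; cases hf; rfl

theorem fst_comp_heq {c c' d d' : Dom} (hc : c = c') (hd : d = d') {A : STy} {f : c ⟶ d}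
    {f' : c' ⟶ d'} (hf : HEq f f') :
    HEq ((Dom.fst : Dom.times c A ⟶ c) ≫ f) ((Dom.fst : Dom.times c' A ⟶ c') ≫ f') := by
  subst hc hd; cases hf; rfl

end

/-! ## Soundness of computation-level substitution -/

theorem DVar.sem_csub {n m : ℕ} (θ : Fin n → DCtx m) (ρ : Fin m → Dom) {ρ' : Fin n → Dom}
    (hρ : ρ' = fun i => (θ i).sem ρ) {Ψ : DCtx n} {A : DTy} (x : DVar Ψ A) :
    HEq ((x.csub θ).sem ρ) (x.sem ρ') := by
  subst hρ
  induction x with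
  | @zero Ψ A =>
    change HEq (Dom.snd : Dom.times ((Ψ.sub θ).sem ρ) A.sem ⟶ _) Dom.snd
    rw [DCtx.sem_sub]
  | succ x ih => exact fst_comp_heq (DCtx.sem_sub _ _ _) rfl ih

theorem Wk.sem_csub {n m : ℕ} (θ : Fin n → DCtx m) (ρ : Fin m → Dom) {ρ' : Fin n → Dom}
    (hρ : ρ' = fun i => (θ i).sem ρ) {Φ Ψ : DCtx n} (w : Wk Φ Ψ) :
    HEq ((w.csub θ).sem ρ) (w.sem ρ') := by
  subst hρ
  induction w with
  | @refl Ψ =>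
    change HEq (𝟙 ((Ψ.sub θ).sem ρ)) (𝟙 (Ψ.sem _))
    rw [DCtx.sem_sub]
  | drop w ih => exact fst_comp_heq (DCtx.sem_sub _ _ _) (DCtx.sem_sub _ _ _) ih

/-- The value of an environment `e : Env K Γ Δ` at the element `s` of `⟦Δ⟧` is the element `s'` of
`⟦Γ⟧`. -/
structure Env.Rel {K : Kit} {n m : ℕ} {Γ : CCtx n} {Δ : CCtx m} (e : Env K Γ Δ) (s : Δ.El)
    (s' : Γ.El) : Prop where
  env : Γ.env s' = fun i => (e.θ i).sem (Δ.env s)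
  val : ∀ {τ : CTy n} (y : CVar Γ τ), HEq ((K.toTm (e.val y)).sem s) (Psh.ofTop _ (y.sem s'))

structure Kit.Sound (K : Kit) : Prop where
  cast : ∀ {n : ℕ} {Γ : CCtx n} {τ τ' : CTy n} (h : τ = τ') (v : K.V Γ τ) (s : Γ.El),
    HEq ((K.toTm (K.cast h v)).sem s) ((K.toTm v).sem s)
  ofVar : ∀ {n : ℕ} {Γ : CCtx n} {τ : CTy n} (y : CVar Γ τ) (s : Γ.El),
    (K.toTm (K.ofVar y)).sem s = Psh.ofTop _ (y.sem s)
  wk : ∀ {n : ℕ} {Γ : CCtx n} {τ : CTy n} (τ' : CTy n) (v : K.V Γ τ) (s : Γ.El)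
    (x : (τ'.sem (Γ.env s)).obj top),
    HEq ((K.toTm (K.wk τ' v)).sem ⟨s, x⟩) ((K.toTm v).sem s)
  wkCtx : ∀ {n : ℕ} {Γ : CCtx n} {τ : CTy n} (v : K.V Γ τ) (s : Γ.El) (c : Dom),
    HEq ((K.toTm (K.wkCtx v)).sem ⟨s, c⟩) ((K.toTm v).sem s)

namespace Env.Rel

variable {K : Kit} {n m : ℕ} {Γ : CCtx n} {Δ : CCtx m} {e : Env K Γ Δ} {s : Δ.El} {s' : Γ.El}

theorem dctx (h : e.Rel s s') (Ψ : DCtx n) : (Ψ.sub e.θ).sem (Δ.env s) = Ψ.sem (Γ.env s') := by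
  rw [DCtx.sem_sub, h.env]

theorem ty (h : e.Rel s s') (τ : CTy n) : (τ.sub e.θ).sem (Δ.env s) = τ.sem (Γ.env s') := by
  rw [CTy.sem_sub, h.env]

theorem cons (h : e.Rel s s') {τ : CTy n} (v : K.V Δ (τ.sub e.θ))
    {x : (τ.sem (Γ.env s')).obj top} (hv : HEq ((K.toTm v).sem s) (Psh.ofTop _ x)) :
    (e.cons v).Rel s (⟨s', x⟩ : (Γ.tm τ).El) where
  env := h.env
  val
    | .zero => hv
    | .succ y => h.val y

theorem wk (hK : K.Sound) (h : e.Rel s s') (τ : CTy m) (x : (τ.sem (Δ.env s)).obj top) :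
    (e.wk τ).Rel (⟨s, x⟩ : (Δ.tm τ).El) s' where
  env := h.env
  val y := (hK.wk τ (e.val y) s x).trans (h.val y)

theorem lift (hK : K.Sound) (h : e.Rel s s') {τ : CTy n}
    {x : ((τ.sub e.θ).sem (Δ.env s)).obj top} {x' : (τ.sem (Γ.env s')).obj top} (hx : HEq x x') :
    (e.lift τ).Rel (⟨s, x⟩ : (Δ.tm (τ.sub e.θ)).El) (⟨s', x'⟩ : (Γ.tm τ).El) := by
  refine (h.wk hK (τ.sub e.θ) x).cons (K.ofVar .zero) ?_
  exact (heq_of_eq (hK.ofVar _ _)).trans (Psh.ofTop_heq (h.ty τ) hx)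

theorem ofTop_succCtx {τ : CTy n} (y : CVar Γ τ) (c : Dom) :
    HEq (Psh.ofTop _ (CVar.sem (.succCtx y) (⟨s', c⟩ : Γ.ctx.El))) (Psh.ofTop _ (y.sem s')) :=
  Psh.ofTop_heq (CTy.sem_weaken _ _ _) (cast_heq _ _)

theorem consCtx (hK : K.Sound) (h : e.Rel s s') (Ψ : DCtx m) :
    (e.consCtx Ψ).Rel s (⟨s', Ψ.sem (Δ.env s)⟩ : Γ.ctx.El) where
  env := vcons_ext rfl fun i => congrFun h.env i
  val
    | .succCtx y => ((hK.cast _ _ s).trans (h.val y)).trans (ofTop_succCtx y _).symm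

theorem liftCtx (hK : K.Sound) (h : e.Rel s s') (c : Dom) :
    e.liftCtx.Rel (⟨s, c⟩ : Δ.ctx.El) (⟨s', c⟩ : Γ.ctx.El) where
  env := vcons_ext rfl fun i => by
    refine (congrFun h.env i).trans ?_
    exact (DCtx.sem_sub (e.θ i) (fun j => .var j.succ) (vcons c (Δ.env s))).symm
  val
    | .succCtx y =>
      (((hK.cast _ _ _).trans (hK.wkCtx _ s c)).trans (h.val y)).trans (ofTop_succCtx y _).symm

theorem id (hK : K.Sound) (s : Γ.El) : (Env.id K Γ).Rel s s where
  env := rfl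
  val y := (hK.cast _ _ s).trans (heq_of_eq (hK.ofVar y s))

end Env.Rel

mutual

theorem DTm.sem_csub {K : Kit} (hK : K.Sound) : {n : ℕ} → {Γ : CCtx n} → {Ψ : DCtx n} →
    {A : DTy} → (M : DTm Γ Ψ A) → {m : ℕ} → {Δ : CCtx m} → {e : Env K Γ Δ} → {s : Δ.El} →
    {s' : Γ.El} → e.Rel s s' → HEq ((M.csub e).sem s) (M.sem s')
  | _, _, _, _, .var x, _, _, _, _, _, h =>
     lamU_yoneda_heq (h.dctx _) rfl (x.sem_csub _ _ h.env)
  | _, _, _, _, .cLam, _, _, _, _, _, h =>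
     lamU_constU_heq (h.dctx _) _
  | _, _, _, _, .cApp, _, _, _, _, _, h =>
     lamU_constU_heq (h.dctx _) _
  | _, _, _, _, .app M N, _, _, _, _, _, h =>
     lamU_arrowE_heq (h.dctx _) (M.sem_csub hK h) (N.sem_csub hK h)
  | _, _, _, _, .lam M, _, _, _, _, _, h =>
     lamU_curryU_heq (h.dctx _) (M.sem_csub hK h)
  | _, _, _, _, .unbox t σ, _, _, _, _, _, h =>
     letBox_comp_heq (h.dctx _) (h.dctx _) (t.sem_csub hK h) (σ.sem_csub hK h)
  | _, _, _, _, .unboxv t σ, _, _, _, _, _, h =>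
     letBox_compV_heq (h.dctx _) (h.dctx _) (t.sem_csub hK h) (σ.sem_csub hK h)

theorem DSub.sem_csub {K : Kit} (hK : K.Sound) : {n : ℕ} → {Γ : CCtx n} → {Φ Ψ : DCtx n} →
    (σ : DSub Γ Φ Ψ) → {m : ℕ} → {Δ : CCtx m} → {e : Env K Γ Δ} → {s : Δ.El} →
    {s' : Γ.El} → e.Rel s s' → HEq ((σ.csub e).sem s) (σ.sem s')
  | _, _, _, _, .wk w, _, _, _, _, _, h =>
     lamU_yoneda_heq (h.dctx _) (h.dctx _) (w.sem_csub _ _ h.env)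
  | _, _, _, _, .nil, _, _, _, _, _, h =>
     lamU_toUnit_heq (h.dctx _)
  | _, _, _, _, .snoc σ M, _, _, _, _, _, h =>
     lamU_pairU_heq (h.dctx _) (h.dctx _) (σ.sem_csub hK h) (M.sem_csub hK h)

theorem VObj.sem_csub {K : Kit} (hK : K.Sound) : {n : ℕ} → {Γ : CCtx n} → {Ψ : DCtx n} →
    {A : DTy} → (C : VObj Γ Ψ A) → {m : ℕ} → {Δ : CCtx m} → {e : Env K Γ Δ} → {s : Δ.El} →
    {s' : Γ.El} → e.Rel s s' → HEq ((C.csub e).sem s) (C.sem s')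
  | _, _, _, _, .var x, _, _, _, _, _, h =>
     projV_heq (h.dctx _) (x.sem_csub _ _ h.env) ((x.csub _).sem_isProj _)
      (x.sem_isProj _)
  | _, _, _, _, .unbox t w, _, _, _, _, _, h =>
     letBox_precompV_heq (h.dctx _) (h.dctx _) (t.sem_csub hK h) (w.sem_csub _ _ h.env) _ _

theorem CTm.sem_csub {K : Kit} (hK : K.Sound) : {n : ℕ} → {Γ : CCtx n} → {τ : CTy n} →
    (t : CTm Γ τ) → {m : ℕ} → {Δ : CCtx m} → {e : Env K Γ Δ} → {s : Δ.El} →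
    {s' : Γ.El} → e.Rel s s' → HEq ((t.csub e).sem s) (t.sem s')
  | _, _, _, .var y, _, _, _, _, _, h =>
     h.val y
  | _, _, _, .box M, _, _, _, _, _, h =>
     boxIntro_heq (fn_el_eq (h.dctx _) rfl) (M.sem_csub hK h)
  | _, _, _, .boxv C, _, _, _, _, _, h =>
     boxIntro_heq (fnV_eq (h.dctx _) _) (C.sem_csub hK h)
  | _, _, _, .fn t, _, _, _, _, _, h =>
     crispLam_heq (h.ty _) (h.ty _) fun x x' hx => t.sem_csub hK (h.lift hK hx)
  | _, _, _, .fnCtx t, _, _, _, _, _, h =>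
     crispLam_obj_heq (funext fun c => (h.liftCtx hK c).ty _)
      fun c => t.sem_csub hK (h.liftCtx hK c)
  | _, _, _, .app t r, _, _, _, _, _, h =>
     crispApp_heq (h.ty _) (h.ty _) (t.sem_csub hK h) (r.sem_csub hK h)
  | _, _, _, .appCtx t Ψ hτ, _, _, _, _, _, h => by
    refine (Glob.cast_heq _ _).trans (HEq.trans ?_ (Glob.cast_heq _ _).symm)
    exact crispApp_obj_heq (funext fun c => (h.liftCtx hK c).ty _) (t.sem_csub hK h) (h.dctx Ψ)
  | _, _, _, .recTm τ bv ba hl bl Ψ t hτ, _, _, _, _, _, h => by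
    refine (Glob.cast_heq _ _).trans (HEq.trans ?_ (Glob.cast_heq _ _).symm)
    refine Psh.ofTop_heq ?_ (recSem_heq ?_ ?_ ?_ ?_ (h.dctx Ψ) ?_)
    · rw [h.dctx Ψ]
      exact (h.liftCtx hK _).ty τ
    · exact funext fun c => congrArg (fun X : Psh => X.obj top) ((h.liftCtx hK c).ty τ)
    · intro c p
      exact Glob.top_heq ((h.liftCtx hK c).ty τ)
        (bv.sem_csub hK ((h.liftCtx hK c).lift hK (HEq.refl p)))
    · intro c m n a b a' b' ha hb
      exact Glob.top_heq ((h.liftCtx hK c).ty τ)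
        (ba.sem_csub hK (((((h.liftCtx hK c).lift hK (HEq.refl m)).lift hK (HEq.refl n)).lift hK
          ha).lift hK hb))
    · intro c m a a' ha
      exact Glob.top_heq ((h.liftCtx hK c).ty τ)
        (bl.sem_csub hK (((h.liftCtx hK c).lift hK (HEq.refl m)).lift hK
          ((cast_heq _ _).trans (ha.trans (cast_heq _ _).symm))))
    · exact Glob.top_heq (congrArg flat.obj (fn_el_eq (h.dctx Ψ) rfl)) (t.sem_csub hK h)

end

theorem Kit.ren_sound : Kit.ren.Sound where
  cast h y s := by subst h; rfl
  ofVar _ _ := rfl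
  wk _ _ _ _ := HEq.rfl
  wkCtx y _ c := Env.Rel.ofTop_succCtx y c

namespace CTm

variable {n : ℕ} {Γ : CCtx n}

theorem sem_cast {τ τ' : CTy n} (h : τ = τ') (t : CTm Γ τ) (s : Γ.El) :
    HEq ((t.cast h).sem s) (t.sem s) := by
  subst h; rfl

theorem sem_wk {τ : CTy n} (t : CTm Γ τ) (τ' : CTy n) (s : Γ.El)
    (x : (τ'.sem (Γ.env s)).obj top) : HEq ((t.wk τ').sem ⟨s, x⟩) (t.sem s) :=
  (sem_cast _ _ _).trans (t.sem_csub Kit.ren_sound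
    ((Env.Rel.id Kit.ren_sound s).wk Kit.ren_sound τ' x))

theorem sem_wkCtx {τ : CTy n} (t : CTm Γ τ) (s : Γ.El) (c : Dom) :
    HEq (t.wkCtx.sem ⟨s, c⟩) (t.sem s) :=
  t.sem_csub Kit.ren_sound ⟨rfl, fun y => Env.Rel.ofTop_succCtx y c⟩

end CTm

theorem Kit.sub_sound : Kit.sub.Sound where
  cast h t s := t.sem_cast h s
  ofVar _ _ := rfl
  wk τ' t s x := t.sem_wk τ' s x
  wkCtx t s c := t.sem_wkCtx s c

namespace CTm

variable {n : ℕ} {Γ : CCtx n}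

theorem sem_inst {τ τ' : CTy n} (t : CTm (Γ.tm τ') τ) (r : CTm Γ τ') (s : Γ.El) :
    (t.inst r).sem s = t.sem ⟨s, (r.sem s).1 top⟩ := by
  refine eq_of_heq ((sem_cast _ _ _).trans (t.sem_csub Kit.sub_sound
    ((Env.Rel.id Kit.sub_sound s).cons _ ((r.sem_cast _ s).trans (heq_of_eq ?_)))))
  exact (r.sem s).ofTop_top.symm

end CTm

theorem Env.Rel.cons_sub {n m : ℕ} {Γ : CCtx n} {Δ : CCtx m} {e : Env Kit.sub Γ Δ} {s : Δ.El}
    {s' : Γ.El} (h : e.Rel s s') {τ : CTy n} (r : CTm Δ (τ.sub e.θ))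
    {x : (τ.sem (Γ.env s')).obj top} (hx : HEq ((r.sem s).1 top) x) :
    (e.cons (τ := τ) r).Rel s (⟨s', x⟩ : (Γ.tm τ).El) :=
  h.cons r ((heq_of_eq (r.sem s).ofTop_top.symm).trans (Psh.ofTop_heq (h.ty τ) hx))

theorem instCtx_rel {n : ℕ} (Γ : CCtx n) (Ψ : DCtx n) (s : Γ.El) :
    (instCtx Γ Ψ).Rel s (⟨s, Ψ.sem (Γ.env s)⟩ : Γ.ctx.El) :=
  (Env.Rel.id Kit.sub_sound s).consCtx Kit.sub_sound Ψ

theorem VObj.sem_toDTm {n : ℕ} {Γ : CCtx n} {Ψ : DCtx n} {A : DTy} (C : VObj Γ Ψ A) (s : Γ.El) :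
    C.toDTm.sem s = (C.sem s).map (inclV _ _) := by
  cases C with
  | var x => rfl
  | unbox t w =>
    apply Glob.hom_ext
    refine (DTm.hom_unboxv s t (.wk w)).trans ?_
    rw [DSub.hom_wk, Glob.hom_eq]
    refine Eq.symm ((FunAt.app_eq (Subtype.val ((Psh.ofTop (FnV _ _) ((t.sem s).1 top)).1 top))
      _ _).trans ?_)
    refine congrArg₂ (· ≫ ·) (Category.id_comp _) ?_
    exact congrArg (fun f => FunAt.app (Subtype.val f) (Dom.toUnit _) (𝟙 _))
      (Psh.top_ofTop (FnV _ _) _)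

theorem VObj.sem_congr {n : ℕ} {Γ : CCtx n} {Ψ : DCtx n} {A : DTy} {C D : VObj Γ Ψ A} {s : Γ.El}
    (h : C.toDTm.sem s = D.toDTm.sem s) : C.sem s = D.sem s := by
  rw [sem_toDTm, sem_toDTm] at h
  exact Glob.ext_top (Subtype.ext (congrFun (congrArg Subtype.val h) top))

theorem CTm.boxHom_box {n : ℕ} {Γ : CCtx n} {Ψ : DCtx n} {A : DTy} (M : DTm Γ Ψ A) (s : Γ.El) :
    (CTm.box M).boxHom s = M.hom s :=
  (Glob.hom_eq (M.sem s)).symm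

theorem CTm.boxvHom_boxv {n : ℕ} {Γ : CCtx n} {Ψ : DCtx n} {A : DTy} (C : VObj Γ Ψ A)
    (s : Γ.El) : (CTm.boxv C).boxvHom s = C.toDTm.hom s := by
  rw [DTm.hom, C.sem_toDTm s, Glob.hom_eq]
  rfl

theorem DTm.boxTm_app {n : ℕ} {Γ : CCtx n} {Ψ : DCtx n} (M N : DTm Γ Ψ .tm) (s : Γ.El) :
    ((CTm.box (.app (.app .cApp M) N)).sem s).1 top =
      app' (((CTm.box M).sem s).1 top) (((CTm.box N).sem s).1 top) := by
  apply BoxTm.cls_injective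
  refine (Glob.hom_eq (DTm.sem (.app (.app .cApp M) N) s)).symm.trans ?_
  refine Eq.trans ?_ (BoxTm.cls_app' _ _).symm
  refine Eq.trans ?_ (congrArg₂ semApp (Glob.hom_eq (M.sem s)) (Glob.hom_eq (N.sem s)))
  refine (DTm.hom_app _ _ _).trans ?_
  rw [DTm.hom_app, DTm.hom_cApp]
  rfl

theorem DTm.boxTm_lam {n : ℕ} {Γ : CCtx n} {Ψ : DCtx n} (M : DTm Γ (Ψ.snoc .tm) .tm)
    (s : Γ.El) : ((CTm.box (.app .cLam (.lam M))).sem s).1 top =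
      lam' (((CTm.box M).sem s).1 top) := by
  apply BoxTm.cls_injective
  refine (Glob.hom_eq (DTm.sem (.app .cLam (.lam M)) s)).symm.trans ?_
  refine Eq.trans ?_ (BoxTm.cls_lam' _).symm
  refine Eq.trans ?_ (congrArg (fun m => Dom.app (Dom.cLam _) (Dom.lam m)) (Glob.hom_eq (M.sem s)))
  refine (DTm.hom_app _ _ _).trans ?_
  rw [DTm.hom_lam, DTm.hom_cLam]
  rfl

section
variable {n : ℕ} {Γ : CCtx n} (τ : CTy (n + 1)) {τl : CTy (n + 1)}
  (bv : CTm (Γ.ctx.tm (.boxv (.var 0) .tm)) τ)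
  (ba : CTm ((((Γ.ctx.tm (.box (.var 0) .tm)).tm (.box (.var 0) .tm)).tm τ).tm τ) τ)
  (hl : τ.extTm = τl)
  (bl : CTm ((Γ.ctx.tm (.box (.snoc (.var 0) .tm) .tm)).tm τl) τ)

/-- The function interpreting a recursor. -/
noncomputable def recFun (s : Γ.El) (c : Dom) (m : BoxTm c) :
    (τ.sem (vcons c (Γ.env s))).obj top :=
  recSem (R := fun c => (τ.sem (vcons c (Γ.env s))).obj top)
    (fun c p => (bv.sem ⟨⟨s, c⟩, p⟩).1 top)
    (fun c m n a b => (ba.sem ⟨⟨⟨⟨⟨s, c⟩, m⟩, n⟩, a⟩, b⟩).1 top)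
    (fun c m a => (bl.sem ⟨⟨⟨s, c⟩, m⟩,
      cast (congrArg (fun X : Psh => X.obj top) (by rw [← hl]; exact (τ.sem_extTm _ _).symm))
        a⟩).1 top) c m

theorem sem_recTm (s : Γ.El) (Ψ : DCtx n) (t : CTm Γ (.box Ψ .tm)) {τ' : CTy n}
    (h : τ.inst Ψ = τ') {m : BoxTm (Ψ.sem (Γ.env s))} (hm : (t.sem s).1 top = m) :
    HEq (((CTm.recTm τ bv ba hl bl Ψ t h).sem s).1 top)
      (recFun τ bv ba hl bl s (Ψ.sem (Γ.env s)) m) := by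
  subst hm h
  exact (Glob.top_heq (CTy.sem_inst _ _ _) (Glob.cast_heq _ _)).trans
    (heq_of_eq (Psh.top_ofTop _ _))

theorem recFun_congr {bv bv' : CTm (Γ.ctx.tm (.boxv (.var 0) .tm)) τ}
    {ba ba' : CTm ((((Γ.ctx.tm (.box (.var 0) .tm)).tm (.box (.var 0) .tm)).tm τ).tm τ) τ}
    {bl bl' : CTm ((Γ.ctx.tm (.box (.snoc (.var 0) .tm) .tm)).tm τl) τ}
    (hv : ∀ s, bv.sem s = bv'.sem s) (ha : ∀ s, ba.sem s = ba'.sem s)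
    (hb : ∀ s, bl.sem s = bl'.sem s) (s : Γ.El) (c : Dom) (m : BoxTm c) :
    recFun τ bv ba hl bl s c m = recFun τ bv' ba' hl bl' s c m := by
  refine eq_of_heq (recSem_heq rfl (fun c p => ?_) (fun c m n a b a' b' h h' => ?_)
    (fun c m a a' h => ?_) rfl HEq.rfl)
  · exact Glob.top_heq rfl (heq_of_eq (hv _))
  · cases h
    cases h'
    exact Glob.top_heq rfl (heq_of_eq (ha _))
  · cases h
    exact Glob.top_heq rfl (heq_of_eq (hb _))

theorem recFun_toTm (s : Γ.El) (c : Dom) (p : BoxVar c) :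
    recFun τ bv ba hl bl s c p.toTm = (bv.sem ⟨⟨s, c⟩, p⟩).1 top :=
  recSem_toTm _ _

theorem recFun_app' (s : Γ.El) (c : Dom) (m n : BoxTm c) :
    recFun τ bv ba hl bl s c (app' m n) =
      (ba.sem ⟨⟨⟨⟨⟨s, c⟩, m⟩, n⟩, recFun τ bv ba hl bl s c m⟩,
        recFun τ bv ba hl bl s c n⟩).1 top :=
  recSem_app' _ _ _

theorem recFun_lam' (s : Γ.El) (c : Dom) (m : BoxTm (Dom.times c .tm)) :
    recFun τ bv ba hl bl s c (lam' m) = (bl.sem ⟨⟨⟨s, c⟩, m⟩,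
      cast (congrArg (fun X : Psh => X.obj top) (by rw [← hl]; exact (τ.sem_extTm _ _).symm))
        (recFun τ bv ba hl bl s _ m)⟩).1 top :=
  recSem_lam' _ _

end

mutual

theorem DTm.Eqv.sem_eq : {n : ℕ} → {Γ : CCtx n} → {Ψ : DCtx n} → {A : DTy} →
    {M N : DTm Γ Ψ A} → M.Eqv N → ∀ s, M.sem s = N.sem s
  | _, _, _, _, _, _, .refl _, _ => rfl
  | _, _, _, _, _, _, .symm h, s => (h.sem_eq s).symm
  | _, _, _, _, _, _, .trans h h', s => (h.sem_eq s).trans (h'.sem_eq s)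
  | _, _, _, _, _, _, .app h h', s => Glob.hom_ext <| by
    refine (DTm.hom_app _ _ _).trans (Eq.trans ?_ (DTm.hom_app _ _ _).symm)
    exact congrArg₂ (fun m n => Dom.app (Glob.hom m) (Glob.hom n)) (h.sem_eq s) (h'.sem_eq s)
  | _, _, _, _, _, _, .lam h, s => Glob.hom_ext <| by
    refine (DTm.hom_lam _ _).trans (Eq.trans ?_ (DTm.hom_lam _ _).symm)
    exact congrArg (fun m => Dom.lam (Glob.hom m)) (h.sem_eq s)
  | _, _, _, _, _, _, .unbox h h', s => Glob.hom_ext <| by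
    refine (DTm.hom_unbox _ _ _).trans (Eq.trans ?_ (DTm.hom_unbox _ _ _).symm)
    rw [CTm.boxHom, CTm.boxHom, DSub.hom, DSub.hom, h.sem_eq s, h'.sem_eq s]
  | _, _, _, _, _, _, .unboxv h h', s => Glob.hom_ext <| by
    refine (DTm.hom_unboxv _ _ _).trans (Eq.trans ?_ (DTm.hom_unboxv _ _ _).symm)
    rw [CTm.boxvHom, CTm.boxvHom, DSub.hom, DSub.hom, h.sem_eq s, h'.sem_eq s]
  | _, _, _, _, _, _, .beta M N, s => Glob.hom_ext <| by
    refine (DTm.hom_app _ _ _).trans (Eq.trans ?_ (DTm.hom_sub s M _).symm)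
    rw [DTm.hom_lam, DSub.hom_snoc, DSub.hom_wk]
    exact Dom.app_lam _ _
  | _, _, _, _, _, _, .eta M, s => Glob.hom_ext <| by
    refine Eq.symm ((DTm.hom_lam _ _).trans ?_)
    rw [DTm.hom_app, DTm.hom_ren, DTm.hom_var, Ope.sem, Wk.sem_one]
    exact Dom.lam_eta _
  | _, _, _, _, _, _, .unbox_box M σ, s => Glob.hom_ext <| by
    refine (DTm.hom_unbox _ _ _).trans (Eq.trans ?_ (DTm.hom_sub s M σ).symm)
    rw [CTm.boxHom_box]
  | _, _, _, _, _, _, .unboxv_boxv C σ, s => Glob.hom_ext <| by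
    refine (DTm.hom_unboxv _ _ _).trans (Eq.trans ?_ (DTm.hom_sub s C.toDTm σ).symm)
    rw [CTm.boxvHom_boxv]

theorem DSub.Eqv.sem_eq : {n : ℕ} → {Γ : CCtx n} → {Φ Ψ : DCtx n} →
    {σ σ' : DSub Γ Φ Ψ} → σ.Eqv σ' → ∀ s, σ.sem s = σ'.sem s
  | _, _, _, _, _, _, .refl _, _ => rfl
  | _, _, _, _, _, _, .symm h, s => (h.sem_eq s).symm
  | _, _, _, _, _, _, .trans h h', s => (h.sem_eq s).trans (h'.sem_eq s)
  | _, _, _, _, _, _, .snoc h h', s => Glob.hom_ext <| by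
    refine (DSub.hom_snoc _ _ _).trans (Eq.trans ?_ (DSub.hom_snoc _ _ _).symm)
    exact congrArg₂ (fun m n => Dom.pair (Glob.hom m) (Glob.hom n)) (h.sem_eq s) (h'.sem_eq s)
  | _, _, _, _, _, _, .nil_eta σ, s => Glob.hom_ext (Dom.toUnit_unique _ _)
  | _, _, _, _, _, _, .wk_eta w, s => Glob.hom_ext <| by
    refine (DSub.hom_wk _ _).trans (Eq.trans ?_ (DSub.hom_snoc _ _ _).symm)
    rw [DSub.hom_wk, DTm.hom_var, Wk.sem_trans, Wk.sem_one, Wk.sem_var]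
    exact (Dom.pair_eta _).symm

theorem CTm.Eqv.sem_eq : {n : ℕ} → {Γ : CCtx n} → {τ : CTy n} → {t t' : CTm Γ τ} →
    t.Eqv t' → ∀ s, t.sem s = t'.sem s
  | _, _, _, _, _, .refl _, _ => rfl
  | _, _, _, _, _, .symm h, s => (h.sem_eq s).symm
  | _, _, _, _, _, .trans h h', s => (h.sem_eq s).trans (h'.sem_eq s)
  | _, _, _, _, _, .box h, s => congrArg boxIntro (h.sem_eq s)
  | _, _, _, _, _, .boxv h, s => congrArg boxIntro (VObj.sem_congr (h.sem_eq s))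
  | _, _, _, _, _, .fn h, s => congrArg crispLam (funext fun x => h.sem_eq ⟨s, x⟩)
  | _, _, _, _, _, .fnCtx h, s =>
    congrArg (crispLam (X := Obj)) (funext fun c => h.sem_eq ⟨s, c⟩)
  | _, _, _, _, _, .app h h', s =>
    eq_of_heq (crispApp_heq rfl rfl (heq_of_eq (h.sem_eq s)) (heq_of_eq (h'.sem_eq s)))
  | _, _, _, _, _, .appCtx Ψ hτ h, s => by
    refine eq_of_heq ((Glob.cast_heq _ _).trans (HEq.trans ?_ (Glob.cast_heq _ _).symm))
    exact crispApp_obj_heq rfl (heq_of_eq (h.sem_eq s)) rfl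
  | _, _, _, _, _, .recTm τ hl Ψ hτ hv ha hb ht, s => Glob.ext_top <| by
    refine eq_of_heq ((sem_recTm τ _ _ hl _ s Ψ _ hτ (congrArg (fun m => m.1 top)
      (ht.sem_eq s))).trans (HEq.trans (heq_of_eq ?_) (sem_recTm τ _ _ hl _ s Ψ _ hτ rfl).symm))
    exact recFun_congr τ hl hv.sem_eq ha.sem_eq hb.sem_eq s _ _
  | _, _, _, _, _, .fn_beta t r, s => (t.sem_inst r s).symm
  | _, _, _, _, _, .fn_eta t, s => Subtype.ext <| funext fun Φ => funext fun x => by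
    refine Eq.symm (Eq.trans ?_ (congrArg ((t.sem s).1 Φ) (Psh.top_ofTop _ x)))
    exact congrArg (fun m : Glob (CrispFn _ fun _ => _) => m.1 Φ _) (eq_of_heq (t.sem_wk _ s x))
  | _, _, _, _, _, .fnCtx_beta t Ψ, s =>
    eq_of_heq ((Glob.cast_heq _ _).trans (t.sem_csub Kit.sub_sound (instCtx_rel _ Ψ s)).symm)
  | _, _, _, _, _, .fnCtx_eta t, s => by
    refine eq_of_heq (crispLam_obj_heq (m := fun c => crispApp (X := Obj) (t.sem s) (objGlob c))
      rfl fun c => HEq.trans ?_ (Glob.cast_heq _ _).symm)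
    refine crispApp_obj_heq (funext fun c' => ?_) (t.sem_wkCtx s c).symm rfl
    refine Eq.symm ((CTy.sem_sub _ _ _).trans ?_)
    exact congrArg (CTy.sem _) (vcons_ext rfl fun _ => rfl)
  | _, _, _, _, _, .box_eta t, s => Glob.ext_top <| FunAt.ext_hom <| by
    refine Eq.symm ((Glob.hom_eq _).symm.trans ((DTm.hom_unbox s t (.wk .refl)).trans ?_))
    rw [DSub.hom_wk]
    exact Category.id_comp _
  | _, _, _, _, _, .boxv_eta t, s => Glob.ext_top <| Subtype.ext <| FunAt.ext_hom <| by
    refine Eq.symm (Eq.trans (congrArg (FunAt.app · _ _)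
      (congrFun (congrArg Subtype.val (VObj.sem_toDTm (.unbox t .refl) s)) top)).symm ?_)
    refine (Glob.hom_eq _).symm.trans ((DTm.hom_unboxv s t (.wk .refl)).trans ?_)
    rw [DSub.hom_wk]
    exact Category.id_comp _
  | _, Γ, _, _, _, .rec_var τ bv ba hl bl Ψ C, s => Glob.ext_top <| by
    have h := bv.sem_csub Kit.sub_sound
      ((instCtx_rel Γ Ψ s).cons_sub (τ := .boxv (.var 0) .tm) (.boxv C) HEq.rfl)
    refine eq_of_heq ((sem_recTm τ bv ba hl bl s Ψ (.box C.toDTm) rfl (m := BoxVar.toTm ((C.sem s).1 top))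
      (congrFun (congrArg Subtype.val (C.sem_toDTm s)) top)).trans ?_)
    exact (heq_of_eq (recFun_toTm _ _ _ _ _ _ _ _)).trans
      (Glob.top_heq ((instCtx_rel Γ Ψ s).ty τ) h).symm
  | _, Γ, _, _, _, .rec_app τ bv ba hl bl Ψ M N, s => Glob.ext_top <| by
    have h := ba.sem_csub Kit.sub_sound
      (((((instCtx_rel Γ Ψ s).cons_sub (τ := .box (.var 0) .tm) (.box M) HEq.rfl).cons_sub
        (τ := .box (.var 0) .tm) (.box N) HEq.rfl).cons_sub (τ := τ)
        (.recTm τ bv ba hl bl Ψ (.box M) rfl) (sem_recTm τ bv ba hl bl s Ψ _ rfl rfl)).cons_sub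
        (τ := τ) (.recTm τ bv ba hl bl Ψ (.box N) rfl) (sem_recTm τ bv ba hl bl s Ψ _ rfl rfl))
    refine eq_of_heq ((sem_recTm τ bv ba hl bl s Ψ _ rfl (DTm.boxTm_app M N s)).trans ?_)
    exact (heq_of_eq (recFun_app' _ _ _ _ _ _ _ _ _)).trans
      (Glob.top_heq ((instCtx_rel Γ Ψ s).ty τ) h).symm
  | _, Γ, _, _, _, .rec_lam τ bv ba hl bl Ψ M, s => Glob.ext_top <| by
    subst hl
    have hτ : τ.inst (.snoc Ψ .tm) = τ.extTm.sub (instCtx Γ Ψ).θ :=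
      (CTy.extTm_sub_vcons τ Ψ).symm
    have hr := (sem_recTm τ bv ba rfl bl s (Ψ.snoc .tm) (.box M) hτ rfl).trans
      (cast_heq (congrArg (fun X : Psh => X.obj top)
        (τ.sem_extTm (Ψ.sem (Γ.env s)) (Γ.env s)).symm) _).symm
    have h := bl.sem_csub Kit.sub_sound
      (((instCtx_rel Γ Ψ s).cons_sub (τ := .box (.snoc (.var 0) .tm) .tm) (.box M)
        HEq.rfl).cons_sub (τ := τ.extTm) (.recTm τ bv ba rfl bl (Ψ.snoc .tm) (.box M) hτ) hr)
    refine eq_of_heq ((sem_recTm τ bv ba rfl bl s Ψ _ rfl (DTm.boxTm_lam M s)).trans ?_)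
    exact (heq_of_eq (recFun_lam' _ _ _ _ _ _ _ _)).trans
      (Glob.top_heq ((instCtx_rel Γ Ψ s).ty τ) h).symm

end

end Cocon

theorem mainTheorem2 :
    (∀ (n : ℕ) (Γ : Cocon.CCtx n) (Ψ : Cocon.DCtx n) (A : Cocon.DTy) (M N : Cocon.DTm Γ Ψ A),
      M.Eqv N → M.interp = N.interp) ∧
    (∀ (n : ℕ) (Γ : Cocon.CCtx n) (Ψ Φ : Cocon.DCtx n) (σ σ' : Cocon.DSub Γ Ψ Φ),
      σ.Eqv σ' → σ.interp = σ'.interp) ∧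
    (∀ (n : ℕ) (Γ : Cocon.CCtx n) (τ : Cocon.Disc n) (t₁ t₂ : Cocon.Arg Γ τ),
      t₁.Eqv t₂ → t₁.interp = t₂.interp) ∧
    Cocon.flat ⋙ Cocon.flat = Cocon.flat := by
  refine ⟨fun _ _ _ _ _ _ h => congrArg Cocon.Section.mk (funext h.sem_eq),
    fun _ _ _ _ _ _ h => congrArg Cocon.Section.mk (funext h.sem_eq), ?_, rfl⟩
  rintro n Γ (τ | _) t₁ t₂ h
  · exact congrArg Cocon.Section.mk (funext (Cocon.CTm.Eqv.sem_eq h))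
  · exact congrArg Cocon.Arg.interp h
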